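/- Let $I=[0,1]$ and let $C(I)$ be the Polish space of continuous maps $I\to I$ with the topology of uniform convergence. Call $f,g\in C(I)$ conjugate if $h\circ f=g\circ h$ for some homeomorphism $h\colon I\to I$ (orientation-preserving or orientation-reversing). For equivalence relations $E$, $F$ on standard Borel spaces $X$, $Y$, say that $E$ is Borel reducible to $F$ if there is a Borel map $\varphi\colon X\to Y$ such that $x\mathrel{E}x'\iff\varphi(x)\mathrel{F}\varphi(x')$ for all $x,x'\in X$, and that $E$ and $F$ are Borel bireducible if each is Borel reducible to the other. Let $S_\infty$ be the group of all permutations of $\mathbb N$ with the topology of pointwise convergence. A universal $S_\infty$-orbit equivalence relation, denoted $E_{S_\infty}$, is an orbit equivalence relation of a continuous action of $S_\infty$ on a Polish space to which the orbit equivalence relation of every continuous action of $S_\infty$ on a Polish space is Borel reducible. Theorem. Such a relation $E_{S_\infty}$ exists, and the conjugacy relation on $C(I)$ is Borel bireducible to every such relation $E_{S_\infty}$. Moreover, conjugacy on $C(I)$ is classifiable by countable structures, that is, for some countable relational language $L$ it is Borel reducible to the isomorphism relation of $L$-structures with universe $\mathbb N$; and it is Borel bireducible to the isomorphism relation of graphs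 with vertex set $\mathbb N$. -/

import Mathlib

open scoped unitInterval

universe u v

namespace BorelComplexity

/-! ### Borel reducibility of equivalence relations on standard Borel spaces -/

/-- `E` is Borel reducible to `F`: there is a Borel map `f` with `x E x' ↔ f x F f x'`. -/
def BorelReducible {X : Type u} {Y : Type v} [MeasurableSpace X] [StandardBorelSpace X]
    [MeasurableSpace Y] [StandardBorelSpace Y] (E : Setoid X) (F : Setoid Y) : Prop :=
  ∃ f : X → Y, Measurable f ∧ ∀ x x' : X, E x x' ↔ F (f x) (f x')

/-- `E` and `F` are Borel bireducible: each of them is Borel reducible to the other. -/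
def BorelBireducible {X : Type u} {Y : Type v} [MeasurableSpace X] [StandardBorelSpace X]
    [MeasurableSpace Y] [StandardBorelSpace Y] (E : Setoid X) (F : Setoid Y) : Prop :=
  BorelReducible E F ∧ BorelReducible F E

/-- A measurable space that embeds measurably, with measurable image, into a standard Borel space
is standard Borel. -/
theorem standardBorelSpace_of_measurableEmbedding {X : Type u} {Y : Type v} [MeasurableSpace X]
    [MeasurableSpace Y] [StandardBorelSpace Y] {f : X → Y} (hf : MeasurableEmbedding f) :
    StandardBorelSpace X := by
  obtain ⟨t, hB, hP, hc, _⟩ := hf.measurableSet_range.isClopenable'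
  let tX : TopologicalSpace X := t.induced f
  have hcl : Topology.IsClosedEmbedding f := ⟨⟨⟨rfl⟩, hf.injective⟩, hc⟩
  have hPX : PolishSpace X := hcl.polishSpace
  have hBX : BorelSpace X := by
    constructor
    rw [← hf.comap_eq, hB.measurable_eq, borel_comap]
  exact ⟨tX, hBX, hPX⟩

/-! ### The group `S_∞` and the universal `S_∞`-orbit equivalence relation -/

/-- The group `S_∞` of all permutations of `ℕ`, with the topology of pointwise convergence, that
is, the topology inherited from the Baire space `ℕ → ℕ`. -/
instance instTopologicalSpacePermNat : TopologicalSpace (Equiv.Perm ℕ) :=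
  TopologicalSpace.induced (fun (g : Equiv.Perm ℕ) (n : ℕ) => g n) inferInstance

/-- `E` is the orbit equivalence relation of a continuous action of `S_∞` on the space `X` for some
Polish topology on `X` whose Borel sets are the given measurable sets. -/
def IsPolishSInftyOrbitRel {X : Type u} [MeasurableSpace X] (E : Setoid X) : Prop :=
  ∃ (_ : TopologicalSpace X) (_ : MulAction (Equiv.Perm ℕ) X),
    PolishSpace X ∧ BorelSpace X ∧ ContinuousSMul (Equiv.Perm ℕ) X ∧
      E = MulAction.orbitRel (Equiv.Perm ℕ) X

/-- `E` is a universal `S_∞`-orbit equivalence relation (an incarnation of `E_{S_∞}`): it is the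
orbit equivalence relation of a continuous action of `S_∞` on a Polish space, and every such
orbit equivalence relation is Borel reducible to it. As every Polish space is homeomorphic to
one whose points form a type in `Type`, it is enough to let `Y` range over `Type`. -/
def IsUniversalSInftyOrbitRel {X : Type u} [MeasurableSpace X] [StandardBorelSpace X]
    (E : Setoid X) : Prop :=
  IsPolishSInftyOrbitRel E ∧
    ∀ (Y : Type) [MeasurableSpace Y] [StandardBorelSpace Y] (F : Setoid Y),
      IsPolishSInftyOrbitRel F → BorelReducible F E

/-! ### Classification by countable structures -/

/-- The Borel structure on the space of `L`-structures with universe `ℕ`, for a relational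
language `L`: it is generated by the sets of those structures in which `R(v)` holds, where `R` is
a relation symbol and `v` a tuple of natural numbers. -/
instance instMeasurableSpaceStructure (L : FirstOrder.Language.{0, 0}) [L.IsRelational] :
    MeasurableSpace (L.Structure ℕ) :=
  MeasurableSpace.comap
    (fun (S : L.Structure ℕ) (R : Σ n, L.Relations n) (v : Fin R.1 → ℕ) => S.RelMap R.2 v)
    inferInstance

instance instStandardBorelSpaceStructure (L : FirstOrder.Language.{0, 0}) [L.IsRelational]
    [Countable (Σ n, L.Relations n)] : StandardBorelSpace (L.Structure ℕ) := by
  let φ : L.Structure ℕ → ((R : Σ n, L.Relations n) → (Fin R.1 → ℕ) → Prop) :=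
    fun S R v => S.RelMap R.2 v
  have hinj : Function.Injective φ := by
    intro S T h
    ext n R v
    · exact isEmptyElim R
    · exact iff_of_eq (congrFun (congrFun h ⟨n, R⟩) v)
  have hsurj : Function.Surjective φ := by
    intro r
    exact ⟨{ funMap := fun f => isEmptyElim f, RelMap := fun {n} R v => r ⟨n, R⟩ v }, rfl⟩
  have hemb : MeasurableEmbedding φ :=
    { injective := hinj
      measurable := comap_measurable φ
      measurableSet_image' := by
        rintro s ⟨t, ht, rfl⟩
        rwa [Set.image_preimage_eq t hsurj] }
  exact standardBorelSpace_of_measurableEmbedding hemb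

/-- Isomorphism of `L`-structures with universe `ℕ`. -/
def structureIso (L : FirstOrder.Language.{0, 0}) : Setoid (L.Structure ℕ) where
  r S T := Nonempty (@FirstOrder.Language.Equiv L ℕ ℕ S T)
  iseqv :=
    { refl := fun S => ⟨@FirstOrder.Language.Equiv.refl L ℕ S⟩
      symm := fun {S T} ⟨e⟩ => ⟨@FirstOrder.Language.Equiv.symm L ℕ ℕ S T e⟩
      trans := fun {S T U} ⟨e⟩ ⟨e'⟩ => ⟨@FirstOrder.Language.Equiv.comp L ℕ ℕ S T ℕ U e' e⟩ }

/-- `E` is classifiable by countable structures: it is Borel reducible to isomorphism of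
`L`-structures with universe `ℕ` for some countable relational language `L`. -/
def ClassifiableByCountableStructures {X : Type u} [MeasurableSpace X] [StandardBorelSpace X]
    (E : Setoid X) : Prop :=
  ∃ (L : FirstOrder.Language.{0, 0}) (_ : L.IsRelational) (_ : Countable (Σ n, L.Relations n)),
    BorelReducible E (structureIso L)

/-! ### Isomorphism of countable graphs -/

/-- The space of graphs with vertex set `ℕ` is standard Borel (its Borel structure is generated by
the sets of graphs in which two given vertices are adjacent). -/
instance instStandardBorelSpaceSimpleGraphNat : StandardBorelSpace (SimpleGraph ℕ) :=
  have : StandardBorelSpace (Set (Sym2 ℕ)) :=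
    inferInstanceAs (StandardBorelSpace (Sym2 ℕ → Prop))
  standardBorelSpace_of_measurableEmbedding SimpleGraph.measurableEmbedding_edgeSet

/-- Isomorphism of graphs with vertex set `ℕ`. -/
def graphIso : Setoid (SimpleGraph ℕ) where
  r G H := Nonempty (G ≃g H)
  iseqv :=
    { refl := fun _ => ⟨SimpleGraph.Iso.refl⟩
      symm := fun ⟨e⟩ => ⟨e.symm⟩
      trans := fun ⟨e⟩ ⟨e'⟩ => ⟨e.trans e'⟩ }

/-! ### Interval dynamical systems -/

/-- The Borel structure of the space `C(I, I)` of continuous self-maps of `I = [0, 1]` with the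
topology of uniform convergence (which is the compact-open topology). -/
instance instMeasurableSpaceIntervalMaps : MeasurableSpace C(I, I) := borel C(I, I)

instance instBorelSpaceIntervalMaps : BorelSpace C(I, I) := ⟨rfl⟩

/-- Conjugacy of interval dynamical systems: `f` and `g` are conjugate if `h ∘ f = g ∘ h` for some
homeomorphism `h` of `[0, 1]`, which may preserve or reverse the orientation. -/
def intervalConjugacy : Setoid C(I, I) where
  r f g := ∃ h : I ≃ₜ I, ∀ x : I, h (f x) = g (h x)
  iseqv :=
    { refl := fun _ => ⟨Homeomorph.refl I, fun _ => rfl⟩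
      symm := fun {f g} ⟨h, hh⟩ => ⟨h.symm, fun x => by
        rw [Homeomorph.symm_apply_eq, hh, Homeomorph.apply_symm_apply]⟩
      trans := fun {f g k} ⟨h, hh⟩ ⟨h', hh'⟩ => ⟨h.trans h', fun x => by
        simp only [Homeomorph.trans_apply, hh, hh']⟩ }

end BorelComplexity

/-! ### Universality of families of relations among `S_∞`-actions. -/

namespace BorelComplexity

/-! ### Borel reducibility -/

/-! The proof is a cycle of Borel reductions. Every orbit relation of a continuous `S_∞`-action on a
Polish space reduces to isomorphism of countable families of relations on `ℕ`
(`borelReducible_relFamilyIso`); this reduces to graph isomorphism (`relFamilyIso_le_graphIso`),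
which reduces to interval conjugacy (`graphIso_le_intervalConjugacy`), which reduces back to
families of relations (`intervalConjugacy_le_relFamilyIso`). Since `relFamilyIso` is itself an
`S_∞`-orbit relation, it is universal, and everything in the cycle is bireducible with any universal
relation.

Upper bound. To a map `f` a countable set of nodes is attached in a conjugacy-invariant way: start
from `0`, `1`, the local extreme values and the one-sided fixed points of iterates, close under
images and one-sided preimages, and add the end points of the gaps of the closure. On a gap between
adjacent nodes `f` is either constant or a homeomorphism onto another gap, because a failure of
injectivity produces a local extremum, whose value is marked. An iterate returning a gap to itself
by a bijection is the identity or has no fixed point there, because a boundary point of the fixed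
set would be marked. Fixed-point-free increasing homeomorphisms of an open interval are conjugate to
a translation or its inverse, so only their direction matters. Hence an increasing matching of nodes
that respects the maps and these directions extends to a conjugacy: bijections between gaps are
chosen equivariantly (`exists_equivariant_section`), glued, and extended by density
(`NodeMatch.exists_conj`). The node data are coded by relations on `ℕ` through a Borel enumeration,
with the order recorded only up to reversal.

Lower bound. A graph is coded as a colouring of one fixed countable order, the finite sequences over
a dense order in which every vertex occurs densely as a colour; a sequence is coloured by the
adjacency pattern of its vertices. Colour-preserving order automorphisms preserve lengths, hence the
tree structure, and a back-and-forth along branches extracts a graph isomorphism. Conversely, every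
vertex permutation is realised by an automorphism of the dense order. A coloured order becomes an
interval map with one cell for each element: the map moves points up inside the cells, fixes all
other points, and shows the colour as the number of interior points of the cell that are sent to its
right end. -/

theorem BorelReducible.trans {X Y Z : Type*} [MeasurableSpace X] [StandardBorelSpace X]
    [MeasurableSpace Y] [StandardBorelSpace Y] [MeasurableSpace Z] [StandardBorelSpace Z]
    {E : Setoid X} {F : Setoid Y} {G : Setoid Z}
    (h₁ : BorelReducible E F) (h₂ : BorelReducible F G) : BorelReducible E G := by
  obtain ⟨f, hf, hf'⟩ := h₁
  obtain ⟨g, hg, hg'⟩ := h₂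
  exact ⟨g ∘ f, hg.comp hf, fun x x' => (hf' x x').trans (hg' _ _)⟩

/-! ### Countable families of finitary relations on `ℕ` -/

/-- The space of countable families of finitary relations on `ℕ`. -/
abbrev RelFamily : Type := ℕ → List ℕ → Bool

/-- The natural action of permutations of `ℕ` on families of relations. -/
@[reducible]
def relFamilyAction : MulAction (Equiv.Perm ℕ) RelFamily where
  smul g r := fun i l => r i (l.map (g⁻¹ : Equiv.Perm ℕ))
  one_smul r := by
    funext i l
    change r i (l.map _) = _
    simp
  mul_smul g h r := by
    funext i l
    change r i (l.map _) = r i ((l.map _).map _)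
    rw [List.map_map]
    simp [mul_inv_rev, Equiv.Perm.coe_mul]

/-- Isomorphism of families of relations on `ℕ`. -/
def relFamilyIso : Setoid RelFamily :=
  letI := relFamilyAction
  MulAction.orbitRel (Equiv.Perm ℕ) RelFamily

theorem relFamilyIso_iff {r s : RelFamily} :
    relFamilyIso r s ↔ ∃ p : Equiv.Perm ℕ, ∀ i l, r i l = s i (l.map p) := by
  let := relFamilyAction
  change r ∈ MulAction.orbit (Equiv.Perm ℕ) s ↔ _
  constructor
  · rintro ⟨g, rfl⟩
    exact ⟨g⁻¹, fun i l => rfl⟩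
  · rintro ⟨p, hp⟩
    refine ⟨p⁻¹, ?_⟩
    funext i l
    change s i (l.map ((p⁻¹)⁻¹ : Equiv.Perm ℕ)) = r i l
    rw [hp, inv_inv]

theorem continuous_perm_apply (n : ℕ) : Continuous fun g : Equiv.Perm ℕ => g n :=
  (continuous_apply n).comp continuous_induced_dom

/-- The topology records only the values of `g`, but `g⁻¹ n = b` is the same condition as `g b = n`.
-/
theorem continuous_perm_inv_apply (n : ℕ) :
    Continuous fun g : Equiv.Perm ℕ => (g⁻¹ : Equiv.Perm ℕ) n := by
  rw [continuous_discrete_rng]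
  intro b
  have : (fun g : Equiv.Perm ℕ => (g⁻¹ : Equiv.Perm ℕ) n) ⁻¹' {b} =
      (fun g : Equiv.Perm ℕ => g b) ⁻¹' {n} := by
    ext g
    simp only [Set.mem_preimage, Set.mem_singleton_iff]
    rw [Equiv.Perm.inv_eq_iff_eq, eq_comm]
  rw [this]
  exact (isOpen_discrete {n}).preimage (continuous_perm_apply b)

theorem eventually_list_map_perm_inv_eq (g : Equiv.Perm ℕ) (l : List ℕ) :
    ∀ᶠ h in nhds g, l.map (h⁻¹ : Equiv.Perm ℕ) = l.map (g⁻¹ : Equiv.Perm ℕ) := by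
  induction l with
  | nil => simp
  | cons n l ih =>
    have hn : ∀ᶠ h : Equiv.Perm ℕ in nhds g, (h⁻¹ : Equiv.Perm ℕ) n = (g⁻¹ : Equiv.Perm ℕ) n :=
      ((isOpen_discrete {(g⁻¹ : Equiv.Perm ℕ) n}).preimage
        (continuous_perm_inv_apply n)).mem_nhds rfl
    filter_upwards [ih, hn] with h h₁ h₂
    simp only [List.map_cons, h₁, h₂]

theorem isPolishSInftyOrbitRel_relFamilyIso : IsPolishSInftyOrbitRel relFamilyIso := by
  let := relFamilyAction
  have hB : PolishSpace Bool := inferInstance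
  refine ⟨inferInstance, relFamilyAction, inferInstance, inferInstance, ⟨?_⟩, rfl⟩
  refine continuous_pi fun i => continuous_pi fun l => ?_
  rw [continuous_iff_continuousAt]
  rintro ⟨g, r⟩
  have hc : ContinuousAt (fun q : Equiv.Perm ℕ × RelFamily =>
      q.2 i (l.map (g⁻¹ : Equiv.Perm ℕ))) (g, r) :=
    Continuous.continuousAt (by fun_prop)
  refine hc.congr ?_
  filter_upwards [continuous_fst.continuousAt.eventually (eventually_list_map_perm_inv_eq g l)]
    with q hq
  change q.2 i _ = q.2 i (l.map (q.1⁻¹ : Equiv.Perm ℕ))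
  rw [hq]

/-- A neighbourhood of the identity in `S_∞` contains all permutations fixing `0, …, k - 1`, for
some `k`. -/
theorem exists_forall_fix_mem {V : Set (Equiv.Perm ℕ)} (hV : V ∈ nhds (1 : Equiv.Perm ℕ)) :
    ∃ k : ℕ, ∀ g : Equiv.Perm ℕ, (∀ i < k, g i = i) → g ∈ V := by
  rw [nhds_induced, Filter.mem_comap] at hV
  obtain ⟨t, ht, htV⟩ := hV
  rw [nhds_pi, Filter.mem_pi] at ht
  obtain ⟨J, hJ, s, hs, hst⟩ := ht
  obtain ⟨k, hk⟩ := hJ.bddAbove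
  refine ⟨k + 1, fun g hg => htV (hst fun i hi => ?_)⟩
  change g i ∈ s i
  rw [hg i (Nat.lt_succ_of_le (hk hi))]
  exact mem_of_mem_nhds (hs i)

/-- A point is coded by the basic sets whose closures contain certain pieces of its orbit. The code
is equivariant, so points of one orbit get isomorphic codes. It is also injective, so an isomorphism
`p` of codes satisfies `p • x = x'`. -/
theorem borelReducible_relFamilyIso {Y : Type*} [MeasurableSpace Y] [StandardBorelSpace Y]
    {F : Setoid Y} (hF : IsPolishSInftyOrbitRel F) : BorelReducible F relFamilyIso := by
  classical
  obtain ⟨tY, aY, hP, hB, hc, rfl⟩ := hF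
  obtain ⟨B, hBc, hBe, hBb⟩ := TopologicalSpace.exists_countable_basis Y
  obtain ⟨U, hU⟩ : ∃ U : ℕ → Set Y, B ⊆ Set.range U :=
    (Set.countable_iff_exists_subset_range).1 hBc
  -- The permutations carrying `l` to `0, …, k - 1` form a coset of the pointwise stabilizer of
  -- these numbers, or none exists if `l` has a repetition. Taking `closure (U n)` makes the
  -- condition closed in `x`, although the quantifier ranges over uncountably many `g`.
  let Q : Y → ℕ → List ℕ → Prop := fun x n l =>
    ∀ g : Equiv.Perm ℕ, l.map g = List.range l.length → g • x ∈ closure (U n)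
  have hQclosed : ∀ n l, IsClosed {x | Q x n l} := by
    intro n l
    have : {x | Q x n l} = ⋂ (g : Equiv.Perm ℕ) (_ : l.map g = List.range l.length),
        (fun x : Y => g • x) ⁻¹' closure (U n) := by
      ext x; simp [Q]
    rw [this]
    exact isClosed_iInter fun g => isClosed_iInter fun _ =>
      isClosed_closure.preimage (continuous_const_smul g)
  have hQsmul : ∀ (h : Equiv.Perm ℕ) x n l, Q (h • x) n (l.map h) ↔ Q x n l := by
    intro h x n l
    constructor
    · intro H g hg
      have := H (g * h⁻¹) (by
        rw [List.length_map, ← hg, List.map_map]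
        congr 1
        funext a
        simp)
      rwa [smul_smul, inv_mul_cancel_right] at this
    · intro H g hg
      have := H (g * h) (by
        rw [List.length_map, List.map_map] at hg
        rw [← hg]; rfl)
      rwa [← smul_smul] at this
  have hQinj : ∀ x y, (∀ n l, Q x n l ↔ Q y n l) → x = y := by
    intro x y hxy
    by_contra hne
    -- Regularity gives a basic `U n` around `x` whose closure misses `y`. By continuity at `1`, all
    -- permutations fixing `0, …, k - 1` keep `x` in `U n`, so `Q` holds of `x` at `List.range k`;
    -- for `y` it fails already at `g = 1`.
    have hxn : {z | z ≠ y} ∈ nhds x := isOpen_ne.mem_nhds hne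
    obtain ⟨C, hC, hCc, hCy⟩ := exists_mem_nhds_isClosed_subset hxn
    obtain ⟨V, hVB, hxV, hVC⟩ := hBb.mem_nhds_iff.1 hC
    obtain ⟨n, rfl⟩ := hU hVB
    have h1 : {g : Equiv.Perm ℕ | g • x ∈ U n} ∈ nhds (1 : Equiv.Perm ℕ) := by
      have hcont : Continuous fun g : Equiv.Perm ℕ => g • x := by fun_prop
      exact hcont.continuousAt.preimage_mem_nhds
        (by simpa using (hBb.isOpen hVB).mem_nhds hxV)
    obtain ⟨k, hk⟩ := exists_forall_fix_mem h1
    have hx : Q x n (List.range k) := by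
      intro g hg
      refine subset_closure (hk g fun i hi => ?_)
      rw [List.length_range] at hg
      have := congrArg (fun l => l[i]?) hg
      simpa [hi] using this
    have hy := (hxy n _).1 hx 1 (by simp)
    rw [one_smul] at hy
    exact hCy (closure_minimal hVC hCc hy) rfl
  refine ⟨fun x n l => decide (Q x n l), ?_, fun x x' => ?_⟩
  · refine measurable_pi_iff.2 fun n => measurable_pi_iff.2 fun l => ?_
    exact measurable_to_bool (by
      have : (fun x => decide (Q x n l)) ⁻¹' {true} = {x | Q x n l} := by ext x; simp
      rw [this]
      exact (hQclosed n l).measurableSet)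
  · rw [relFamilyIso_iff]
    constructor
    · rintro ⟨g, rfl⟩
      refine ⟨g⁻¹, fun i l => ?_⟩
      have := hQsmul g⁻¹ (g • x') i l
      rw [inv_smul_smul] at this
      exact decide_eq_decide.2 this.symm
    · rintro ⟨p, hp⟩
      have : p • x = x' := hQinj _ _ fun n l => by
        have h1 := hQsmul p x n (l.map (p⁻¹ : Equiv.Perm ℕ))
        have h2 := hp n (l.map (p⁻¹ : Equiv.Perm ℕ))
        have h3 : (l.map (p⁻¹ : Equiv.Perm ℕ)).map p = l := by simp [List.map_map]
        rw [h3] at h1 h2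
        rw [h1]
        simpa using h2
      exact ⟨p⁻¹, by rw [← this]; simp⟩

end BorelComplexity

/-! ### Reduction of families of relations to graphs. -/

namespace BorelComplexity

/-! ### Coding vertex colours in a graph by leaves -/

/-- The graph obtained from `H` by attaching `c v + 2` leaves to each vertex `v`. The unused
vertices `(v, j)` with `c v + 2 ≤ j` are isolated. -/
def leafGraph {V : Type*} (H : SimpleGraph V) (c : V → ℕ) : SimpleGraph (V ⊕ V × ℕ) where
  Adj
    | .inl u, .inl v => H.Adj u v
    | .inl u, .inr (v, j) => u = v ∧ j < c v + 2
    | .inr (v, j), .inl u => u = v ∧ j < c v + 2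
    | .inr _, .inr _ => False
  symm := ⟨by rintro (u | u) (v | v) h <;> first | exact h | exact h.symm⟩
  loopless := ⟨by rintro (u | u) h; exacts [H.loopless.irrefl u h, h]⟩

section LeafGraph

variable {V W : Type*} {H : SimpleGraph V} {c : V → ℕ} {K : SimpleGraph W} {d : W → ℕ}

@[simp] theorem leafGraph_adj_inl_inl {u v : V} :
    (leafGraph H c).Adj (.inl u) (.inl v) ↔ H.Adj u v := Iff.rfl

@[simp] theorem leafGraph_adj_inl_inr {u v : V} {j : ℕ} :
    (leafGraph H c).Adj (.inl u) (.inr (v, j)) ↔ u = v ∧ j < c v + 2 := Iff.rfl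

@[simp] theorem leafGraph_adj_inr_inl {u v : V} {j : ℕ} :
    (leafGraph H c).Adj (.inr (v, j)) (.inl u) ↔ u = v ∧ j < c v + 2 := Iff.rfl

@[simp] theorem leafGraph_adj_inr_inr {p q : V × ℕ} :
    (leafGraph H c).Adj (.inr p) (.inr q) ↔ False := Iff.rfl

/-- A vertex `inl v` has at least two leaves, while a vertex `inr` has at most one neighbour. This
is why two leaves are attached even for colour `0`. -/
theorem leafGraph_iso_inl (e : leafGraph H c ≃g leafGraph K d) (v : V) :
    ∃ w, e (.inl v) = .inl w := by
  rcases hw : e (.inl v) with w | ⟨w, j⟩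
  · exact ⟨w, rfl⟩
  · exfalso
    have key : ∀ k < c v + 2, e (.inr (v, k)) = .inl w := by
      intro k hk
      have h : (leafGraph K d).Adj (e (.inl v)) (e (.inr (v, k))) :=
        e.map_rel_iff.2 ⟨rfl, hk⟩
      rw [hw] at h
      rcases h' : e (.inr (v, k)) with x | x
      · rw [h'] at h
        rw [h.1]
      · rw [h'] at h
        exact h.elim
    have := e.injective ((key 0 (by omega)).trans (key 1 (by omega)).symm)
    simp at this

/-- The leaves of `v` are sent injectively to leaves of its image; a leaf cannot become a vertex
`inl`, by the previous lemma for the inverse. -/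
theorem leafGraph_iso_le (e : leafGraph H c ≃g leafGraph K d) {v : V} {w : W}
    (hvw : e (.inl v) = .inl w) : c v ≤ d w := by
  have key : ∀ k : Fin (c v + 2), ∃ k' : Fin (d w + 2), e (.inr (v, k)) = .inr (w, (k' : ℕ)) := by
    intro k
    have h : (leafGraph K d).Adj (e (.inl v)) (e (.inr (v, k))) :=
      e.map_rel_iff.2 ⟨rfl, k.2⟩
    rw [hvw] at h
    rcases h' : e (.inr (v, k)) with x | ⟨x, j⟩
    · obtain ⟨y, hy⟩ := leafGraph_iso_inl e.symm x
      rw [← h', RelIso.symm_apply_apply] at hy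
      simp at hy
    · rw [h'] at h
      obtain ⟨rfl, hj⟩ := h
      exact ⟨⟨j, hj⟩, rfl⟩
  choose g hg using key
  have hinj : Function.Injective g := by
    intro a b hab
    have := (hg a).trans ((congrArg (fun k : Fin (d w + 2) =>
      (Sum.inr (w, (k : ℕ)) : W ⊕ W × ℕ)) hab).trans (hg b).symm)
    simpa [Fin.ext_iff] using this
  simpa using Fintype.card_le_of_injective g hinj

theorem leafGraph_iso_exists (e : leafGraph H c ≃g leafGraph K d) :
    ∃ f : H ≃g K, ∀ v, d (f v) = c v := by
  choose f hf using leafGraph_iso_inl e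
  choose f' hf' using leafGraph_iso_inl e.symm
  have h1 : ∀ v, f' (f v) = v := fun v => by
    have := hf' (f v)
    rw [← hf v, RelIso.symm_apply_apply] at this
    exact (Sum.inl_injective this).symm
  have h2 : ∀ w, f (f' w) = w := fun w => by
    have := hf (f' w)
    rw [← hf' w, RelIso.apply_symm_apply] at this
    exact (Sum.inl_injective this).symm
  refine ⟨⟨⟨f, f', h1, h2⟩, fun {u v} => ?_⟩, fun v => ?_⟩
  · change K.Adj (f u) (f v) ↔ _
    rw [← leafGraph_adj_inl_inl (c := d), ← hf, ← hf, e.map_rel_iff]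
    rfl
  · change d (f v) = c v
    refine le_antisymm (leafGraph_iso_le e.symm (w := v) ?_) (leafGraph_iso_le e (hf v))
    rw [← hf v, RelIso.symm_apply_apply]

/-- A colour-preserving isomorphism extends to the graphs with leaves. -/
def leafGraphIso (f : H ≃g K) (hf : ∀ v, d (f v) = c v) : leafGraph H c ≃g leafGraph K d where
  toEquiv := Equiv.sumCongr f.toEquiv (Equiv.prodCongr f.toEquiv (Equiv.refl ℕ))
  map_rel_iff' := by
    rintro (u | ⟨u, j⟩) (v | ⟨v, k⟩) <;> simp [hf, f.map_rel_iff]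

end LeafGraph

/-! ### Coding a family of relations in a coloured graph -/

/-- The vertices coding a family of relations: numbers, pairs of an index and a tuple, and such
pairs with a marked position. -/
abbrev TupleVertex : Type := ℕ ⊕ (ℕ × List ℕ) ⊕ (ℕ × List ℕ) × ℕ

/-- Each tuple is joined to its positions and each position to the number that occupies it. -/
def tupleGraph : SimpleGraph TupleVertex where
  Adj
    | .inr (.inl t), .inr (.inr (s, j)) => t = s ∧ j < s.2.length
    | .inr (.inr (s, j)), .inr (.inl t) => t = s ∧ j < s.2.length
    | .inl n, .inr (.inr (s, j)) => s.2[j]? = some n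
    | .inr (.inr (s, j)), .inl n => s.2[j]? = some n
    | _, _ => False
  symm := ⟨by rintro (u | u | u) (v | v | v) h <;> exact h⟩
  loopless := ⟨by rintro (u | u | u) h <;> exact h⟩

/-- The colour of a vertex tells its kind, the index and truth value of a tuple, and the number of a
position. -/
def tupleColor (r : RelFamily) : TupleVertex → ℕ
  | .inl _ => 0
  | .inr (.inl t) => if r t.1 t.2 then 3 * t.1 + 2 else 3 * t.1 + 3
  | .inr (.inr s) => 3 * s.2 + 1

theorem tupleColor_eq_inl {r s : RelFamily} {n : ℕ} {v : TupleVertex}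
    (h : tupleColor s v = tupleColor r (.inl n)) : ∃ m, v = .inl m := by
  rcases v with m | t | t
  · exact ⟨m, rfl⟩
  · simp only [tupleColor] at h
    split_ifs at h
  · simp [tupleColor] at h

theorem tupleColor_eq_pos {r s : RelFamily} {t : ℕ × List ℕ} {j : ℕ} {v : TupleVertex}
    (h : tupleColor s v = tupleColor r (.inr (.inr (t, j)))) : ∃ t', v = .inr (.inr (t', j)) := by
  rcases v with m | t' | ⟨t', j'⟩
  · simp [tupleColor] at h
  · simp only [tupleColor] at h
    split_ifs at h <;> omega
  · simp only [tupleColor] at h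
    obtain rfl : j' = j := by omega
    exact ⟨t', rfl⟩

theorem tupleColor_eq_tuple {r s : RelFamily} {i : ℕ} {l : List ℕ} {v : TupleVertex}
    (h : tupleColor s v = tupleColor r (.inr (.inl (i, l)))) :
    ∃ l', v = .inr (.inl (i, l')) ∧ r i l = s i l' := by
  rcases v with m | ⟨i', l'⟩ | ⟨t', j'⟩
  · simp only [tupleColor] at h
    split_ifs at h
  · simp only [tupleColor] at h
    have hi : i' = i := by split_ifs at h <;> omega
    subst hi
    refine ⟨l', rfl, ?_⟩
    split_ifs at h with h1 h2 h2 <;> first | omega | simp_all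
  · simp only [tupleColor] at h
    split_ifs at h <;> omega

/-- Colours force an isomorphism to permute the numbers, to keep the index and truth value of each
tuple, and to keep position numbers. Adjacency then makes the image of `(i, l)` equal to `(i, l.map
p)`, where `p` is the permutation induced on numbers. -/
theorem relFamilyIso_iff_tupleGraph {r s : RelFamily} :
    relFamilyIso r s ↔ ∃ f : tupleGraph ≃g tupleGraph, ∀ v, tupleColor s (f v) = tupleColor r v := by
  rw [relFamilyIso_iff]
  constructor
  · rintro ⟨p, hp⟩
    have hinj : Function.Injective (List.map p) := List.map_injective_iff.2 p.injective
    let eL : List ℕ ≃ List ℕ := Equiv.listEquivOfEquiv p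
    have heL : ∀ l, eL l = l.map p := fun l => rfl
    let eT : ℕ × List ℕ ≃ ℕ × List ℕ := Equiv.prodCongr (Equiv.refl ℕ) eL
    refine ⟨⟨Equiv.sumCongr p (Equiv.sumCongr eT (Equiv.prodCongr eT (Equiv.refl ℕ))), ?_⟩, ?_⟩
    · rintro (u | u | ⟨⟨i, l⟩, j⟩) (v | v | ⟨⟨i', l'⟩, j'⟩) <;>
        simp [tupleGraph, eT, heL]
      all_goals
        intro _
        simp only [Prod.ext_iff, Prod.map_fst, Prod.map_snd, id, heL, hinj.eq_iff]
    · rintro (u | u | u) <;> simp [tupleColor, eT, heL, hp]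
  · rintro ⟨f, hf⟩
    have hn : ∀ n, ∃ m, f (.inl n) = .inl m := fun n => tupleColor_eq_inl (hf _)
    have hn' : ∀ n, ∃ m, f.symm (.inl n) = .inl m := fun n => by
      refine tupleColor_eq_inl (r := s) (s := r) (n := n) ?_
      rw [← hf, RelIso.apply_symm_apply]
    choose p hp using hn
    choose q hq using hn'
    have hpq : ∀ n, q (p n) = n := fun n => by
      have := hq (p n)
      rw [← hp, RelIso.symm_apply_apply] at this
      exact (Sum.inl_injective this).symm
    have hqp : ∀ n, p (q n) = n := fun n => by
      have := hp (q n)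
      rw [← hq, RelIso.apply_symm_apply] at this
      exact (Sum.inl_injective this).symm
    refine ⟨⟨p, q, hpq, hqp⟩, fun i l => ?_⟩
    change r i l = s i (l.map p)
    obtain ⟨l', hl', hrs⟩ := tupleColor_eq_tuple (hf (.inr (.inl (i, l))))
    rw [hrs]
    congr 1
    have hpos : ∀ j < l.length, j < l'.length ∧ ∀ n, l[j]? = some n → l'[j]? = some (p n) := by
      intro j hj
      obtain ⟨t, ht⟩ := tupleColor_eq_pos (hf (.inr (.inr ((i, l), j))))
      have h1 : tupleGraph.Adj (f (.inr (.inl (i, l)))) (f (.inr (.inr ((i, l), j)))) :=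
        f.map_rel_iff.2 ⟨rfl, hj⟩
      rw [hl', ht] at h1
      obtain ⟨rfl, h1⟩ := h1
      refine ⟨h1, fun n h => ?_⟩
      have h2 : tupleGraph.Adj (f (.inl n)) (f (.inr (.inr ((i, l), j)))) :=
        f.map_rel_iff.2 h
      rw [hp, ht] at h2
      exact h2
    -- A further position of `l'` would pull back to position number `l.length` of `l`, which is not
    -- joined to the vertex of `l`.
    have hlen : l'.length ≤ l.length := by
      by_contra! hlt
      have hc : tupleColor r (f.symm (.inr (.inr ((i, l'), l.length)))) =
          tupleColor s (.inr (.inr ((i, l'), l.length))) := by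
        rw [← hf, RelIso.apply_symm_apply]
      obtain ⟨t, ht⟩ := tupleColor_eq_pos hc
      have h1 : tupleGraph.Adj (f.symm (.inr (.inl (i, l'))))
          (f.symm (.inr (.inr ((i, l'), l.length)))) := f.symm.map_rel_iff.2 ⟨rfl, hlt⟩
      rw [ht, ← hl', RelIso.symm_apply_apply] at h1
      obtain ⟨rfl, h1⟩ := h1
      exact lt_irrefl _ h1
    have hlen' : l.length ≤ l'.length := by
      by_contra! hlt
      exact lt_irrefl _ (hpos _ hlt).1
    refine List.ext_getElem? fun j => ?_
    rw [List.getElem?_map]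
    by_cases hj : j < l.length
    · rw [(hpos j hj).2 _ (List.getElem?_eq_getElem hj), List.getElem?_eq_getElem hj]
      rfl
    · rw [List.getElem?_eq_none (by omega), List.getElem?_eq_none (by omega)]
      rfl

theorem relFamilyIso_le_graphIso : BorelReducible relFamilyIso graphIso := by
  obtain ⟨D⟩ := nonempty_denumerable (TupleVertex ⊕ TupleVertex × ℕ)
  -- The vertex set does not depend on `r`, so one numbering serves all families and only adjacency
  -- has to be measurable in `r`.
  let ε : ℕ ≃ TupleVertex ⊕ TupleVertex × ℕ := (Denumerable.eqv _).symm
  refine ⟨fun r => (leafGraph tupleGraph (tupleColor r)).comap ε, ?_, fun r s => ?_⟩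
  · rw [SimpleGraph.measurable_iff_adj]
    intro u v
    have hm : ∀ (w : TupleVertex) (j : ℕ), Measurable fun r : RelFamily => j < tupleColor r w + 2 := by
      rintro (w | w | w) j
      · exact measurable_const (a := j < 0 + 2)
      · have : Measurable fun r : RelFamily => r w.1 w.2 :=
          (measurable_pi_apply w.2).comp (measurable_pi_apply w.1)
        exact (measurable_from_top (f := fun b : Bool =>
          j < (if b then 3 * w.1 + 2 else 3 * w.1 + 3) + 2)).comp this
      · exact measurable_const (a := j < 3 * w.2 + 1 + 2)
    change Measurable fun r => (leafGraph tupleGraph (tupleColor r)).Adj (ε u) (ε v)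
    rcases ε u with x | ⟨x, j⟩ <;> rcases ε v with y | ⟨y, k⟩
    · exact measurable_const
    · exact measurable_const.and (hm y k)
    · exact measurable_const.and (hm x j)
    · exact measurable_const
  · rw [relFamilyIso_iff_tupleGraph]
    constructor
    · rintro ⟨f, hf⟩
      exact ⟨(SimpleGraph.Iso.comap ε _).trans ((leafGraphIso f hf).trans
        (SimpleGraph.Iso.comap ε _).symm)⟩
    · rintro ⟨e⟩
      exact leafGraph_iso_exists ((SimpleGraph.Iso.comap ε _).symm.trans
        (e.trans (SimpleGraph.Iso.comap ε _)))

theorem graphIso_le_structureIso :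
    BorelReducible graphIso (structureIso FirstOrder.Language.graph) := by
  refine ⟨fun G => G.structure, ?_, fun G H => ?_⟩
  · rw [measurable_comap_iff, measurable_pi_iff]
    rintro ⟨_, ⟨⟩⟩
    rw [measurable_pi_iff]
    intro v
    exact SimpleGraph.measurable_iff_adj.1 measurable_id _ _
  · let := G.structure
    constructor
    · rintro ⟨e⟩
      exact ⟨@FirstOrder.Language.Equiv.mk _ _ _ G.structure H.structure e.toEquiv
        (fun f => isEmptyElim f) (by rintro _ ⟨⟩ x; exact e.map_rel_iff)⟩
    · rintro ⟨e⟩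
      refine ⟨⟨@FirstOrder.Language.Equiv.toEquiv _ _ _ G.structure H.structure e, fun {a b} => ?_⟩⟩
      exact @FirstOrder.Language.Equiv.map_rel' _ _ _ G.structure H.structure e 2
        FirstOrder.Language.adj ![a, b]

end BorelComplexity

/-! ### Tools for building conjugacies: order extension, equivariant choice, translations. -/

namespace BorelComplexity

/-! ### Extending order isomorphisms from dense sets -/

/-- The monotone extension of the correspondence `a p ↦ b p`. -/
noncomputable def supExtension {P X Y : Type*} [LE X] [SupSet Y] (a : P → X) (b : P → Y) (x : X) :
    Y :=
  sSup (b '' {p | a p ≤ x})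

theorem supExtension_mono {P X Y : Type*} [Preorder X] [CompleteLattice Y] (a : P → X)
    (b : P → Y) : Monotone (supExtension a b) := fun _ _ hxy =>
  sSup_le_sSup (Set.image_mono fun _ hp => le_trans hp hxy)

/-- If the two sides differed, density would put some `a q` strictly between them, and comparing `b
q` with the supremum is contradictory. Only `a` needs dense range here. -/
theorem supExtension_supExtension {P X Y : Type*} [CompleteLinearOrder X] [DenselyOrdered X]
    [TopologicalSpace X] [OrderTopology X] [CompleteLinearOrder Y] {a : P → X} {b : P → Y}
    (ha : DenseRange a) (hab : ∀ p q, a p < a q ↔ b p < b q) (x : X) :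
    supExtension b a (supExtension a b x) = x := by
  apply le_antisymm
  · refine sSup_le ?_
    rintro _ ⟨p, hp, rfl⟩
    by_contra! hlt
    obtain ⟨q, h1, h2⟩ := ha.exists_mem_open isOpen_Ioo (Set.nonempty_Ioo.2 hlt)
    refine ((hab q p).1 h2).not_ge (le_trans hp (sSup_le ?_))
    rintro _ ⟨r, hr, rfl⟩
    exact ((hab r q).1 (lt_of_le_of_lt hr h1)).le
  · refine le_of_forall_lt fun c hc => ?_
    obtain ⟨q, h1, h2⟩ := ha.exists_mem_open isOpen_Ioo (Set.nonempty_Ioo.2 hc)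
    exact lt_of_lt_of_le h1 (le_sSup ⟨q, le_sSup ⟨q, h2.le, rfl⟩, rfl⟩)

theorem exists_orderIso_of_denseRange {P X Y : Type*} [CompleteLinearOrder X] [DenselyOrdered X]
    [TopologicalSpace X] [OrderTopology X] [CompleteLinearOrder Y] [DenselyOrdered Y]
    [TopologicalSpace Y] [OrderTopology Y] {a : P → X} {b : P → Y} (ha : DenseRange a)
    (hb : DenseRange b) (hab : ∀ p q, a p < a q ↔ b p < b q) :
    ∃ h : X ≃o Y, ∀ p, h (a p) = b p := by
  let e : X ≃ Y := ⟨supExtension a b, supExtension b a, supExtension_supExtension ha hab,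
    supExtension_supExtension hb fun p q => (hab p q).symm⟩
  refine ⟨e.toOrderIso (supExtension_mono a b) (supExtension_mono b a), fun p => ?_⟩
  apply le_antisymm
  · refine sSup_le ?_
    rintro _ ⟨q, hq, rfl⟩
    by_contra! hlt
    exact ((hab p q).2 hlt).not_ge hq
  · exact le_sSup ⟨p, le_rfl, rfl⟩

/-! ### Equivariant sections -/

/-- Let `t` act on `X` over the action `T` on `B`, bijectively between fibres. If over every point
`b` there is a point fixed by the power of `t` given by the minimal period of `b`, there is an
equivariant section. -/
theorem exists_equivariant_section {B X : Type*} {T : B → B} {t : X → X} {π : X → B}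
    (hπ : Function.Semiconj π t T) (hinj : ∀ x y, π x = π y → t x = t y → x = y)
    (hsurj : ∀ b z, π z = T b → ∃ x, π x = b ∧ t x = z)
    (hper : ∀ b, ∃ x, π x = b ∧ t^[Function.minimalPeriod T b] x = x) :
    ∃ s : B → X, (∀ b, π (s b) = b) ∧ ∀ b, s (T b) = t (s b) := by
  classical
  have hπn : ∀ n x, π (t^[n] x) = T^[n] (π x) := fun n x => (hπ.iterate_right n).eq x
  have hinjn : ∀ n x y, π x = π y → t^[n] x = t^[n] y → x = y := by
    intro n
    induction n with
    | zero => exact fun x y _ h => h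
    | succ n ih =>
      intro x y hxy h
      rw [Function.iterate_succ_apply', Function.iterate_succ_apply'] at h
      exact ih x y hxy (hinj _ _ (by rw [hπn, hπn, hxy]) h)
  have hsurjn : ∀ n b z, π z = T^[n] b → ∃ x, π x = b ∧ t^[n] x = z := by
    intro n
    induction n with
    | zero => exact fun b z h => ⟨z, h, rfl⟩
    | succ n ih =>
      intro b z h
      rw [Function.iterate_succ_apply'] at h
      obtain ⟨y, hy, rfl⟩ := hsurj _ _ h
      obtain ⟨x, hx, rfl⟩ := ih b y hy
      exact ⟨x, hx, Function.iterate_succ_apply' t n x⟩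
  let S : Setoid B :=
    { r := fun b c => ∃ m n, T^[m] b = T^[n] c
      iseqv :=
        { refl := fun b => ⟨0, 0, rfl⟩
          symm := fun ⟨m, n, h⟩ => ⟨n, m, h.symm⟩
          trans := fun {b c d} ⟨m, n, h⟩ ⟨k, l, h'⟩ => ⟨k + m, n + l, by
            rw [Function.iterate_add_apply, h, ← Function.iterate_add_apply, add_comm k n,
              Function.iterate_add_apply, h', ← Function.iterate_add_apply]⟩ } }
  -- a representative of every class, periodic if possible
  have hrep : ∀ q : Quotient S, ∃ b, Quotient.mk S b = q ∧
      ((∃ c, Quotient.mk S c = q ∧ c ∈ Function.periodicPts T) → b ∈ Function.periodicPts T) := by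
    intro q
    by_cases h : ∃ c, Quotient.mk S c = q ∧ c ∈ Function.periodicPts T
    · obtain ⟨c, hc, hcp⟩ := h
      exact ⟨c, hc, fun _ => hcp⟩
    · exact ⟨q.out, q.out_eq, fun h' => (h h').elim⟩
  choose R hR hRp using hrep
  choose x hx hxp using hper
  -- The value over `b` is the point of the fibre whose forward orbit merges with that of the point
  -- chosen over the representative of the class of `b`.
  let Rel : B → X → Prop := fun b y =>
    π y = b ∧ ∃ m n, t^[m] y = t^[n] (x (R (Quotient.mk S b)))
  have hex : ∀ b, ∃ y, Rel b y := by
    intro b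
    obtain ⟨m, n, h⟩ : ∃ m n, T^[m] b = T^[n] (R (Quotient.mk S b)) :=
      Quotient.exact (hR (Quotient.mk S b)).symm
    obtain ⟨y, hy, hy'⟩ := hsurjn m b (t^[n] (x (R (Quotient.mk S b)))) (by rw [hπn, hx, h])
    exact ⟨y, hy, m, n, hy'⟩
  have hRS : ∀ b m n y, π y = b → t^[m] y = t^[n] (x (R (Quotient.mk S b))) →
      T^[m] b = T^[n] (R (Quotient.mk S b)) := by
    intro b m n y hy h
    have := congrArg π h
    rwa [hπn, hπn, hy, hx] at this
  -- Two routes of different lengths from the representative `r` to one point make `r` eventually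
  -- periodic. Its class then has a periodic point, so `r` was chosen periodic and the difference of
  -- the lengths is a multiple of its minimal period, under which `x r` is fixed. This makes the
  -- value independent of the route.
  have hagree : ∀ b k n, T^[k] (R (Quotient.mk S b)) = T^[n] (R (Quotient.mk S b)) → k ≤ n →
      t^[k] (x (R (Quotient.mk S b))) = t^[n] (x (R (Quotient.mk S b))) := by
    intro b k n h hkn
    obtain ⟨d, rfl⟩ := Nat.exists_eq_add_of_le hkn
    set r := R (Quotient.mk S b) with hr
    rcases Nat.eq_zero_or_pos d with rfl | hd
    · rfl
    have hpk : Function.IsPeriodicPt T d (T^[k] r) := by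
      rw [Function.IsPeriodicPt, Function.IsFixedPt, ← Function.iterate_add_apply, add_comm, ← h]
    have hrp : r ∈ Function.periodicPts T := by
      apply hRp
      refine ⟨T^[k] r, ?_, d, hd, hpk⟩
      rw [← hR (Quotient.mk S b)]
      exact Quotient.sound ⟨0, k, rfl⟩
    have hdvd : Function.minimalPeriod T r ∣ d := by
      rw [← Function.minimalPeriod_apply_iterate hrp k]
      exact hpk.minimalPeriod_dvd
    obtain ⟨e, rfl⟩ := hdvd
    rw [Function.iterate_add_apply, Function.iterate_mul]
    congr 1
    exact (Function.iterate_fixed (hxp r) e).symm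
  have huniq : ∀ b y z, Rel b y → Rel b z → y = z := by
    rintro b y z ⟨hy, m, n, h⟩ ⟨hz, m', n', h'⟩
    have h1 : t^[m' + m] y = t^[m' + n] (x (R (Quotient.mk S b))) := by
      rw [Function.iterate_add_apply, h, ← Function.iterate_add_apply]
    have h2 : t^[m' + m] z = t^[m + n'] (x (R (Quotient.mk S b))) := by
      rw [add_comm, Function.iterate_add_apply, h', ← Function.iterate_add_apply]
    refine hinjn (m' + m) y z (hy.trans hz.symm) ?_
    have h3 := (hRS b _ _ y hy h1).symm.trans (hRS b _ _ z hz h2)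
    rw [h1, h2]
    rcases le_total (m' + n) (m + n') with hle | hle
    · exact hagree b _ _ h3 hle
    · exact (hagree b _ _ h3.symm hle).symm
  choose s hs using hex
  refine ⟨s, fun b => (hs b).1, fun b => huniq (T b) _ _ (hs _) ⟨?_, ?_⟩⟩
  · rw [hπ.eq, (hs b).1]
  · obtain ⟨-, m, n, h⟩ := hs b
    have hq : Quotient.mk S (T b) = Quotient.mk S b := Quotient.sound ⟨0, 1, rfl⟩
    refine ⟨m, n + 1, ?_⟩
    rw [hq, ← Function.iterate_succ_apply, Function.iterate_succ_apply', h,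
      ← Function.iterate_succ_apply' t]

/-! ### Fixed-point-free homeomorphisms of the line -/

/-- An order automorphism of the line moving every point up is conjugate to a translation. -/
theorem exists_conj_translation {α : ℝ ≃o ℝ} (hα : ∀ x, x < α x) :
    ∃ h : ℝ ≃o ℝ, ∀ x, h (x + 1) = α (h x) := by
  have hz : ∀ n : ℤ, (α ^ (n + 1)) 0 = (α ^ n) (α 0) := fun n => by
    rw [zpow_add_one]; rfl
  have hz' : ∀ n : ℤ, ∀ x, (α ^ (n + 1)) x = α ((α ^ n) x) := fun n x => by
    rw [add_comm, zpow_add, zpow_one]; rfl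
  have hmono : StrictMono fun n : ℤ => (α ^ n) 0 :=
    strictMono_int_of_lt_succ fun n => by
      rw [hz']; exact hα _
  have hα0 : 0 < α 0 := hα 0
  have hup : ∀ x, ∃ n : ℤ, x < (α ^ n) 0 := by
    intro x
    by_contra! hx
    have hb : BddAbove (Set.range fun n : ℤ => (α ^ n) 0) := ⟨x, by rintro _ ⟨n, rfl⟩; exact hx n⟩
    -- If the orbit of `0` were bounded above, some orbit point would exceed the preimage of the
    -- supremum, and the next one would exceed the supremum.
    have hlt' : α.symm (⨆ n : ℤ, (α ^ n) 0) < ⨆ n : ℤ, (α ^ n) 0 := by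
      have := hα (α.symm (⨆ n : ℤ, (α ^ n) 0))
      rwa [α.apply_symm_apply] at this
    obtain ⟨n, hn⟩ := exists_lt_of_lt_ciSup hlt'
    have := le_ciSup hb (n + 1)
    rw [hz'] at this
    rw [α.symm_apply_lt] at hn
    exact absurd hn this.not_gt
  have hdown : ∀ x, ∃ n : ℤ, (α ^ n) 0 ≤ x := by
    intro x
    by_contra! hx
    have hb : BddBelow (Set.range fun n : ℤ => (α ^ n) 0) :=
      ⟨x, by rintro _ ⟨n, rfl⟩; exact (hx n).le⟩
    obtain ⟨n, hn⟩ := exists_lt_of_ciInf_lt (hα (⨅ n : ℤ, (α ^ n) 0))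
    have h1 := ciInf_le hb (n - 1)
    have h2 := hz' (n - 1) 0
    rw [sub_add_cancel] at h2
    rw [h2, α.lt_iff_lt] at hn
    exact absurd hn h1.not_gt
  -- On `[0, 1)` this is the linear map onto the fundamental domain `[0, α 0)`; the powers of `α`
  -- carry it to `[n, n + 1)`.
  let χ : ℝ → ℝ := fun y => (α ^ ⌊y⌋) (Int.fract y * α 0)
  have hlow : ∀ y, (α ^ ⌊y⌋) 0 ≤ χ y := fun y =>
    (α ^ ⌊y⌋).monotone (mul_nonneg (Int.fract_nonneg y) hα0.le)
  have hhigh : ∀ y, χ y < (α ^ (⌊y⌋ + 1)) 0 := fun y => by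
    rw [hz]
    exact (α ^ ⌊y⌋).strictMono (mul_lt_of_lt_one_left hα0 (Int.fract_lt_one y))
  have hχ : StrictMono χ := by
    intro y z hyz
    rcases (Int.floor_mono hyz.le).eq_or_lt with h | h
    · have hf : Int.fract y < Int.fract z := by
        rw [Int.fract, Int.fract, h]; linarith
      change (α ^ ⌊y⌋) _ < (α ^ ⌊z⌋) _
      rw [h]
      exact (α ^ ⌊z⌋).strictMono (mul_lt_mul_of_pos_right hf hα0)
    · exact (hhigh y).trans_le ((hmono.monotone (Int.add_one_le_iff.2 h)).trans (hlow z))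
  have hsurj : Function.Surjective χ := by
    intro x
    obtain ⟨N, hN⟩ := hup x
    obtain ⟨n, hn, hmax⟩ := Int.exists_greatest_of_bdd (P := fun n => (α ^ n) 0 ≤ x)
      ⟨N, fun n hn => (hmono.lt_iff_lt.1 (hn.trans_lt hN)).le⟩ (hdown x)
    have hn1 : x < (α ^ (n + 1)) 0 := by
      by_contra! h
      have := hmax _ h
      omega
    set z := (α ^ n).symm x with hzdef
    have hxz : (α ^ n) z = x := (α ^ n).apply_symm_apply x
    have hz0 : 0 ≤ z := by rwa [← (α ^ n).le_iff_le, hxz]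
    have hz1 : z < α 0 := by rwa [← (α ^ n).lt_iff_lt, hxz, ← hz]
    have hfr : z / α 0 < 1 := (div_lt_one hα0).2 hz1
    have hfr0 : 0 ≤ z / α 0 := div_nonneg hz0 hα0.le
    refine ⟨n + z / α 0, ?_⟩
    have hfl : ⌊(n : ℝ) + z / α 0⌋ = n := by
      rw [Int.floor_intCast_add, Int.floor_eq_zero_iff.2 ⟨hfr0, hfr⟩, add_zero]
    change (α ^ ⌊(n : ℝ) + z / α 0⌋) (Int.fract _ * _) = x
    rw [hfl, Int.fract, hfl, add_sub_cancel_left, div_mul_cancel₀ _ hα0.ne', hxz]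
  refine ⟨hχ.orderIsoOfSurjective χ hsurj, fun x => ?_⟩
  change (α ^ ⌊x + 1⌋) (Int.fract (x + 1) * α 0) = α ((α ^ ⌊x⌋) _)
  rw [Int.floor_add_one, Int.fract_add_one, hz']

end BorelComplexity

/-! ### Upper bound: marked points, gaps, and conjugacies rebuilt from the nodes. -/

namespace BorelComplexity

open Set Filter Topology

/-! ### Points canonically attached to an interval map -/

/-- `z` lies strictly between `u` and `x`. -/
def Between (u z x : I) : Prop := (u < z ∧ z < x) ∨ (x < z ∧ z < u)

/-- The points of `Z` that are not limits of `Z` from both sides. -/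
def oneSided (Z : Set I) : Set I := {x | x ∈ Z ∧ ∃ u ≠ x, ∀ z ∈ Z, ¬ Between u z x}

/-- A finite stage in the construction of the marked points of `f`. -/
def stage (f : C(I, I)) : ℕ → Set I
  | 0 => {0, 1} ∪ {v | ∃ x, IsLocalExtr f x ∧ f x = v} ∪ ⋃ n : ℕ, oneSided {x | f^[n] x = x}
  | k + 1 => stage f k ∪ f '' stage f k ∪ ⋃ y ∈ stage f k, oneSided {x | f x = y}

/-- The marked points of `f`: the least set that contains `0`, `1`, all local extreme values and the
one-sided fixed points of all iterates, and that is closed under images and one-sided preimages. -/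
def marked (f : C(I, I)) : Set I := ⋃ k, stage f k

/-- The marked points together with the end points of the gaps of their closure. -/
def nodes (f : C(I, I)) : Set I := marked f ∪ oneSided (closure (marked f))

section Canonical

theorem homeomorph_mono_or_anti (h : I ≃ₜ I) : StrictMono h ∨ StrictAnti h :=
  h.continuous.strictMono_of_inj h.injective

theorem between_homeomorph (h : I ≃ₜ I) {u z x : I} :
    Between (h u) (h z) (h x) ↔ Between u z x := by
  rcases homeomorph_mono_or_anti h with hh | hh
  · simp only [Between, hh.lt_iff_lt]
  · simp only [Between, hh.lt_iff_gt]
    tauto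

theorem oneSided_homeomorph (h : I ≃ₜ I) {Z W : Set I} (hZ : ∀ x, h x ∈ W ↔ x ∈ Z) {x : I} :
    h x ∈ oneSided W ↔ x ∈ oneSided Z := by
  constructor
  · rintro ⟨hx, u, hu, H⟩
    refine ⟨(hZ x).1 hx, h.symm u, fun e => hu (by rw [← e, h.apply_symm_apply]), fun z hz hb => ?_⟩
    refine H (h z) ((hZ z).2 hz) ?_
    rwa [← between_homeomorph h, h.apply_symm_apply] at hb
  · rintro ⟨hx, u, hu, H⟩
    refine ⟨(hZ x).2 hx, h u, h.injective.ne hu, fun z hz hb => ?_⟩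
    refine H (h.symm z) ((hZ _).1 (by rwa [h.apply_symm_apply])) ?_
    rwa [← between_homeomorph h, h.apply_symm_apply]

variable {f g : C(I, I)} {h : I ≃ₜ I}

theorem conj_symm (hh : ∀ x, h (f x) = g (h x)) (x : I) : h.symm (g x) = f (h.symm x) := by
  rw [h.symm_apply_eq, hh, h.apply_symm_apply]

theorem conj_iterate (hh : ∀ x, h (f x) = g (h x)) (n : ℕ) (x : I) : h (f^[n] x) = g^[n] (h x) :=
  Function.Semiconj.iterate_right (f := h) (ga := f) (gb := g) hh n x

theorem isLocalExtr_conj (hh : ∀ x, h (f x) = g (h x)) {x : I} (hx : IsLocalExtr f x) :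
    IsLocalExtr g (h x) := by
  have ht : Tendsto h.symm (𝓝 (h x)) (𝓝 x) := by
    simpa using h.symm.continuous.tendsto (h x)
  have hg : ∀ w, g w = h (f (h.symm w)) := fun w => by rw [hh, h.apply_symm_apply]
  rcases homeomorph_mono_or_anti h with hm | hm <;> rcases hx with hx | hx
  · left
    filter_upwards [ht.eventually hx] with w hw
    rw [hg, hg, h.symm_apply_apply]
    exact hm.monotone hw
  · right
    filter_upwards [ht.eventually hx] with w hw
    rw [hg, hg, h.symm_apply_apply]
    exact hm.monotone hw
  · right
    filter_upwards [ht.eventually hx] with w hw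
    rw [hg, hg, h.symm_apply_apply]
    exact hm.antitone hw
  · left
    filter_upwards [ht.eventually hx] with w hw
    rw [hg, hg, h.symm_apply_apply]
    exact hm.antitone hw

theorem homeomorph_zero_one (h : I ≃ₜ I) : h 0 ∈ ({0, 1} : Set I) ∧ h 1 ∈ ({0, 1} : Set I) := by
  rcases homeomorph_mono_or_anti h with hm | hm
  · have h0 := hm.monotone (unitInterval.nonneg' (t := h.symm 0))
    have h1 := hm.monotone (unitInterval.le_one' (t := h.symm 1))
    rw [h.apply_symm_apply] at h0 h1
    exact ⟨.inl (le_antisymm h0 unitInterval.nonneg'), .inr (le_antisymm unitInterval.le_one' h1)⟩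
  · have h0 := hm.antitone (unitInterval.nonneg' (t := h.symm 1))
    have h1 := hm.antitone (unitInterval.le_one' (t := h.symm 0))
    rw [h.apply_symm_apply] at h0 h1
    exact ⟨.inr (le_antisymm unitInterval.le_one' h0), .inl (le_antisymm h1 unitInterval.nonneg')⟩

theorem stage_conj (hh : ∀ x, h (f x) = g (h x)) (k : ℕ) : ∀ x ∈ stage f k, h x ∈ stage g k := by
  induction k with
  | zero =>
    rintro x (((rfl | rfl) | ⟨z, hz, rfl⟩) | hx)
    · exact .inl (.inl (homeomorph_zero_one h).1)
    · exact .inl (.inl (homeomorph_zero_one h).2)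
    · exact .inl (.inr ⟨h z, isLocalExtr_conj hh hz, (hh z).symm⟩)
    · obtain ⟨n, hn⟩ := mem_iUnion.1 hx
      refine .inr (mem_iUnion.2 ⟨n, (oneSided_homeomorph h fun z => ?_).2 hn⟩)
      simp only [mem_ofPred_eq, ← conj_iterate hh, h.injective.eq_iff]
  | succ k ih =>
    rintro x ((hx | ⟨y, hy, rfl⟩) | hx)
    · exact .inl (.inl (ih x hx))
    · exact .inl (.inr ⟨h y, ih y hy, (hh y).symm⟩)
    · obtain ⟨y, hy, hx⟩ := mem_iUnion₂.1 hx
      refine .inr (mem_iUnion₂.2 ⟨h y, ih y hy, (oneSided_homeomorph h fun z => ?_).2 hx⟩)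
      simp only [mem_ofPred_eq, ← hh, h.injective.eq_iff]

theorem marked_conj (hh : ∀ x, h (f x) = g (h x)) {x : I} : h x ∈ marked g ↔ x ∈ marked f := by
  simp only [marked, mem_iUnion]
  constructor
  · rintro ⟨k, hk⟩
    refine ⟨k, ?_⟩
    have := stage_conj (h := h.symm) (conj_symm hh) k _ hk
    rwa [h.symm_apply_apply] at this
  · rintro ⟨k, hk⟩
    exact ⟨k, stage_conj hh k x hk⟩

theorem nodes_conj (hh : ∀ x, h (f x) = g (h x)) {x : I} : h x ∈ nodes g ↔ x ∈ nodes f := by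
  refine or_congr (marked_conj hh) (oneSided_homeomorph h fun z => ?_)
  have : marked f = h ⁻¹' marked g := by ext; exact (marked_conj hh).symm
  rw [this, ← h.preimage_closure]
  rfl

end Canonical

/-! ### Gaps between nodes -/

theorem zero_mem_marked (f : C(I, I)) : 0 ∈ marked f := mem_iUnion.2 ⟨0, .inl (.inl (.inl rfl))⟩

theorem one_mem_marked (f : C(I, I)) : 1 ∈ marked f := mem_iUnion.2 ⟨0, .inl (.inl (.inr rfl))⟩

variable {f : C(I, I)} {a b x y : I}

theorem IsLocalExtr.apply_mem_marked (hx : IsLocalExtr f x) : f x ∈ marked f :=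
  mem_iUnion.2 ⟨0, .inl (.inr ⟨x, hx, rfl⟩)⟩

theorem oneSided_fix_subset_marked (f : C(I, I)) (n : ℕ) :
    oneSided {x | f^[n] x = x} ⊆ marked f :=
  fun _ hx => mem_iUnion.2 ⟨0, .inr (mem_iUnion.2 ⟨n, hx⟩)⟩

theorem apply_mem_marked (hx : x ∈ marked f) : f x ∈ marked f := by
  obtain ⟨k, hk⟩ := mem_iUnion.1 hx
  exact mem_iUnion.2 ⟨k + 1, .inl (.inr ⟨x, hk, rfl⟩)⟩

theorem oneSided_preimage_subset_marked (hy : y ∈ marked f) :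
    oneSided {x | f x = y} ⊆ marked f := fun x hx => by
  obtain ⟨k, hk⟩ := mem_iUnion.1 hy
  exact mem_iUnion.2 ⟨k + 1, .inr (mem_iUnion₂.2 ⟨y, hk, hx⟩)⟩

theorem nodes_subset_closure (f : C(I, I)) : nodes f ⊆ closure (marked f) :=
  union_subset subset_closure fun _ hx => hx.1

theorem apply_mem_closure_marked (hx : x ∈ closure (marked f)) : f x ∈ closure (marked f) :=
  map_mem_closure f.continuous hx fun _ => apply_mem_marked

/-- `a < b` are adjacent nodes of `f`. -/
structure IsGap (f : C(I, I)) (a b : I) : Prop where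
  lt : a < b
  left : a ∈ nodes f
  right : b ∈ nodes f
  notMem : ∀ z ∈ nodes f, ¬ (a < z ∧ z < b)

theorem IsGap.notMem_closure (h : IsGap f a b) (hx : x ∈ Ioo a b) : x ∉ closure (marked f) := by
  intro hc
  obtain ⟨z, hz, hz'⟩ := mem_closure_iff.1 hc _ isOpen_Ioo hx
  exact h.notMem z (.inl hz') hz

/-- Closedness makes the supremum a point of `Z`, and `q` itself witnesses that it is isolated from
the right. This locates the end of the gap of `Z` around `q`. -/
theorem exists_sSup_oneSided {Z : Set I} (hZ : IsClosed Z) {q : I} (hq : q ∉ Z)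
    (hne : (Z ∩ Iic q).Nonempty) :
    sSup (Z ∩ Iic q) ∈ oneSided Z ∧ sSup (Z ∩ Iic q) < q ∧ ∀ z ∈ Z, z ≤ q → z ≤ sSup (Z ∩ Iic q) := by
  have hmem : sSup (Z ∩ Iic q) ∈ Z ∩ Iic q := (hZ.inter isClosed_Iic).sSup_mem hne
  have hlt : sSup (Z ∩ Iic q) < q := lt_of_le_of_ne hmem.2 fun e => hq (e ▸ hmem.1)
  refine ⟨⟨hmem.1, q, hlt.ne', ?_⟩, hlt, fun z hz hzq => le_sSup ⟨hz, hzq⟩⟩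
  rintro z hz (⟨h1, h2⟩ | ⟨h1, h2⟩)
  · exact lt_asymm hlt (h1.trans h2)
  · exact h1.not_ge (le_sSup ⟨hz, h2.le⟩)

theorem exists_sInf_oneSided {Z : Set I} (hZ : IsClosed Z) {q : I} (hq : q ∉ Z)
    (hne : (Z ∩ Ici q).Nonempty) :
    sInf (Z ∩ Ici q) ∈ oneSided Z ∧ q < sInf (Z ∩ Ici q) ∧ ∀ z ∈ Z, q ≤ z → sInf (Z ∩ Ici q) ≤ z := by
  have hmem : sInf (Z ∩ Ici q) ∈ Z ∩ Ici q := (hZ.inter isClosed_Ici).sInf_mem hne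
  have hlt : q < sInf (Z ∩ Ici q) := lt_of_le_of_ne hmem.2 fun e => hq (e ▸ hmem.1)
  refine ⟨⟨hmem.1, q, hlt.ne, ?_⟩, hlt, fun z hz hzq => sInf_le ⟨hz, hzq⟩⟩
  rintro z hz (⟨h1, h2⟩ | ⟨h1, h2⟩)
  · exact h2.not_ge (sInf_le ⟨hz, h1.le⟩)
  · exact lt_asymm hlt (h1.trans h2)

theorem exists_isGap (hx : x ∉ closure (marked f)) : ∃ a b, IsGap f a b ∧ x ∈ Ioo a b := by
  obtain ⟨h1, h2, h3⟩ := exists_sSup_oneSided isClosed_closure hx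
    ⟨0, subset_closure (zero_mem_marked f), unitInterval.nonneg'⟩
  obtain ⟨h4, h5, h6⟩ := exists_sInf_oneSided isClosed_closure hx
    ⟨1, subset_closure (one_mem_marked f), unitInterval.le_one'⟩
  refine ⟨_, _, ⟨h2.trans h5, .inr h1, .inr h4, fun z hz => ?_⟩, h2, h5⟩
  rintro ⟨h7, h8⟩
  have hz' := nodes_subset_closure f hz
  rcases le_total z x with hzx | hzx
  · exact h7.not_ge (h3 z hz' hzx)
  · exact h8.not_ge (h6 z hz' hzx)

/-- Going from a point of the gap outside `Z` towards one in `Z`, the first point of `Z` is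
one-sided, hence marked. But a gap contains no marked point. -/
theorem IsGap.subset_or_disjoint (h : IsGap f a b) {Z : Set I} (hZ : IsClosed Z)
    (hZM : oneSided Z ⊆ marked f) : Ioo a b ⊆ Z ∨ Disjoint (Ioo a b) Z := by
  by_contra! hcon
  obtain ⟨h1, h2⟩ := hcon
  obtain ⟨w, hw, hwZ⟩ := not_subset.1 h1
  obtain ⟨z, hz, hzZ⟩ := not_disjoint_iff.1 h2
  rcases le_total w z with hwz | hwz
  · obtain ⟨h3, h4, h5⟩ := exists_sInf_oneSided hZ hwZ ⟨z, hzZ, hwz⟩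
    exact h.notMem _ (.inl (hZM h3)) ⟨hw.1.trans h4, (h5 z hzZ hwz).trans_lt hz.2⟩
  · obtain ⟨h3, h4, h5⟩ := exists_sSup_oneSided hZ hwZ ⟨z, hzZ, hwz⟩
    exact h.notMem _ (.inl (hZM h3)) ⟨hz.1.trans_le (h5 z hzZ hwz), h4.trans hw.2⟩

theorem isClosed_fiber (f : C(I, I)) (y : I) : IsClosed {x | f x = y} :=
  isClosed_eq f.continuous continuous_const

theorem IsGap.const_of_apply_mem (h : IsGap f a b) (hx : x ∈ Ioo a b) (hfx : f x ∈ marked f) :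
    ∀ z ∈ Icc a b, f z = f x := by
  rcases h.subset_or_disjoint (isClosed_fiber f (f x)) (oneSided_preimage_subset_marked hfx)
    with h1 | h1
  · rw [← closure_Ioo h.lt.ne]
    exact closure_minimal h1 (isClosed_fiber f (f x))
  · exact (disjoint_left.1 h1 hx rfl).elim

/-- Two equal values enclose a local extremum (Rolle). Its value is marked, so its fibre meets the
gap and therefore contains it. -/
theorem IsGap.const_of_eq (h : IsGap f a b) (hx : x ∈ Icc a b) (hy : y ∈ Icc a b) (hxy : x < y)
    (hf : f x = f y) : (∀ z ∈ Icc a b, f z = f a) ∧ f a ∈ marked f := by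
  obtain ⟨c, hc, hce⟩ := exists_isLocalExtr_Ioo hxy f.continuous.continuousOn hf
  have hcI : c ∈ Ioo a b := ⟨hx.1.trans_lt hc.1, hc.2.trans_le hy.2⟩
  have hcm := IsLocalExtr.apply_mem_marked hce
  have := h.const_of_apply_mem hcI hcm
  have ha := this a ⟨le_rfl, h.lt.le⟩
  exact ⟨fun z hz => (this z hz).trans ha.symm, ha ▸ hcm⟩

theorem IsGap.const (h : IsGap f a b) (hf : f a = f b) :
    (∀ z ∈ Icc a b, f z = f a) ∧ f a ∈ marked f :=
  h.const_of_eq ⟨le_rfl, h.lt.le⟩ ⟨h.lt.le, le_rfl⟩ h.lt hf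

theorem IsGap.injOn (h : IsGap f a b) (hf : f a ≠ f b) : InjOn f (Icc a b) := by
  intro x hx y hy hxy
  by_contra hne
  have hb : b ∈ Icc a b := ⟨h.lt.le, le_rfl⟩
  rcases lt_or_gt_of_ne hne with hlt | hlt
  · exact hf ((h.const_of_eq hx hy hlt hxy).1 b hb).symm
  · exact hf ((h.const_of_eq hy hx hlt hxy.symm).1 b hb).symm

theorem IsGap.strictMonoOn (h : IsGap f a b) (hf : f a < f b) : StrictMonoOn f (Icc a b) := by
  rcases f.continuous.continuousOn.strictMonoOn_of_injOn_Icc' h.lt.le (h.injOn hf.ne) with h1 | h1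
  · exact h1
  · exact absurd (h1 ⟨le_rfl, h.lt.le⟩ ⟨h.lt.le, le_rfl⟩ h.lt) hf.not_gt

theorem IsGap.strictAntiOn (h : IsGap f a b) (hf : f b < f a) : StrictAntiOn f (Icc a b) := by
  rcases f.continuous.continuousOn.strictMonoOn_of_injOn_Icc' h.lt.le (h.injOn hf.ne') with h1 | h1
  · exact absurd (h1 ⟨le_rfl, h.lt.le⟩ ⟨h.lt.le, le_rfl⟩ h.lt) hf.not_gt
  · exact h1

theorem IsGap.bijOn_of_lt (h : IsGap f a b) (hf : f a < f b) :
    BijOn f (Ioo a b) (Ioo (f a) (f b)) := by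
  have hm := h.strictMonoOn hf
  refine ⟨fun x hx => ⟨hm ⟨le_rfl, h.lt.le⟩ ⟨hx.1.le, hx.2.le⟩ hx.1,
    hm ⟨hx.1.le, hx.2.le⟩ ⟨h.lt.le, le_rfl⟩ hx.2⟩, hm.injOn.mono Ioo_subset_Icc_self,
    intermediate_value_Ioo h.lt.le f.continuous.continuousOn⟩

theorem IsGap.bijOn_of_gt (h : IsGap f a b) (hf : f b < f a) :
    BijOn f (Ioo a b) (Ioo (f b) (f a)) := by
  have hm := h.strictAntiOn hf
  refine ⟨fun x hx => ⟨hm ⟨hx.1.le, hx.2.le⟩ ⟨h.lt.le, le_rfl⟩ hx.2,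
    hm ⟨le_rfl, h.lt.le⟩ ⟨hx.1.le, hx.2.le⟩ hx.1⟩, hm.injOn.mono Ioo_subset_Icc_self,
    intermediate_value_Ioo' h.lt.le f.continuous.continuousOn⟩

/-- End points in the closure suffice: the absence of marked points between them makes them
one-sided in the closure, hence nodes. Images of nodes are a priori known only to lie in the
closure. -/
theorem isGap_of_disjoint (hab : a < b) (ha : a ∈ closure (marked f))
    (hb : b ∈ closure (marked f)) (hd : ∀ z ∈ Ioo a b, z ∉ marked f) : IsGap f a b := by
  have hd' : ∀ z ∈ closure (marked f), ¬ (a < z ∧ z < b) := by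
    intro z hz hz'
    obtain ⟨w, hw, hw'⟩ := mem_closure_iff.1 hz _ isOpen_Ioo hz'
    exact hd w hw hw'
  refine ⟨hab, .inr ⟨ha, b, hab.ne', ?_⟩, .inr ⟨hb, a, hab.ne, ?_⟩,
    fun z hz => hd' z (nodes_subset_closure f hz)⟩
  · rintro z hz (h | h)
    · exact lt_asymm hab (h.1.trans h.2)
    · exact hd' z hz h
  · rintro z hz (h | h)
    · exact hd' z hz h
    · exact lt_asymm hab (h.1.trans h.2)

theorem IsGap.image_notMem_marked (h : IsGap f a b) (hf : f a ≠ f b) (hx : x ∈ Ioo a b) :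
    f x ∉ marked f := fun hm => by
  have := h.const_of_apply_mem hx hm
  exact hf ((this a ⟨le_rfl, h.lt.le⟩).trans (this b ⟨h.lt.le, le_rfl⟩).symm)

theorem IsGap.image_of_lt (h : IsGap f a b) (hf : f a < f b) : IsGap f (f a) (f b) := by
  refine isGap_of_disjoint hf (apply_mem_closure_marked (nodes_subset_closure f h.left))
    (apply_mem_closure_marked (nodes_subset_closure f h.right)) fun z hz => ?_
  obtain ⟨x, hx, rfl⟩ := (h.bijOn_of_lt hf).surjOn hz
  exact h.image_notMem_marked hf.ne hx

theorem IsGap.image_of_gt (h : IsGap f a b) (hf : f b < f a) : IsGap f (f b) (f a) := by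
  refine isGap_of_disjoint hf (apply_mem_closure_marked (nodes_subset_closure f h.right))
    (apply_mem_closure_marked (nodes_subset_closure f h.left)) fun z hz => ?_
  obtain ⟨x, hx, rfl⟩ := (h.bijOn_of_gt hf).surjOn hz
  exact h.image_notMem_marked hf.ne' hx

theorem IsGap.apply_mem_nodes (h : IsGap f a b) : f a ∈ nodes f ∧ f b ∈ nodes f := by
  rcases lt_trichotomy (f a) (f b) with hf | hf | hf
  · exact ⟨(h.image_of_lt hf).left, (h.image_of_lt hf).right⟩
  · have := (h.const hf).2
    exact ⟨.inl this, .inl (hf ▸ this)⟩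
  · exact ⟨(h.image_of_gt hf).right, (h.image_of_gt hf).left⟩

/-- An unmarked node is an end point of a gap, which `f` either collapses to a marked value or maps
onto another gap, carrying end points to end points. -/
theorem apply_mem_nodes (hx : x ∈ nodes f) : f x ∈ nodes f := by
  rcases hx with hx | ⟨hx, u, hu, H⟩
  · exact .inl (apply_mem_marked hx)
  · rcases lt_or_gt_of_ne hu with hlt | hlt
    · obtain ⟨z, h1, h2⟩ := exists_between hlt
      obtain ⟨a, b, hab, hz⟩ := exists_isGap (f := f) fun hz => H z hz (.inl ⟨h1, h2⟩)
      have hbx : b = x := by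
        refine le_antisymm ?_ ?_
        · by_contra! hb
          exact hab.notMem_closure ⟨hz.1.trans h2, hb⟩ hx
        · by_contra! hb
          exact H b (nodes_subset_closure f hab.right) (.inl ⟨h1.trans hz.2, hb⟩)
      exact hbx ▸ hab.apply_mem_nodes.2
    · obtain ⟨z, h1, h2⟩ := exists_between hlt
      obtain ⟨a, b, hab, hz⟩ := exists_isGap (f := f) fun hz => H z hz (.inr ⟨h1, h2⟩)
      have hbx : a = x := by
        refine le_antisymm ?_ ?_
        · by_contra! hb
          exact H a (nodes_subset_closure f hab.left) (.inr ⟨hb, hz.1.trans h2⟩)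
        · by_contra! hb
          exact hab.notMem_closure ⟨hb, h1.trans hz.2⟩ hx
      exact hbx ▸ hab.apply_mem_nodes.1

theorem IsGap.unique (h : IsGap f a b) {a' b' : I} (h' : IsGap f a' b') (hx : x ∈ Ioo a b)
    (hx' : x ∈ Ioo a' b') : a = a' ∧ b = b' := by
  refine ⟨?_, ?_⟩
  · rcases lt_trichotomy a a' with hlt | e | hlt
    · exact (h.notMem a' h'.left ⟨hlt, hx'.1.trans hx.2⟩).elim
    · exact e
    · exact (h'.notMem a h.left ⟨hlt, hx.1.trans hx'.2⟩).elim
  · rcases lt_trichotomy b b' with hlt | e | hlt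
    · exact (h'.notMem b h.right ⟨hx'.1.trans hx.2, hlt⟩).elim
    · exact e
    · exact (h.notMem b' h'.right ⟨hx.1.trans hx'.2, hlt⟩).elim

end BorelComplexity

namespace BorelComplexity

open Set Filter Topology

/-! ### Increasing bijections between subsets of the interval -/

/-- `h` restricts to an increasing bijection from `A` onto `C` and vanishes outside `A`. -/
structure IsoOn (h : I → I) (A C : Set I) : Prop where
  strictMonoOn : StrictMonoOn h A
  bijOn : BijOn h A C
  eq_zero : ∀ z ∉ A, h z = 0

/-- The normalization outside `A` turns agreement on `A` into equality of functions, as needed for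
fibres of the equivariant section. -/
theorem IsoOn.ext {h k : I → I} {A C C' : Set I} (hh : IsoOn h A C) (hk : IsoOn k A C')
    (H : ∀ z ∈ A, h z = k z) : h = k := by
  funext z
  by_cases hz : z ∈ A
  · exact H z hz
  · rw [hh.eq_zero z hz, hk.eq_zero z hz]

/-- `α` and `β` are both increasing on the respective sets or both decreasing. -/
def SameDirection (α β : I → I) (A C : Set I) : Prop :=
  (StrictMonoOn α A ∧ StrictMonoOn β C) ∨ (StrictAntiOn α A ∧ StrictAntiOn β C)

theorem SameDirection.lt_iff {α β : I → I} {A C : Set I} (hd : SameDirection α β A C) {x y x' y' : I}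
    (hx : x ∈ A) (hy : y ∈ A) (hx' : x' ∈ C) (hy' : y' ∈ C) (h : x < y ↔ x' < y')
    (h' : y < x ↔ y' < x') : α x < α y ↔ β x' < β y' := by
  rcases hd with ⟨h1, h2⟩ | ⟨h1, h2⟩
  · rw [h1.lt_iff_lt hx hy, h2.lt_iff_lt hx' hy', h]
  · rw [h1.lt_iff_gt hx hy, h2.lt_iff_gt hx' hy', h']

/-- The new bijection is `β ∘ h ∘ α⁻¹`. It is increasing because `α` and `β` either both preserve or
both reverse order. -/
theorem IsoOn.exists_push {α β h : I → I} {A A' C C' : Set I} (hα : BijOn α A A')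
    (hβ : BijOn β C C') (hd : SameDirection α β A C) (hh : IsoOn h A C) :
    ∃ k, IsoOn k A' C' ∧ ∀ z ∈ A, k (α z) = β (h z) := by
  classical
  let k : I → I := fun z => if z ∈ A' then β (h (Function.invFunOn α A z)) else 0
  have hk : ∀ z ∈ A, k (α z) = β (h z) := fun z hz => by
    simp only [k, if_pos (hα.mapsTo hz), hα.injOn.leftInvOn_invFunOn hz]
  have hmono : StrictMonoOn k A' := by
    intro x hx y hy hxy
    obtain ⟨x, hxA, rfl⟩ := hα.surjOn hx
    obtain ⟨y, hyA, rfl⟩ := hα.surjOn hy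
    rw [hk x hxA, hk y hyA]
    exact (hd.lt_iff hxA hyA (hh.bijOn.mapsTo hxA) (hh.bijOn.mapsTo hyA)
      (hh.strictMonoOn.lt_iff_lt hxA hyA).symm (hh.strictMonoOn.lt_iff_lt hyA hxA).symm).1 hxy
  refine ⟨k, ⟨hmono, ⟨?_, hmono.injOn, ?_⟩, fun z hz => if_neg hz⟩, hk⟩
  · intro x hx
    obtain ⟨x, hxA, rfl⟩ := hα.surjOn hx
    rw [hk x hxA]
    exact hβ.mapsTo (hh.bijOn.mapsTo hxA)
  · intro y hy
    obtain ⟨y, hyC, rfl⟩ := hβ.surjOn hy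
    obtain ⟨x, hx, rfl⟩ := hh.bijOn.surjOn hyC
    exact ⟨α x, hα.mapsTo hx, hk x hx⟩

/-- Dually, the bijection is `β⁻¹ ∘ k ∘ α`. Pushing and pulling make the step between fibres over
consecutive gaps bijective. -/
theorem IsoOn.exists_pull {α β k : I → I} {A A' C C' : Set I} (hα : BijOn α A A')
    (hβ : BijOn β C C') (hd : SameDirection α β A C) (hk : IsoOn k A' C') :
    ∃ h, IsoOn h A C ∧ ∀ z ∈ A, k (α z) = β (h z) := by
  classical
  let h : I → I := fun z => if z ∈ A then Function.invFunOn β C (k (α z)) else 0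
  have hex : ∀ z ∈ A, k (α z) ∈ β '' C := fun z hz =>
    hβ.surjOn (hk.bijOn.mapsTo (hα.mapsTo hz))
  have hhC : ∀ z ∈ A, h z ∈ C := fun z hz => by
    simp only [h, if_pos hz]
    exact Function.invFunOn_mem (hex z hz)
  have hh : ∀ z ∈ A, k (α z) = β (h z) := fun z hz => by
    simp only [h, if_pos hz]
    exact (Function.invFunOn_eq (hex z hz)).symm
  have hlt : ∀ x ∈ A, ∀ y ∈ A, α x < α y ↔ β (h x) < β (h y) := fun x hx y hy => by
    rw [← hh x hx, ← hh y hy, hk.strictMonoOn.lt_iff_lt (hα.mapsTo hx) (hα.mapsTo hy)]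
  have hmono : StrictMonoOn h A := by
    intro x hx y hy hxy
    rcases hd with ⟨h1, h2⟩ | ⟨h1, h2⟩
    · exact (h2.lt_iff_lt (hhC x hx) (hhC y hy)).1 ((hlt x hx y hy).1 (h1 hx hy hxy))
    · exact (h2.lt_iff_gt (hhC y hy) (hhC x hx)).1 ((hlt y hy x hx).1 (h1 hx hy hxy))
  refine ⟨h, ⟨hmono, ⟨hhC, hmono.injOn, ?_⟩, fun z hz => if_neg hz⟩, hh⟩
  intro v hv
  obtain ⟨u, hu, huv⟩ := hk.bijOn.surjOn (hβ.mapsTo hv)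
  obtain ⟨w, hw, rfl⟩ := hα.surjOn hu
  exact ⟨w, hw, hβ.injOn (hhC w hw) hv ((hh w hw).symm.trans huv)⟩

theorem exists_isoOn_of_orderIso {A C : Set I} (e : A ≃o C) :
    ∃ h, IsoOn h A C ∧ ∀ z : A, h z = e z := by
  classical
  let h : I → I := fun z => if hz : z ∈ A then e ⟨z, hz⟩ else 0
  have hh : ∀ z : A, h z = e z := fun z => dif_pos z.2
  have hmono : StrictMonoOn h A := fun x hx y hy hxy => by
    have : e ⟨x, hx⟩ < e ⟨y, hy⟩ := e.strictMono hxy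
    rwa [← Subtype.coe_lt_coe, ← hh, ← hh] at this
  refine ⟨h, ⟨hmono, ⟨fun x hx => ?_, hmono.injOn, fun y hy => ?_⟩, fun z hz => dif_neg hz⟩, hh⟩
  · exact hh ⟨x, hx⟩ ▸ (e ⟨x, hx⟩).2
  · exact ⟨e.symm ⟨y, hy⟩, (e.symm ⟨y, hy⟩).2, by rw [hh, e.apply_symm_apply]⟩

theorem nonempty_real_orderIso_Ioo {a b : I} (hab : a < b) : Nonempty (ℝ ≃o Ioo a b) := by
  have hab' : (0 : ℝ) < b - a := sub_pos.2 hab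
  let s := orderIsoIooNegOneOne ℝ
  have hs : ∀ y, -1 < (s y : ℝ) ∧ (s y : ℝ) < 1 := fun y => (s y).2
  have ha0 := a.2.1
  have hb1 := b.2.2
  have h1 : ∀ y, (a : ℝ) < a + (b - a) * ((s y + 1) / 2) := fun y => by
    have := mul_pos hab' (show (0 : ℝ) < (s y + 1) / 2 by linarith [hs y])
    linarith
  have h2 : ∀ y, (a : ℝ) + (b - a) * ((s y + 1) / 2) < (b : ℝ) := fun y => by
    have := mul_lt_mul_of_pos_left (show ((s y : ℝ) + 1) / 2 < 1 by linarith [hs y]) hab'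
    linarith
  let ρ : ℝ → Ioo a b := fun y =>
    ⟨⟨a + (b - a) * ((s y + 1) / 2), by linarith [h1 y], by linarith [h2 y]⟩, h1 y, h2 y⟩
  have hρ : StrictMono ρ := fun x y hxy => by
    have hlt : (s x : ℝ) < s y := s.strictMono hxy
    change (a : ℝ) + (b - a) * ((s x + 1) / 2) < a + (b - a) * ((s y + 1) / 2)
    have := mul_lt_mul_of_pos_left (show ((s x : ℝ) + 1) / 2 < (s y + 1) / 2 by linarith) hab'
    linarith
  refine ⟨hρ.orderIsoOfSurjective ρ fun z => ?_⟩
  have hz1 : (a : ℝ) < z := z.2.1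
  have hz2 : (z : ℝ) < b := z.2.2
  have h3 : 0 < ((z : ℝ) - a) / (b - a) := div_pos (by linarith) hab'
  have h4 : ((z : ℝ) - a) / (b - a) < 1 := (div_lt_one hab').2 (by linarith)
  refine ⟨s.symm ⟨2 * (((z : ℝ) - a) / (b - a)) - 1, by linarith, by linarith⟩, ?_⟩
  refine Subtype.ext (Subtype.ext ?_)
  change (a : ℝ) + (b - a) * ((s (s.symm _) + 1) / 2) = z
  rw [s.apply_symm_apply]
  field_simp
  ring

/-- Carried to the line, both maps are conjugate to the translation by `1`, hence to each other. -/
theorem exists_conj_of_lt {X Y : Type*} [LinearOrder X] [LinearOrder Y] (eX : ℝ ≃o X)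
    (eY : ℝ ≃o Y) {α : X ≃o X} {β : Y ≃o Y} (hα : ∀ x, x < α x) (hβ : ∀ y, y < β y) :
    ∃ h : X ≃o Y, ∀ x, h (α x) = β (h x) := by
  obtain ⟨p, hp⟩ := exists_conj_translation (α := eX.trans (α.trans eX.symm)) fun x => by
    simpa [OrderIso.lt_symm_apply] using hα (eX x)
  obtain ⟨q, hq⟩ := exists_conj_translation (α := eY.trans (β.trans eY.symm)) fun x => by
    simpa [OrderIso.lt_symm_apply] using hβ (eY x)
  refine ⟨eX.symm.trans (p.symm.trans (q.trans eY)), fun x => ?_⟩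
  have h1 : p.symm (eX.symm (α x)) = p.symm (eX.symm x) + 1 := by
    rw [OrderIso.symm_apply_eq, hp]
    simp
  simp only [OrderIso.trans_apply, h1, hq]
  simp

theorem exists_isoOn_conj {a b c d : I} (hab : a < b) (hcd : c < d) {F G : I → I}
    (hF : StrictMonoOn F (Ioo a b)) (hFb : BijOn F (Ioo a b) (Ioo a b))
    (hG : StrictMonoOn G (Ioo c d)) (hGb : BijOn G (Ioo c d) (Ioo c d))
    (h : ((∀ z ∈ Ioo a b, F z = z) ∧ ∀ z ∈ Ioo c d, G z = z) ∨
      ((∀ z ∈ Ioo a b, z < F z) ∧ ∀ z ∈ Ioo c d, z < G z) ∨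
      ((∀ z ∈ Ioo a b, F z < z) ∧ ∀ z ∈ Ioo c d, G z < z)) :
    ∃ h, IsoOn h (Ioo a b) (Ioo c d) ∧ ∀ z ∈ Ioo a b, h (F z) = G (h z) := by
  obtain ⟨p⟩ := nonempty_real_orderIso_Ioo hab
  obtain ⟨q⟩ := nonempty_real_orderIso_Ioo hcd
  let α : Ioo a b ≃o Ioo a b := (hF.orderIso F _).trans (OrderIso.setCongr _ _ hFb.image_eq)
  let β : Ioo c d ≃o Ioo c d := (hG.orderIso G _).trans (OrderIso.setCongr _ _ hGb.image_eq)
  have hα : ∀ x, (α x : I) = F x := fun x => rfl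
  have hβ : ∀ x, (β x : I) = G x := fun x => rfl
  have hsuff : ∀ e : Ioo a b ≃o Ioo c d, (∀ x, e (α x) = β (e x)) →
      ∃ h, IsoOn h (Ioo a b) (Ioo c d) ∧ ∀ z ∈ Ioo a b, h (F z) = G (h z) := by
    intro e he
    obtain ⟨h, hh, hhe⟩ := exists_isoOn_of_orderIso e
    refine ⟨h, hh, fun z hz => ?_⟩
    have := congrArg Subtype.val (he ⟨z, hz⟩)
    rwa [← hhe, hα, hβ, ← hhe] at this
  rcases h with ⟨h1, h2⟩ | ⟨h1, h2⟩ | ⟨h1, h2⟩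
  · refine hsuff (p.symm.trans q) fun x => ?_
    have e1 : α x = x := Subtype.ext (h1 x x.2)
    rw [e1]
    exact (Subtype.ext (h2 _ (Subtype.prop _))).symm
  · obtain ⟨e, he⟩ := exists_conj_of_lt p q (α := α) (β := β) (fun x => h1 x x.2)
      (fun x => h2 x x.2)
    exact hsuff e he
  -- Maps moving points down have inverses moving them up, and a conjugacy of the inverses is a
  -- conjugacy of the maps.
  · obtain ⟨e, he⟩ := exists_conj_of_lt p q (α := α.symm) (β := β.symm)
      (fun x => by rw [OrderIso.lt_symm_apply]; exact h1 x x.2)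
      (fun x => by rw [OrderIso.lt_symm_apply]; exact h2 x x.2)
    refine hsuff e fun x => ?_
    have := he (α x)
    rw [OrderIso.symm_apply_apply] at this
    rw [this, OrderIso.apply_symm_apply]

/-! ### Dynamics on gaps -/

variable {f g : C(I, I)}

/-- A map that moves the points of a gap along `f` if `f` is injective on it, and fixes them if `f`
is constant on it. -/
noncomputable def gapStep (f : C(I, I)) (z : I) : I :=
  open Classical in if ∀ᶠ w in 𝓝 z, f w = f z then z else f z

/-- The gap onto which `gapStep` maps a given gap. -/
noncomputable def gapNext (f : C(I, I)) (J : I × I) : I × I :=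
  if f J.1 = f J.2 then J else (min (f J.1) (f J.2), max (f J.1) (f J.2))

theorem IsGap.gapStep_of_eq {a b z : I} (h : IsGap f a b) (hf : f a = f b) (hz : z ∈ Ioo a b) :
    gapStep f z = z := by
  refine if_pos ?_
  filter_upwards [isOpen_Ioo.mem_nhds hz] with w hw
  rw [(h.const hf).1 w (Ioo_subset_Icc_self hw), (h.const hf).1 z (Ioo_subset_Icc_self hz)]

theorem IsGap.gapStep_of_ne {a b z : I} (h : IsGap f a b) (hf : f a ≠ f b) (hz : z ∈ Ioo a b) :
    gapStep f z = f z := by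
  refine if_neg fun hev => ?_
  -- Local constancy at `z` would give a second point of the gap with the same value, against
  -- injectivity.
  have hev' : ∀ᶠ w in 𝓝[>] z, f w = f z ∧ w ∈ Ioo a b ∧ z < w := by
    filter_upwards [hev.filter_mono nhdsWithin_le_nhds,
      (show ∀ᶠ w in 𝓝 z, w ∈ Ioo a b from isOpen_Ioo.mem_nhds hz).filter_mono nhdsWithin_le_nhds,
      self_mem_nhdsWithin] with w h1 h2 h3
    exact ⟨h1, h2, h3⟩
  have : (𝓝[>] z).NeBot := nhdsGT_neBot_of_exists_gt ⟨b, hz.2⟩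
  obtain ⟨w, h1, h2, h3⟩ := hev'.exists
  exact h3.ne' (h.injOn hf (Ioo_subset_Icc_self h2) (Ioo_subset_Icc_self hz) h1)

theorem IsGap.next {J : I × I} (h : IsGap f J.1 J.2) : IsGap f (gapNext f J).1 (gapNext f J).2 := by
  unfold gapNext
  rcases lt_trichotomy (f J.1) (f J.2) with hf | hf | hf
  · rw [if_neg hf.ne, min_eq_left hf.le, max_eq_right hf.le]
    exact h.image_of_lt hf
  · rwa [if_pos hf]
  · rw [if_neg hf.ne', min_eq_right hf.le, max_eq_left hf.le]
    exact h.image_of_gt hf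

theorem IsGap.gapStep_bijOn {J : I × I} (h : IsGap f J.1 J.2) :
    BijOn (gapStep f) (Ioo J.1 J.2) (Ioo (gapNext f J).1 (gapNext f J).2) := by
  unfold gapNext
  rcases lt_trichotomy (f J.1) (f J.2) with hf | hf | hf
  · rw [if_neg hf.ne, min_eq_left hf.le, max_eq_right hf.le]
    exact (h.bijOn_of_lt hf).congr fun z hz => (h.gapStep_of_ne hf.ne hz).symm
  · rw [if_pos hf]
    exact (bijOn_id _).congr fun z hz => (h.gapStep_of_eq hf hz).symm
  · rw [if_neg hf.ne', min_eq_right hf.le, max_eq_left hf.le]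
    exact (h.bijOn_of_gt hf).congr fun z hz => (h.gapStep_of_ne hf.ne' hz).symm

theorem IsGap.gapStep_strictMonoOn {a b : I} (h : IsGap f a b) (hf : f a ≤ f b) :
    StrictMonoOn (gapStep f) (Ioo a b) := by
  rcases hf.eq_or_lt with hf | hf
  · exact strictMonoOn_id.congr fun z hz => (h.gapStep_of_eq hf hz).symm
  · exact ((h.strictMonoOn hf).mono Ioo_subset_Icc_self).congr
      fun z hz => (h.gapStep_of_ne hf.ne hz).symm

theorem IsGap.gapStep_strictAntiOn {a b : I} (h : IsGap f a b) (hf : f b < f a) :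
    StrictAntiOn (gapStep f) (Ioo a b) :=
  ((h.strictAntiOn hf).mono Ioo_subset_Icc_self).congr
    fun _ hz => (h.gapStep_of_ne hf.ne' hz).symm

theorem IsGap.iterate_next {J : I × I} (h : IsGap f J.1 J.2) (n : ℕ) :
    IsGap f ((gapNext f)^[n] J).1 ((gapNext f)^[n] J).2 := by
  induction n with
  | zero => exact h
  | succ n ih => rw [Function.iterate_succ_apply']; exact ih.next

theorem IsGap.gapStep_iterate_bijOn {J : I × I} (h : IsGap f J.1 J.2) (n : ℕ) :
    BijOn (gapStep f)^[n] (Ioo J.1 J.2)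
      (Ioo ((gapNext f)^[n] J).1 ((gapNext f)^[n] J).2) := by
  induction n with
  | zero => exact bijOn_id _
  | succ n ih =>
    rw [Function.iterate_succ', Function.iterate_succ']
    exact (h.iterate_next n).gapStep_bijOn.comp ih

/-- On a periodic gap on which `f` is not constant, `gapStep f` iterates as `f` does. -/
theorem IsGap.gapStep_iterate_eq {J : I × I} (h : IsGap f J.1 J.2) (hf : f J.1 ≠ f J.2) {p : ℕ}
    (hp : (gapNext f)^[p] J = J) {z : I} (hz : z ∈ Ioo J.1 J.2) : (gapStep f)^[p] z = f^[p] z := by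
  have key : ∀ n ≤ p, (gapStep f)^[n] z = f^[n] z := by
    intro n
    induction n with
    | zero => exact fun _ => rfl
    | succ n ih =>
      intro hn
      rw [Function.iterate_succ_apply', Function.iterate_succ_apply', ← ih (by omega)]
      refine (h.iterate_next n).gapStep_of_ne (fun he => hf ?_)
        ((h.gapStep_iterate_bijOn n).mapsTo hz)
      -- A gap on which `f` is constant is stationary for `gapNext`; if the cycle of `J` reached
      -- one, it would be `J` itself.
      have hfix : gapNext f ((gapNext f)^[n] J) = (gapNext f)^[n] J := if_pos he
      have hJ : (gapNext f)^[n] J = J := by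
        conv_rhs => rw [← hp, show p = (p - n) + n by omega, Function.iterate_add_apply]
        exact (Function.iterate_fixed hfix _).symm
      rwa [hJ] at he
  exact key p le_rfl

theorem isClosed_fix_iterate (f : C(I, I)) (n : ℕ) : IsClosed {x | f^[n] x = x} :=
  isClosed_eq (f.continuous.iterate n) continuous_id

/-- On a gap mapped onto itself by `f^[p]`, this iterate is increasing, and it is the identity, or
moves all points up, or moves all points down. -/
theorem IsGap.return_map {a b : I} (h : IsGap f a b) {p : ℕ}
    (hb : BijOn f^[p] (Ioo a b) (Ioo a b)) :
    StrictMonoOn f^[p] (Ioo a b) ∧ ((∀ z ∈ Ioo a b, f^[p] z = z) ∨ (∀ z ∈ Ioo a b, z < f^[p] z) ∨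
      ∀ z ∈ Ioo a b, f^[p] z < z) := by
  have hc : Continuous f^[p] := f.continuous.iterate p
  have hfix := h.subset_or_disjoint (isClosed_fix_iterate f p) (oneSided_fix_subset_marked f p)
  have hivt : ∀ z ∈ Ioo a b, ∀ w ∈ Ioo a b, z < f^[p] z → f^[p] w < w →
      ∃ c ∈ Ioo a b, f^[p] c = c := by
    intro z hz w hw h1 h2
    obtain ⟨c, hc, hc'⟩ := isPreconnected_Ioo.intermediate_value₂ hw hz hc.continuousOn
      continuousOn_id h2.le h1.le
    exact ⟨c, hc, hc'⟩
  rcases hfix with hall | hno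
  · exact ⟨strictMonoOn_id.congr fun z hz => (hall hz).symm, .inl fun z hz => hall hz⟩
  · have hno' : ∀ z ∈ Ioo a b, f^[p] z ≠ z := fun z hz => disjoint_left.1 hno hz
    refine ⟨?_, ?_⟩
    · rcases hc.continuousOn.strictMonoOn_of_injOn_Ioo h.lt hb.injOn with h1 | h1
      · exact h1
      -- A decreasing self-map of the gap would push some point up and its image down, and so have a
      -- fixed point between them.
      · exfalso
        obtain ⟨z, hz⟩ := exists_between h.lt
        have hz' : z ∈ Ioo a b := hz
        have hFz := hb.mapsTo hz'
        rcases lt_or_gt_of_ne (hno' z hz) with hlt | hlt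
        · obtain ⟨c, hc, hc'⟩ := hivt _ hFz z hz (h1 hFz hz hlt) hlt
          exact hno' c hc hc'
        · obtain ⟨c, hc, hc'⟩ := hivt z hz _ hFz hlt (h1 hz hFz hlt)
          exact hno' c hc hc'
    · right
      by_contra! hcon
      obtain ⟨⟨z, hz, hz'⟩, w, hw, hw'⟩ := hcon
      obtain ⟨c, hc, hc'⟩ := hivt w hw z hz (lt_of_le_of_ne hw' (hno' w hw).symm)
        (lt_of_le_of_ne hz' (hno' z hz))
      exact hno' c hc hc'

end BorelComplexity

namespace BorelComplexity

open Set Filter Topology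

/-! ### Reconstructing a conjugacy from its action on the nodes -/

/-- Between `a` and `b` the iterate `f^[p]` moves no point away from `b`. -/
def MovesTowards (f : C(I, I)) (p : ℕ) (a b : I) : Prop :=
  (∀ z, a < z → z < b → z ≤ f^[p] z) ∧ ∀ z, b < z → z < a → f^[p] z ≤ z

/-- `φ` is an increasing bijection between the nodes of `f` and `g` that respects the values of `f`
and `g` and the direction in which their iterates move points. -/
structure NodeMatch (f g : C(I, I)) (φ : I → I) : Prop where
  strictMonoOn : StrictMonoOn φ (nodes f)
  bijOn : BijOn φ (nodes f) (nodes g)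
  map_apply : ∀ a ∈ nodes f, φ (f a) = g (φ a)
  movesTowards : ∀ p, ∀ a ∈ nodes f, ∀ b ∈ nodes f,
    MovesTowards f p a b ↔ MovesTowards g p (φ a) (φ b)

variable {f g : C(I, I)} {φ : I → I}

theorem NodeMatch.isGap (hφ : NodeMatch f g φ) {a b : I} (h : IsGap f a b) :
    IsGap g (φ a) (φ b) := by
  refine ⟨hφ.strictMonoOn h.left h.right h.lt, hφ.bijOn.mapsTo h.left, hφ.bijOn.mapsTo h.right, ?_⟩
  intro z hz
  obtain ⟨c, hc, rfl⟩ := hφ.bijOn.surjOn hz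
  rw [hφ.strictMonoOn.lt_iff_lt h.left hc, hφ.strictMonoOn.lt_iff_lt hc h.right]
  exact h.notMem c hc

theorem NodeMatch.exists_isGap (hφ : NodeMatch f g φ) {c d : I} (h : IsGap g c d) :
    ∃ a b, IsGap f a b ∧ φ a = c ∧ φ b = d := by
  obtain ⟨a, ha, rfl⟩ := hφ.bijOn.surjOn h.left
  obtain ⟨b, hb, rfl⟩ := hφ.bijOn.surjOn h.right
  refine ⟨a, b, ⟨(hφ.strictMonoOn.lt_iff_lt ha hb).1 h.lt, ha, hb, fun z hz hz' => ?_⟩, rfl, rfl⟩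
  exact h.notMem (φ z) (hφ.bijOn.mapsTo hz)
    ⟨hφ.strictMonoOn ha hz hz'.1, hφ.strictMonoOn hz hb hz'.2⟩

theorem NodeMatch.apply_lt_iff (hφ : NodeMatch f g φ) {a b : I} (ha : a ∈ nodes f)
    (hb : b ∈ nodes f) : g (φ a) < g (φ b) ↔ f a < f b := by
  rw [← hφ.map_apply a ha, ← hφ.map_apply b hb,
    hφ.strictMonoOn.lt_iff_lt (apply_mem_nodes ha) (apply_mem_nodes hb)]

theorem NodeMatch.apply_eq_iff (hφ : NodeMatch f g φ) {a b : I} (ha : a ∈ nodes f)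
    (hb : b ∈ nodes f) : g (φ a) = g (φ b) ↔ f a = f b := by
  rw [← hφ.map_apply a ha, ← hφ.map_apply b hb,
    hφ.strictMonoOn.injOn.eq_iff (apply_mem_nodes ha) (apply_mem_nodes hb)]

theorem NodeMatch.gapNext (hφ : NodeMatch f g φ) {J : I × I} (h : IsGap f J.1 J.2) :
    gapNext g (Prod.map φ φ J) = Prod.map φ φ (gapNext f J) := by
  have hlt := hφ.apply_lt_iff h.left h.right
  have hgt := hφ.apply_lt_iff h.right h.left
  have heq := hφ.apply_eq_iff h.left h.right
  unfold BorelComplexity.gapNext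
  simp only [Prod.map_fst, Prod.map_snd]
  rcases lt_trichotomy (f J.1) (f J.2) with hf | hf | hf
  · have hg := hlt.2 hf
    rw [if_neg hf.ne, if_neg hg.ne, min_eq_left hf.le, max_eq_right hf.le, min_eq_left hg.le,
      max_eq_right hg.le, ← hφ.map_apply _ h.left, ← hφ.map_apply _ h.right]
    rfl
  · rw [if_pos hf, if_pos (heq.2 hf)]
  · have hg := hgt.2 hf
    rw [if_neg hf.ne', if_neg hg.ne', min_eq_right hf.le, max_eq_left hf.le, min_eq_right hg.le,
      max_eq_left hg.le, ← hφ.map_apply _ h.left, ← hφ.map_apply _ h.right]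
    rfl

theorem NodeMatch.gapNext_iterate (hφ : NodeMatch f g φ) {J : I × I} (h : IsGap f J.1 J.2) (n : ℕ) :
    (BorelComplexity.gapNext g)^[n] (Prod.map φ φ J) =
      Prod.map φ φ ((BorelComplexity.gapNext f)^[n] J) := by
  induction n with
  | zero => rfl
  | succ n ih =>
    rw [Function.iterate_succ_apply', Function.iterate_succ_apply', ih,
      hφ.gapNext (h.iterate_next n)]

theorem NodeMatch.sameDirection (hφ : NodeMatch f g φ) {a b : I} (h : IsGap f a b) :
    SameDirection (gapStep f) (gapStep g) (Ioo a b) (Ioo (φ a) (φ b)) := by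
  rcases le_or_gt (f a) (f b) with hf | hf
  · refine .inl ⟨h.gapStep_strictMonoOn hf, (hφ.isGap h).gapStep_strictMonoOn ?_⟩
    rwa [← not_lt, hφ.apply_lt_iff h.right h.left, not_lt]
  · exact .inr ⟨h.gapStep_strictAntiOn hf, (hφ.isGap h).gapStep_strictAntiOn
      ((hφ.apply_lt_iff h.right h.left).2 hf)⟩

/-- On a periodic gap there is an increasing bijection that commutes with the return maps. -/
theorem NodeMatch.exists_periodic (hφ : NodeMatch f g φ) {J : I × I} (h : IsGap f J.1 J.2) {p : ℕ}
    (hp : (BorelComplexity.gapNext f)^[p] J = J) :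
    ∃ k, IsoOn k (Ioo J.1 J.2) (Ioo (φ J.1) (φ J.2)) ∧
      ∀ z ∈ Ioo J.1 J.2, k ((gapStep f)^[p] z) = (gapStep g)^[p] (k z) := by
  have hg := hφ.isGap h
  by_cases hf : f J.1 = f J.2
  · have hgf := (hφ.apply_eq_iff h.left h.right).2 hf
    obtain ⟨k, hk, -⟩ := exists_isoOn_conj h.lt hg.lt strictMonoOn_id (bijOn_id _) strictMonoOn_id
      (bijOn_id _) (.inl ⟨fun _ _ => rfl, fun _ _ => rfl⟩)
    refine ⟨k, hk, fun z hz => ?_⟩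
    rw [Function.iterate_fixed (h.gapStep_of_eq hf hz),
      Function.iterate_fixed (hg.gapStep_of_eq hgf (hk.bijOn.mapsTo hz))]
  · have hgf : g (φ J.1) ≠ g (φ J.2) := mt (hφ.apply_eq_iff h.left h.right).1 hf
    have hpg : (BorelComplexity.gapNext g)^[p] (φ J.1, φ J.2) = (φ J.1, φ J.2) := by
      have := hφ.gapNext_iterate h p
      rwa [hp] at this
    have hfe : ∀ z ∈ Ioo J.1 J.2, (gapStep f)^[p] z = f^[p] z := fun z hz =>
      h.gapStep_iterate_eq hf hp hz
    have hge : ∀ z ∈ Ioo (φ J.1) (φ J.2), (gapStep g)^[p] z = g^[p] z := fun z hz =>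
      IsGap.gapStep_iterate_eq (J := (φ J.1, φ J.2)) hg hgf hpg hz
    have hfb : BijOn f^[p] (Ioo J.1 J.2) (Ioo J.1 J.2) := by
      have := h.gapStep_iterate_bijOn p
      rw [hp] at this
      exact this.congr hfe
    have hgb : BijOn g^[p] (Ioo (φ J.1) (φ J.2)) (Ioo (φ J.1) (φ J.2)) := by
      have := IsGap.gapStep_iterate_bijOn (J := (φ J.1, φ J.2)) hg p
      rw [hpg] at this
      exact this.congr hge
    obtain ⟨hfm, hft⟩ := h.return_map hfb
    obtain ⟨hgm, hgt⟩ := hg.return_map hgb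
    have hup : ∀ {q : C(I, I)} {a b : I}, a < b →
        (MovesTowards q p a b ↔ ∀ z ∈ Ioo a b, z ≤ q^[p] z) := fun {q a b} hab =>
      ⟨fun H z hz => H.1 z hz.1 hz.2, fun H => ⟨fun z h1 h2 => H z ⟨h1, h2⟩,
        fun z h1 h2 => absurd (h1.trans h2) hab.not_gt⟩⟩
    have hdown : ∀ {q : C(I, I)} {a b : I}, a < b →
        (MovesTowards q p b a ↔ ∀ z ∈ Ioo a b, q^[p] z ≤ z) := fun {q a b} hab =>
      ⟨fun H z hz => H.2 z hz.1 hz.2, fun H => ⟨fun z h1 h2 => absurd (h1.trans h2) hab.not_gt,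
        fun z h1 h2 => H z ⟨h1, h2⟩⟩⟩
    -- For `a < b`, moving towards `b` means `z ≤ f^[p] z` on the gap, and moving towards `a` the
    -- opposite inequality. Both hold exactly when the return map is the identity, so the two
    -- together transfer the trichotomy of `IsGap.return_map` to `g`.
    have h1 := hφ.movesTowards p _ h.left _ h.right
    have h2 := hφ.movesTowards p _ h.right _ h.left
    rw [hup h.lt, hup hg.lt] at h1
    rw [hdown h.lt, hdown hg.lt] at h2
    obtain ⟨x, hx⟩ : (Ioo J.1 J.2).Nonempty := nonempty_Ioo.2 h.lt
    obtain ⟨y, hy⟩ : (Ioo (φ J.1) (φ J.2)).Nonempty := nonempty_Ioo.2 hg.lt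
    obtain ⟨k, hk, hk'⟩ := exists_isoOn_conj h.lt hg.lt hfm hfb hgm hgb (by
      rcases hft with hft | hft | hft
      · refine .inl ⟨hft, fun z hz => le_antisymm ?_ ?_⟩
        · exact h2.1 (fun z hz => (hft z hz).le) z hz
        · exact h1.1 (fun z hz => (hft z hz).ge) z hz
      · have h3 := h1.1 fun z hz => (hft z hz).le
        have h4 : ¬ ∀ z ∈ Ioo (φ J.1) (φ J.2), g^[p] z ≤ z := fun H =>
          (h2.2 H x hx).not_gt (hft x hx)
        rcases hgt with hgt | hgt | hgt
        · exact (h4 fun z hz => (hgt z hz).le).elim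
        · exact .inr (.inl ⟨hft, hgt⟩)
        · exact (h4 fun z hz => (hgt z hz).le).elim
      · have h3 : ¬ ∀ z ∈ Ioo (φ J.1) (φ J.2), z ≤ g^[p] z := fun H =>
          (h1.2 H x hx).not_gt (hft x hx)
        rcases hgt with hgt | hgt | hgt
        · exact (h3 fun z hz => (hgt z hz).ge).elim
        · exact (h3 fun z hz => (hgt z hz).le).elim
        · exact .inr (.inr ⟨hft, hgt⟩))
    refine ⟨k, hk, fun z hz => ?_⟩
    rw [hfe z hz, hge _ (hk.bijOn.mapsTo hz), hk' z hz]

/-- A coherent choice of increasing bijections between corresponding gaps. -/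
theorem NodeMatch.exists_gap_family (hφ : NodeMatch f g φ) :
    ∃ k : I × I → I → I, ∀ J : I × I, IsGap f J.1 J.2 →
      IsoOn (k J) (Ioo J.1 J.2) (Ioo (φ J.1) (φ J.2)) ∧
      ∀ z ∈ Ioo J.1 J.2, k (BorelComplexity.gapNext f J) (gapStep f z) = gapStep g (k J z) := by
  classical
  let B := {J : I × I // IsGap f J.1 J.2}
  let T : B → B := fun J => ⟨BorelComplexity.gapNext f J.1, J.2.next⟩
  have hT : ∀ (n : ℕ) (J : B), (T^[n] J).1 = (BorelComplexity.gapNext f)^[n] J.1 := fun n J =>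
    Function.Semiconj.iterate_right (f := Subtype.val) (ga := T) (gb := BorelComplexity.gapNext f)
      (fun _ => rfl) n J
  -- The bundle over the gaps whose fibre consists of the increasing bijections onto the matched
  -- gap; an equivariant section is a coherent family.
  let X := {q : B × (I → I) // IsoOn q.2 (Ioo q.1.1.1 q.1.1.2) (Ioo (φ q.1.1.1) (φ q.1.1.2))}
  have hbij : ∀ J : B, BijOn (gapStep g) (Ioo (φ J.1.1) (φ J.1.2))
      (Ioo (φ (T J).1.1) (φ (T J).1.2)) := fun J => by
    have := IsGap.gapStep_bijOn (J := Prod.map φ φ J.1) (hφ.isGap J.2)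
    rwa [hφ.gapNext J.2] at this
  have hpush : ∀ x : X, ∃ y : X, y.1.1 = T x.1.1 ∧
      ∀ z ∈ Ioo x.1.1.1.1 x.1.1.1.2, y.1.2 (gapStep f z) = gapStep g (x.1.2 z) := by
    rintro ⟨⟨J, h⟩, hx⟩
    obtain ⟨k, hk, hk'⟩ := hx.exists_push J.2.gapStep_bijOn (hbij J) (hφ.sameDirection J.2)
    exact ⟨⟨(T J, k), hk⟩, rfl, hk'⟩
  choose t ht ht' using hpush
  have hsec := exists_equivariant_section (B := B) (X := X) (T := T) (t := t) (π := fun x => x.1.1)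
    ht ?_ ?_ ?_
  · obtain ⟨s, hs, hst⟩ := hsec
    refine ⟨fun J => if hJ : IsGap f J.1 J.2 then (s ⟨J, hJ⟩).1.2 else id, fun J hJ => ?_⟩
    have e1 : (s ⟨J, hJ⟩).1.1 = ⟨J, hJ⟩ := hs _
    refine ⟨?_, fun z hz => ?_⟩
    · simp only [dif_pos hJ]
      have := (s ⟨J, hJ⟩).2
      rwa [e1] at this
    · simp only [dif_pos hJ, dif_pos hJ.next]
      have e2 : s ⟨BorelComplexity.gapNext f J, hJ.next⟩ = t (s ⟨J, hJ⟩) := hst ⟨J, hJ⟩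
      rw [e2]
      exact ht' (s ⟨J, hJ⟩) z (by rw [e1]; exact hz)
  · rintro ⟨⟨J, h⟩, hx⟩ ⟨⟨J', h'⟩, hx'⟩ hJ hxy
    obtain rfl : J = J' := hJ
    have : h = h' := hx.ext hx' fun z hz => by
      refine (hbij J).injOn (hx.bijOn.mapsTo hz) (hx'.bijOn.mapsTo hz) ?_
      have e1 := ht' ⟨(J, h), hx⟩ z hz
      have e2 := ht' ⟨(J, h'), hx'⟩ z hz
      rw [hxy] at e1
      exact e1.symm.trans e2
    subst this
    rfl
  · rintro J ⟨⟨K, k⟩, hk⟩ hK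
    obtain rfl : K = T J := hK
    obtain ⟨h, hh, hh'⟩ := IsoOn.exists_pull J.2.gapStep_bijOn (hbij J) (hφ.sameDirection J.2) hk
    refine ⟨⟨(J, h), hh⟩, rfl, ?_⟩
    have e1 := ht ⟨(J, h), hh⟩
    have e2 := ht' ⟨(J, h), hh⟩
    rcases hy : t ⟨(J, h), hh⟩ with ⟨⟨K, k'⟩, hk'⟩
    rw [hy] at e1 e2
    obtain rfl : K = T J := e1
    have : k' = k := hk'.ext hk fun z hz => by
      obtain ⟨w, hw, rfl⟩ := J.2.gapStep_bijOn.surjOn hz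
      exact (e2 w hw).trans (hh' w hw).symm
    subst this
    rfl
  · intro J
    have hp : T^[Function.minimalPeriod T J] J = J := Function.iterate_minimalPeriod
    set p := Function.minimalPeriod T J
    have hp' : (BorelComplexity.gapNext f)^[p] J.1 = J.1 := by rw [← hT, hp]
    -- Pushing `k` once around the cycle gives back `k`, because `k` commutes with the return maps.
    -- For a gap that is not periodic `p = 0` and this is vacuous.
    obtain ⟨k, hk, hk'⟩ := hφ.exists_periodic J.2 hp'
    refine ⟨⟨(J, k), hk⟩, rfl, ?_⟩
    have hit : ∀ n, (t^[n] ⟨(J, k), hk⟩).1.1 = T^[n] J ∧ ∀ z ∈ Ioo J.1.1 J.1.2,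
        (t^[n] ⟨(J, k), hk⟩).1.2 ((gapStep f)^[n] z) = (gapStep g)^[n] (k z) := by
      intro n
      induction n with
      | zero => exact ⟨rfl, fun _ _ => rfl⟩
      | succ n ih =>
        refine ⟨?_, fun z hz => ?_⟩
        · rw [Function.iterate_succ_apply', Function.iterate_succ_apply', ht, ih.1]
        · rw [Function.iterate_succ_apply', Function.iterate_succ_apply',
            Function.iterate_succ_apply', ← ih.2 z hz]
          refine ht' _ _ ?_
          rw [ih.1, hT]
          exact (J.2.gapStep_iterate_bijOn n).mapsTo hz
    obtain ⟨e1, e2⟩ := hit p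
    rcases hy : t^[p] ⟨(J, k), hk⟩ with ⟨⟨K, k'⟩, hk''⟩
    rw [hy] at e1 e2
    rw [hp] at e1
    obtain rfl : K = J := e1
    have : k' = k := hk''.ext hk fun z hz => by
      have hb := K.2.gapStep_iterate_bijOn p
      rw [hp'] at hb
      obtain ⟨w, hw, rfl⟩ := hb.surjOn hz
      exact (e2 w hw).trans (hk' w hw).symm
    subst this
    rfl

theorem dense_nodes_union (f : C(I, I)) : Dense (nodes f ∪ (closure (marked f))ᶜ) := by
  intro x
  by_cases hx : x ∈ closure (marked f)
  · exact closure_mono (fun _ h => .inl (.inl h)) hx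
  · exact subset_closure (.inr hx)

/-- The matching of nodes and the coherent gap bijections form an increasing map between dense sets.
It extends to a homeomorphism, and the conjugacy equation, verified on the dense set, holds
everywhere by continuity. -/
theorem NodeMatch.exists_conj (hφ : NodeMatch f g φ) :
    ∃ h : I ≃ₜ I, ∀ x, h (f x) = g (h x) := by
  classical
  obtain ⟨k, hk⟩ := hφ.exists_gap_family
  have hgap : ∀ z, ∃ J : I × I, z ∉ closure (marked f) → IsGap f J.1 J.2 ∧ z ∈ Ioo J.1 J.2 := by
    intro z
    by_cases hz : z ∈ closure (marked f)
    · exact ⟨(0, 0), fun h => (h hz).elim⟩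
    · obtain ⟨a, b, hab⟩ := BorelComplexity.exists_isGap hz
      exact ⟨(a, b), fun _ => hab⟩
  choose J hJ using hgap
  let P : Set I := nodes f ∪ (closure (marked f))ᶜ
  let ψ : I → I := fun z => if z ∈ nodes f then φ z else k (J z) z
  have hψn : ∀ z ∈ nodes f, ψ z = φ z := fun z hz => if_pos hz
  have hψg : ∀ a b z, IsGap f a b → z ∈ Ioo a b → ψ z = k (a, b) z := by
    intro a b z h hz
    have hzc := h.notMem_closure hz
    have hzn : z ∉ nodes f := fun hn => hzc (nodes_subset_closure f hn)
    obtain ⟨h1, h2⟩ := hJ z hzc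
    obtain ⟨e1, e2⟩ := h1.unique h h2 hz
    simp only [ψ, if_neg hzn]
    rw [show J z = (a, b) from Prod.ext e1 e2]
  have hψm : ∀ a b z, IsGap f a b → z ∈ Ioo a b → ψ z ∈ Ioo (φ a) (φ b) := by
    intro a b z h hz
    rw [hψg a b z h hz]
    exact (hk (a, b) h).1.bijOn.mapsTo hz
  have hmono : StrictMonoOn ψ P := by
    have hng : ∀ x ∈ nodes f, ∀ y, y ∉ closure (marked f) →
        (x < y → ψ x < ψ y) ∧ (y < x → ψ y < ψ x) := by
      intro x hx y hy
      obtain ⟨h1, h2⟩ := hJ y hy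
      have h3 := hψm _ _ y h1 h2
      rw [hψn x hx]
      refine ⟨fun hxy => ?_, fun hxy => ?_⟩
      · refine lt_of_le_of_lt (hφ.strictMonoOn.monotoneOn hx h1.left ?_) h3.1
        by_contra! hlt
        exact h1.notMem x hx ⟨hlt, hxy.trans h2.2⟩
      · refine lt_of_lt_of_le h3.2 (hφ.strictMonoOn.monotoneOn h1.right hx ?_)
        by_contra! hlt
        exact h1.notMem x hx ⟨h2.1.trans hxy, hlt⟩
    rintro x (hx | hx) y (hy | hy) hxy
    · rw [hψn x hx, hψn y hy]
      exact hφ.strictMonoOn hx hy hxy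
    · exact (hng x hx y hy).1 hxy
    · exact (hng y hy x hx).2 hxy
    · obtain ⟨h1, h2⟩ := hJ x hx
      by_cases hyJ : y < (J x).2
      · have hyI : y ∈ Ioo (J x).1 (J x).2 := ⟨h2.1.trans hxy, hyJ⟩
        rw [hψg _ _ x h1 h2, hψg _ _ y h1 hyI]
        exact (hk (J x) h1).1.strictMonoOn h2 hyI hxy
      · have hne : (J x).2 ≠ y := fun e => hy (e ▸ nodes_subset_closure f h1.right)
        have h3 := (hng (J x).2 h1.right y hy).1 (lt_of_le_of_ne (not_lt.1 hyJ) hne)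
        rw [hψn _ h1.right] at h3
        exact (hψm _ _ x h1 h2).2.trans h3
  have hda : DenseRange (Subtype.val : P → I) := by
    rw [DenseRange, Subtype.range_val]
    exact dense_nodes_union f
  have hdb : DenseRange fun z : P => ψ z := by
    refine (dense_nodes_union g).mono ?_
    rintro w (hw | hw)
    · obtain ⟨z, hz, rfl⟩ := hφ.bijOn.surjOn hw
      exact ⟨⟨z, .inl hz⟩, hψn z hz⟩
    · obtain ⟨c, d, hcd, hwI⟩ := BorelComplexity.exists_isGap hw
      obtain ⟨a, b, hab, rfl, rfl⟩ := hφ.exists_isGap hcd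
      obtain ⟨z, hz, rfl⟩ := (hk (a, b) hab).1.bijOn.surjOn hwI
      exact ⟨⟨z, .inr (hab.notMem_closure hz)⟩, hψg a b z hab hz⟩
  obtain ⟨h, hh⟩ := exists_orderIso_of_denseRange hda hdb fun p q =>
    (hmono.lt_iff_lt p.2 q.2).symm
  have hh' : ∀ z ∈ P, h z = ψ z := fun z hz => hh ⟨z, hz⟩
  refine ⟨h.toHomeomorph, fun x => ?_⟩
  have hext : (fun x => h (f x)) = fun x => g (h x) := by
    refine Continuous.ext_on (dense_nodes_union f) (h.continuous.comp f.continuous)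
      (g.continuous.comp h.continuous) ?_
    rintro z (hz | hz)
    · change h (f z) = g (h z)
      rw [hh' z (.inl hz), hh' _ (.inl (apply_mem_nodes hz)), hψn _ hz, hψn _ (apply_mem_nodes hz),
        hφ.map_apply z hz]
    · obtain ⟨h1, h2⟩ := hJ z hz
      have hg := hφ.isGap h1
      have h3 := hψm _ _ z h1 h2
      change h (f z) = g (h z)
      -- On a constant gap `gapStep` is not `f`, but the equation there only concerns the value at
      -- an end point, which is a node.
      by_cases hf : f (J z).1 = f (J z).2
      · have hgf := (hφ.apply_eq_iff h1.left h1.right).2 hf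
        rw [(h1.const hf).1 z (Ioo_subset_Icc_self h2), hh' z (.inr hz),
          (hg.const hgf).1 _ (Ioo_subset_Icc_self h3), hh' _ (.inl (apply_mem_nodes h1.left)),
          hψn _ (apply_mem_nodes h1.left), hφ.map_apply _ h1.left]
      · have hgf := mt (hφ.apply_eq_iff h1.left h1.right).1 hf
        have h4 := (hk (J z) h1).2 z h2
        have h5 := h1.gapStep_bijOn.mapsTo h2
        rw [h1.gapStep_of_ne hf h2] at h4 h5
        have h6 := h1.next.notMem_closure h5
        rw [hh' z (.inr hz), hh' _ (.inr h6), hψg _ _ _ h1.next h5, h4, ← hψg _ _ z h1 h2,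
          hg.gapStep_of_ne hgf h3]
  exact congrFun hext x

end BorelComplexity

/-! ### Upper bound: Borel coding of a map by relations on its nodes. -/

namespace BorelComplexity

open Set Filter Topology

/-! ### Borel enumerations of countable sets -/

section BorelEnumeration

variable {Ω : Type*} [MeasurableSpace Ω]

/-- The sets `A ω` are enumerated by a sequence of measurable functions. -/
def BorelEnumerable (A : Ω → Set I) : Prop :=
  ∃ e : ℕ → Ω → I, (∀ n, Measurable (e n)) ∧ ∀ ω, A ω = range fun n => e n ω

theorem BorelEnumerable.of_range {ι : Type*} [Countable ι] [Nonempty ι] {A : Ω → Set I}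
    {e : ι → Ω → I} (he : ∀ i, Measurable (e i)) (hA : ∀ ω, A ω = range fun i => e i ω) :
    BorelEnumerable A := by
  obtain ⟨s, hs⟩ := exists_surjective_nat ι
  exact ⟨fun n => e (s n), fun n => he _, fun ω => (hA ω).trans (hs.range_comp _).symm⟩

theorem BorelEnumerable.iUnion {ι : Type*} [Countable ι] [Nonempty ι] {A : ι → Ω → Set I}
    (hA : ∀ i, BorelEnumerable (A i)) : BorelEnumerable fun ω => ⋃ i, A i ω := by
  choose e he hA using hA
  refine .of_range (ι := ι × ℕ) (e := fun p => e p.1 p.2) (fun p => he _ _) fun ω => ?_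
  ext x
  simp [hA]

theorem BorelEnumerable.union {A B : Ω → Set I} (hA : BorelEnumerable A) (hB : BorelEnumerable B) :
    BorelEnumerable fun ω => A ω ∪ B ω := by
  have := BorelEnumerable.iUnion (A := fun b : Bool => cond b A B) (by rintro (_ | _) <;> assumption)
  convert this using 2 with ω
  ext x
  simp [or_comm]

theorem BorelEnumerable.image {A : Ω → Set I} (hA : BorelEnumerable A) {G : Ω → I → I}
    (hG : Measurable fun p : Ω × I => G p.1 p.2) : BorelEnumerable fun ω => G ω '' A ω := by
  obtain ⟨e, he, hA⟩ := hA
  refine ⟨fun n ω => G ω (e n ω), fun n => hG.comp (measurable_id.prodMk (he n)), fun ω => ?_⟩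
  change G ω '' A ω = _
  rw [hA, ← range_comp]
  rfl

/-- For functions continuous in `x`, existence of a point of a compact set with nonpositive value is
a measurable condition. -/
theorem measurableSet_exists_mem_le_zero {K : Set I} (hK : IsCompact K) {F : Ω → I → ℝ}
    (hF : ∀ x, Measurable fun ω => F ω x) (hc : ∀ ω, Continuous (F ω)) :
    MeasurableSet {ω | ∃ x ∈ K, F ω x ≤ 0} := by
  obtain ⟨t, htK, htc, htd⟩ :=
    (TopologicalSpace.IsSeparable.of_separableSpace K).exists_countable_dense_subset
  have : {ω | ∃ x ∈ K, F ω x ≤ 0} = ⋂ n : ℕ, ⋃ x ∈ t, {ω | F ω x < 1 / (n + 1)} := by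
    ext ω
    simp only [mem_ofPred_eq, mem_iInter, mem_iUnion, exists_prop]
    constructor
    · rintro ⟨x, hx, hx0⟩ n
      have hpos : F ω x < 1 / (n + 1) := lt_of_le_of_lt hx0 (by positivity)
      obtain ⟨y, hy, hyt⟩ := mem_closure_iff.1 (htd hx) _
        (isOpen_lt (hc ω) continuous_const) hpos
      exact ⟨y, hyt, hy⟩
    · intro H
      obtain ⟨y, hyt, -⟩ := H 0
      obtain ⟨x, hx, hmin⟩ := hK.exists_isMinOn ⟨y, htK hyt⟩ (hc ω).continuousOn
      refine ⟨x, hx, ?_⟩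
      by_contra! hpos
      obtain ⟨n, hn⟩ := exists_nat_one_div_lt hpos
      obtain ⟨z, hzt, hz⟩ := H n
      exact ((hmin (htK hzt)).trans_lt (hz.trans hn)).false
  rw [this]
  exact .iInter fun n => .biUnion htc fun x _ => measurableSet_lt (hF x) measurable_const

/-- Closed sets depending on a parameter in a measurable way. -/
structure MeasurableClosed (Z : Ω → Set I) : Prop where
  isClosed : ∀ ω, IsClosed (Z ω)
  measurableSet : ∀ s t, MeasurableSet {ω | (Z ω ∩ Icc s t).Nonempty}

theorem MeasurableClosed.of_le_zero {Z : Ω → Set I} {F : Ω → I → ℝ}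
    (hF : ∀ x, Measurable fun ω => F ω x) (hc : ∀ ω, Continuous (F ω))
    (hZ : ∀ ω x, x ∈ Z ω ↔ F ω x ≤ 0) : MeasurableClosed Z := by
  refine ⟨fun ω => ?_, fun s t => ?_⟩
  · have : Z ω = {x | F ω x ≤ 0} := ext (hZ ω)
    rw [this]
    exact isClosed_le (hc ω) continuous_const
  · convert measurableSet_exists_mem_le_zero (isCompact_Icc (a := s) (b := t)) hF hc using 1
    ext ω
    simp only [mem_ofPred_eq, Set.Nonempty, mem_inter_iff, hZ, and_comm]

theorem MeasurableClosed.measurableSet_mem {Z : Ω → Set I} (hZ : MeasurableClosed Z) (q : I) :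
    MeasurableSet {ω | q ∈ Z ω} := by
  convert hZ.measurableSet q q using 3 with ω
  simp

theorem MeasurableClosed.measurable_sSup {Z : Ω → Set I} (hZ : MeasurableClosed Z) (q : I) :
    Measurable fun ω => sSup (Z ω ∩ Iic q) := by
  refine measurable_of_Ici fun c => ?_
  -- For `c > ⊥`, the supremum is at least `c` exactly when `Z ω` meets `[c, q]`; the case `c = ⊥`
  -- is separate because `sSup ∅ = ⊥`.
  rcases (bot_le : ⊥ ≤ c).eq_or_lt with rfl | hc
  · simp
  · convert hZ.measurableSet c q using 1
    ext ω
    simp only [mem_preimage, mem_Ici, mem_ofPred_eq]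
    constructor
    · intro h
      have hne : (Z ω ∩ Iic q).Nonempty := by
        by_contra! he
        rw [he, sSup_empty] at h
        exact hc.not_ge h
      have := ((hZ.isClosed ω).inter isClosed_Iic).sSup_mem hne
      exact ⟨_, this.1, h, this.2⟩
    · rintro ⟨x, hx, h1, h2⟩
      exact h1.trans (le_sSup ⟨hx, h2⟩)

theorem MeasurableClosed.measurable_sInf {Z : Ω → Set I} (hZ : MeasurableClosed Z) (q : I) :
    Measurable fun ω => sInf (Z ω ∩ Ici q) := by
  refine measurable_of_Iic fun c => ?_
  rcases (le_top : c ≤ ⊤).eq_or_lt with rfl | hc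
  · simp
  · convert hZ.measurableSet q c using 1
    ext ω
    simp only [mem_preimage, mem_Iic, mem_ofPred_eq]
    constructor
    · intro h
      have hne : (Z ω ∩ Ici q).Nonempty := by
        by_contra! he
        rw [he, sInf_empty] at h
        exact hc.not_ge h
      have := ((hZ.isClosed ω).inter isClosed_Ici).sInf_mem hne
      exact ⟨_, this.1, this.2, h⟩
    · rintro ⟨x, hx, h1, h2⟩
      exact le_trans (sInf_le (show x ∈ Z ω ∩ Ici q from ⟨hx, h1⟩)) h2

/-- A one-sided point is the nearest point of `Z` on one side of some `d n` outside `Z`. The points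
`0` and `1` are added as default values: they appear when `d n ∈ Z ω` or when `sSup` or `sInf` is
taken over the empty set. -/
theorem MeasurableClosed.borelEnumerable_oneSided {Z : Ω → Set I} (hZ : MeasurableClosed Z) :
    BorelEnumerable fun ω => {0, 1} ∪ oneSided (Z ω) := by
  classical
  let d : ℕ → I := TopologicalSpace.denseSeq I
  have hd : DenseRange d := TopologicalSpace.denseRange_denseSeq I
  let e : Bool ⊕ Bool × ℕ → Ω → I := fun i ω => match i with
    | .inl true => 1
    | .inl false => 0
    | .inr (true, n) => if d n ∈ Z ω then 0 else sSup (Z ω ∩ Iic (d n))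
    | .inr (false, n) => if d n ∈ Z ω then 0 else sInf (Z ω ∩ Ici (d n))
  refine .of_range (e := e) ?_ fun ω => ?_
  · rintro ((_ | _) | ⟨_ | _, n⟩)
    · exact measurable_const
    · exact measurable_const
    · exact Measurable.ite (hZ.measurableSet_mem _) measurable_const (hZ.measurable_sInf _)
    · exact Measurable.ite (hZ.measurableSet_mem _) measurable_const (hZ.measurable_sSup _)
  · apply subset_antisymm
    · rintro x ((rfl | rfl) | ⟨hx, u, hu, H⟩)
      · exact ⟨.inl false, rfl⟩
      · exact ⟨.inl true, rfl⟩
      · rcases lt_or_gt_of_ne hu with hlt | hlt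
        · obtain ⟨n, h1, h2⟩ := hd.exists_mem_open isOpen_Ioo (nonempty_Ioo.2 hlt)
          refine ⟨.inr (false, n), (if_neg fun h => H _ h (.inl ⟨h1, h2⟩)).trans ?_⟩
          refine le_antisymm (sInf_le ⟨hx, h2.le⟩) (le_sInf ?_)
          rintro z ⟨hz, hz'⟩
          by_contra! hzx
          exact H z hz (.inl ⟨h1.trans_le hz', hzx⟩)
        · obtain ⟨n, h1, h2⟩ := hd.exists_mem_open isOpen_Ioo (nonempty_Ioo.2 hlt)
          refine ⟨.inr (true, n), (if_neg fun h => H _ h (.inr ⟨h1, h2⟩)).trans ?_⟩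
          refine le_antisymm (sSup_le ?_) (le_sSup ⟨hx, h1.le⟩)
          rintro z ⟨hz, hz'⟩
          by_contra! hzx
          exact H z hz (.inr ⟨hzx, lt_of_le_of_lt hz' h2⟩)
    · rintro _ ⟨(_ | _) | ⟨_ | _, n⟩, rfl⟩
      · exact .inl (.inl rfl)
      · exact .inl (.inr rfl)
      · by_cases hn : d n ∈ Z ω
        · exact .inl (.inl (if_pos hn))
        · beta_reduce
          rw [show e (.inr (false, n)) ω = sInf (Z ω ∩ Ici (d n)) from if_neg hn]
          rcases (Z ω ∩ Ici (d n)).eq_empty_or_nonempty with he | hne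
          · rw [he, sInf_empty]
            exact .inl (.inr rfl)
          · exact .inr (exists_sInf_oneSided (hZ.isClosed ω) hn hne).1
      · by_cases hn : d n ∈ Z ω
        · exact .inl (.inl (if_pos hn))
        · beta_reduce
          rw [show e (.inr (true, n)) ω = sSup (Z ω ∩ Iic (d n)) from if_neg hn]
          rcases (Z ω ∩ Iic (d n)).eq_empty_or_nonempty with he | hne
          · rw [he, sSup_empty]
            exact .inl (.inl rfl)
          · exact .inr (exists_sSup_oneSided (hZ.isClosed ω) hn hne).1

/-- Local maximum values are maxima over balls from a countable family, so there are countably many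
even if there are many maximum points. The value `0` is a default. -/
theorem borelEnumerable_isLocalMax {F : Ω → C(I, I)} (hF : ∀ x, Measurable fun ω => F ω x) :
    BorelEnumerable fun ω => {0} ∪ {v | ∃ x, IsLocalMax (F ω) x ∧ F ω x = v} := by
  classical
  let d : ℕ → I := TopologicalSpace.denseSeq I
  have hd : DenseRange d := TopologicalSpace.denseRange_denseSeq I
  let r : ℕ → ℝ := fun j => 1 / ((j : ℝ) + 1)
  have hr : ∀ j, 0 < r j := fun j => by positivity
  have hr' : ∀ j, r (j + 1) < r j := fun j =>
    one_div_lt_one_div_of_lt (by positivity) (by push_cast; linarith)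
  let K : ℕ × ℕ → Set I := fun p => Metric.closedBall (d p.1) (r p.2)
  -- Requiring the maximum over `K` to be attained in the smaller ball `K'` ensures that it is
  -- attained at an interior point of `K`, hence at a local maximum.
  let K' : ℕ × ℕ → Set I := fun p => Metric.closedBall (d p.1) (r (p.2 + 1))
  have hK : ∀ p, IsCompact (K p) := fun p => isCompact_closedBall _ _
  have hK' : ∀ p, IsCompact (K' p) := fun p => isCompact_closedBall _ _
  have hKK' : ∀ p, ∀ x ∈ K' p, K p ∈ 𝓝 x := fun p x hx =>
    Metric.closedBall_mem_nhds_of_mem (lt_of_le_of_lt hx (hr' _))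
  let M : ℕ × ℕ → Ω → I := fun p ω => sSup (F ω '' K p)
  have hM : ∀ p, Measurable (M p) := by
    intro p
    refine measurable_of_Ici fun c => ?_
    convert measurableSet_exists_mem_le_zero (hK p) (F := fun ω x => (c : ℝ) - F ω x)
      (fun x => measurable_const.sub (hF x).subtype_val)
      (fun ω => continuous_const.sub (continuous_subtype_val.comp (F ω).continuous)) using 1
    ext ω
    simp only [mem_preimage, mem_Ici, mem_ofPred_eq, sub_nonpos, Subtype.coe_le_coe]
    constructor
    · intro h
      have hne : (F ω '' K p).Nonempty := ⟨_, d p.1, Metric.mem_closedBall_self (hr _).le, rfl⟩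
      obtain ⟨x, hx, hx'⟩ := ((hK p).image (F ω).continuous).sSup_mem hne
      exact ⟨x, hx, hx' ▸ h⟩
    · rintro ⟨x, hx, h⟩
      exact h.trans (le_sSup ⟨x, hx, rfl⟩)
  have hA : ∀ p, MeasurableSet {ω | ∃ x ∈ K' p, M p ω ≤ F ω x} := by
    intro p
    convert measurableSet_exists_mem_le_zero (hK' p) (F := fun ω x => (M p ω : ℝ) - F ω x)
      (fun x => (hM p).subtype_val.sub (hF x).subtype_val)
      (fun ω => continuous_const.sub (continuous_subtype_val.comp (F ω).continuous)) using 1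
    ext ω
    simp only [mem_ofPred_eq, sub_nonpos, Subtype.coe_le_coe]
  let e : Option (ℕ × ℕ) → Ω → I := fun i ω => match i with
    | none => 0
    | some p => if ∃ x ∈ K' p, M p ω ≤ F ω x then M p ω else 0
  refine .of_range (e := e) ?_ fun ω => ?_
  · rintro (_ | p)
    · exact measurable_const
    · exact Measurable.ite (hA p) (hM p) measurable_const
  · apply subset_antisymm
    · rintro _ (rfl | ⟨x, hx, rfl⟩)
      · exact ⟨none, rfl⟩
      · obtain ⟨ε, hε, hball⟩ := Metric.eventually_nhds_iff.1 hx
        obtain ⟨j, hj⟩ := exists_nat_one_div_lt (half_pos hε)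
        have hj' : r j < ε / 2 := hj
        obtain ⟨i, hi⟩ := hd.exists_dist_lt x (hr (j + 1))
        have hmax : M (i, j) ω ≤ F ω x := by
          refine sSup_le ?_
          rintro _ ⟨y, hy, rfl⟩
          refine hball ?_
          have h1 : dist y (d i) ≤ r j := hy
          have h2 := dist_triangle y (d i) x
          rw [dist_comm (d i) x] at h2
          linarith [hr' j]
        have hxK' : x ∈ K' (i, j) := hi.le
        refine ⟨some (i, j), (if_pos ⟨x, hxK', hmax⟩).trans (le_antisymm hmax ?_)⟩
        exact le_sSup ⟨x, mem_of_mem_nhds (hKK' (i, j) x hxK'), rfl⟩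
    · rintro _ ⟨_ | p, rfl⟩
      · exact .inl rfl
      · by_cases h : ∃ x ∈ K' p, M p ω ≤ F ω x
        · beta_reduce
          rw [show e (some p) ω = M p ω from if_pos h]
          obtain ⟨x, hx, hx'⟩ := h
          have hle : ∀ y ∈ K p, F ω y ≤ M p ω := fun y hy => le_sSup ⟨y, hy, rfl⟩
          refine .inr ⟨x, ?_, le_antisymm (hle x (mem_of_mem_nhds (hKK' p x hx))) hx'⟩
          filter_upwards [hKK' p x hx] with y hy
          exact (hle y hy).trans hx'
        · exact .inl (if_neg h)

end BorelEnumeration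

end BorelComplexity

namespace BorelComplexity

open Set Filter Topology

/-! ### Borel enumeration of the nodes -/

theorem measurable_eval_comp {u : C(I, I) → I} (hu : Measurable u) :
    Measurable fun f : C(I, I) => f (u f) :=
  (continuous_eval (F := C(I, I))).measurable.comp (measurable_id.prodMk hu)

theorem measurable_eval_iterate (n : ℕ) (x : I) : Measurable fun f : C(I, I) => f^[n] x := by
  induction n with
  | zero => exact measurable_const
  | succ n ih =>
    simp only [Function.iterate_succ_apply']
    exact measurable_eval_comp ih

theorem measurableClosed_fix (n : ℕ) : MeasurableClosed fun f : C(I, I) => {x | f^[n] x = x} :=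
  .of_le_zero (F := fun f x => dist (f^[n] x) x)
    (fun x => (measurable_eval_iterate n x).dist measurable_const)
    (fun f => (f.continuous.iterate n).dist continuous_id)
    fun f x => by rw [dist_le_zero]; rfl

theorem measurableClosed_fiber {u : C(I, I) → I} (hu : Measurable u) :
    MeasurableClosed fun f : C(I, I) => {x | f x = u f} :=
  .of_le_zero (F := fun f x => dist (f x) (u f))
    (fun x => (measurable_eval_comp measurable_const).dist hu)
    (fun f => f.continuous.dist continuous_const)
    fun f x => by rw [dist_le_zero]; rfl

/-- The closure is the zero set of the distance to `A f`, an infimum over the enumeration. -/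
theorem measurableClosed_closure {A : C(I, I) → Set I} (hA : BorelEnumerable A) :
    MeasurableClosed fun f => closure (A f) := by
  obtain ⟨e, he, hA⟩ := hA
  have hne : ∀ f, (A f).Nonempty := fun f => by rw [hA]; exact range_nonempty _
  refine .of_le_zero (F := fun f x => Metric.infDist x (A f)) (fun x => ?_)
    (fun f => Metric.continuous_infDist_pt _) fun f x => ?_
  · refine measurable_of_Iio fun c => ?_
    have : (fun f => Metric.infDist x (A f)) ⁻¹' Iio c = ⋃ n, {f | dist x (e n f) < c} := by
      ext f
      simp only [mem_preimage, mem_Iio, Metric.infDist_lt_iff (hne f), mem_iUnion, mem_ofPred_eq]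
      simp [hA]
    rw [this]
    exact .iUnion fun n => measurableSet_lt (measurable_const.dist (he n)) measurable_const
  · rw [Metric.mem_closure_iff_infDist_zero (hne f)]
    exact ⟨fun h => h.le, fun h => le_antisymm h Metric.infDist_nonneg⟩

/-- This absorbs the default values `0` and `1` in the enumerations of one-sided points. -/
theorem zero_one_subset_stage (f : C(I, I)) (k : ℕ) : {0, 1} ⊆ stage f k := by
  induction k with
  | zero => exact fun x hx => .inl (.inl hx)
  | succ k ih => exact fun x hx => .inl (.inl (ih hx))

/-- Minima of `f` are maxima of `1 - f`; reflecting the values back turns the default `0` into `1`.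
-/
theorem borelEnumerable_localExtr :
    BorelEnumerable fun f : C(I, I) => {0, 1} ∪ {v | ∃ x, IsLocalExtr f x ∧ f x = v} := by
  have h1 := borelEnumerable_isLocalMax (F := fun f : C(I, I) => f)
    fun x => measurable_eval_comp measurable_const
  let s : C(I, I) := ⟨unitInterval.symm, unitInterval.continuous_symm⟩
  have h2 := borelEnumerable_isLocalMax (F := fun f : C(I, I) => s.comp f)
    fun x => unitInterval.continuous_symm.measurable.comp (measurable_eval_comp measurable_const)
  have h3 := h2.image (G := fun _ => unitInterval.symm)
    (unitInterval.continuous_symm.measurable.comp measurable_snd)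
  convert h1.union h3 using 2 with f
  have hmin : ∀ x, IsLocalMax (s.comp f) x ↔ IsLocalMin f x := fun x =>
    eventually_congr (.of_forall fun y => unitInterval.strictAnti_symm.le_iff_ge)
  ext v
  constructor
  · rintro ((rfl | rfl) | ⟨x, hx | hx, rfl⟩)
    · exact .inl (.inl rfl)
    · exact .inr ⟨0, .inl rfl, unitInterval.symm_zero⟩
    · exact .inr ⟨_, .inr ⟨x, (hmin x).2 hx, rfl⟩, unitInterval.symm_symm _⟩
    · exact .inl (.inr ⟨x, hx, rfl⟩)
  · rintro ((rfl | ⟨x, hx, rfl⟩) | ⟨_, rfl | ⟨x, hx, rfl⟩, rfl⟩)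
    · exact .inl (.inl rfl)
    · exact .inr ⟨x, .inr hx, rfl⟩
    · exact .inl (.inr unitInterval.symm_zero)
    · exact .inr ⟨x, .inl ((hmin x).1 hx), (unitInterval.symm_symm _).symm⟩

theorem borelEnumerable_stage (k : ℕ) : BorelEnumerable fun f => stage f k := by
  induction k with
  | zero =>
    convert borelEnumerable_localExtr.union (BorelEnumerable.iUnion fun n =>
      (measurableClosed_fix n).borelEnumerable_oneSided) using 2 with f
    rw [stage, ← union_iUnion, ← union_assoc]
    congr 1
    exact (union_eq_self_of_subset_right subset_union_left).symm
  | succ k ih =>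
    have h1 := ih.image (G := fun f => f) (continuous_eval (F := C(I, I))).measurable
    obtain ⟨e, he, hA⟩ := id ih
    have h2 := BorelEnumerable.iUnion fun n =>
      (measurableClosed_fiber (he n)).borelEnumerable_oneSided
    convert (ih.union h1).union h2 using 2 with f
    have h01 := zero_one_subset_stage f k
    have : (⋃ y ∈ stage f k, oneSided {x | f x = y}) = ⋃ n, oneSided {x | f x = e n f} := by
      have hAf : stage f k = range fun n => e n f := hA f
      rw [hAf, biUnion_range]
    rw [stage, this, ← union_iUnion, ← union_assoc]
    congr 1
    exact (union_eq_self_of_subset_right (h01.trans subset_union_left)).symm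

theorem borelEnumerable_nodes : BorelEnumerable nodes := by
  have h1 : BorelEnumerable marked := .iUnion borelEnumerable_stage
  convert h1.union (measurableClosed_closure h1).borelEnumerable_oneSided using 2 with f
  rw [nodes, ← union_assoc]
  congr 1
  refine (union_eq_self_of_subset_right ?_).symm
  rintro x (rfl | rfl)
  · exact zero_mem_marked f
  · exact one_mem_marked f

/-- An enumeration of the nodes in which every node occurs infinitely often. -/
theorem exists_infinite_enumeration : ∃ e : ℕ → C(I, I) → I, (∀ n, Measurable (e n)) ∧
    (∀ f, range (fun n => e n f) = nodes f) ∧ ∀ f n, {m | e m f = e n f}.Infinite := by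
  obtain ⟨e, he, hA⟩ := borelEnumerable_nodes
  refine ⟨fun n => e n.unpair.1, fun n => he _, fun f => ?_, fun f n => ?_⟩
  · rw [hA]
    have hs : Function.Surjective fun n : ℕ => n.unpair.1 := fun n =>
      ⟨Nat.pair n 0, by simp only [Nat.unpair_pair]⟩
    exact hs.range_comp (fun n => e n f)
  · refine Set.infinite_of_injective_forall_mem (f := fun m => Nat.pair n.unpair.1 m)
      (fun a b hab => ?_) fun m => ?_
    · exact (Nat.pair_eq_pair.1 hab).2
    · change e (Nat.unpair _).1 f = _
      rw [Nat.unpair_pair]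

/-! ### The relations attached to an interval map -/

/-- The relations between the nodes of `f`, in an enumeration `x`, that determine `f` up to
conjugacy: comparison of the directions of two pairs, the action of `f`, and the direction in which
iterates of `f` move the points between two nodes. -/
def nodeRel (f : C(I, I)) (x : ℕ → I) : ℕ → List ℕ → Prop
  | 0, [a, b, c, d] => (x a < x b ∧ x c < x d) ∨ (x b < x a ∧ x d < x c)
  | 1, [a, b] => f (x a) = x b
  | p + 2, [a, b] => MovesTowards f p (x a) (x b)
  | _, _ => False

/-- Orientation reversal exchanges the two clauses of `MovesTowards`. Speaking of motion towards a
node, instead of up or down, makes the relation invariant under all conjugacies. -/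
theorem movesTowards_conj {f g : C(I, I)} {h : I ≃ₜ I} (hh : ∀ x, h (f x) = g (h x)) {p : ℕ}
    {a b : I} : MovesTowards g p (h a) (h b) ↔ MovesTowards f p a b := by
  have hs := h.surjective
  unfold MovesTowards
  rcases homeomorph_mono_or_anti h with hm | hm
  · refine and_congr (hs.forall.trans (forall_congr' fun z => ?_))
      (hs.forall.trans (forall_congr' fun z => ?_)) <;>
    rw [← conj_iterate hh, hm.lt_iff_lt, hm.lt_iff_lt, hm.le_iff_le]
  · rw [and_comm]
    refine and_congr (hs.forall.trans (forall_congr' fun z => ?_))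
      (hs.forall.trans (forall_congr' fun z => ?_)) <;>
    · rw [← conj_iterate hh, hm.lt_iff_gt, hm.lt_iff_gt, hm.le_iff_ge]
      exact ⟨fun H h1 h2 => H h2 h1, fun H h1 h2 => H h2 h1⟩

theorem nodeRel_conj {f g : C(I, I)} {h : I ≃ₜ I} (hh : ∀ x, h (f x) = g (h x)) (x : ℕ → I) (i : ℕ)
    (l : List ℕ) : nodeRel g (fun n => h (x n)) i l ↔ nodeRel f x i l := by
  unfold nodeRel
  split
  · rcases homeomorph_mono_or_anti h with hm | hm
    · simp only [hm.lt_iff_lt]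
    · simp only [hm.lt_iff_gt]
      exact or_comm
  · rw [← hh, h.injective.eq_iff]
  · exact movesTowards_conj hh
  · rfl

theorem nodeRel_map (f : C(I, I)) (x : ℕ → I) (p : ℕ → ℕ) (i : ℕ) (l : List ℕ) :
    nodeRel f x i (l.map p) ↔ nodeRel f (fun n => x (p n)) i l := by
  rcases i with _ | _ | i <;> rcases l with _ | ⟨a, _ | ⟨b, _ | ⟨c, _ | ⟨d, _ | ⟨_, _⟩⟩⟩⟩⟩ <;> rfl

theorem forall_between_iff_denseSeq {F G : I → I} (hF : Continuous F) (hG : Continuous G) (a b : I) :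
    (∀ z, a < z → z < b → F z ≤ G z) ↔
      ∀ n, a < TopologicalSpace.denseSeq I n → TopologicalSpace.denseSeq I n < b →
        F (TopologicalSpace.denseSeq I n) ≤ G (TopologicalSpace.denseSeq I n) := by
  refine ⟨fun H n => H _, fun H z h1 h2 => ?_⟩
  by_contra! hlt
  obtain ⟨n, ⟨h3, h4⟩, h5⟩ := (TopologicalSpace.denseRange_denseSeq I).exists_mem_open
    ((isOpen_Ioo (a := a) (b := b)).inter (isOpen_lt hG hF)) ⟨z, ⟨h1, h2⟩, hlt⟩
  exact (H n h3 h4).not_gt h5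

theorem measurableSet_nodeRel {e : ℕ → C(I, I) → I} (he : ∀ n, Measurable (e n)) (i : ℕ)
    (l : List ℕ) : MeasurableSet {f | nodeRel f (fun n => e n f) i l} := by
  have hlt : ∀ {u v : C(I, I) → I}, Measurable u → Measurable v → MeasurableSet {f | u f < v f} :=
    fun hu hv => measurableSet_lt hu hv
  unfold nodeRel
  split
  · rename_i a b c d
    exact ((hlt (he a) (he b)).inter (hlt (he c) (he d))).union
      ((hlt (he b) (he a)).inter (hlt (he d) (he c)))
  · exact measurableSet_eq_fun (measurable_eval_comp (he _)) (he _)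
  · rename_i p a b
    let d := TopologicalSpace.denseSeq I
    have : {f : C(I, I) | MovesTowards f p (e a f) (e b f)} =
        (⋂ n, {f | e a f < d n}ᶜ ∪ ({f | d n < e b f}ᶜ ∪ {f | d n ≤ f^[p] (d n)})) ∩
        ⋂ n, {f | e b f < d n}ᶜ ∪ ({f | d n < e a f}ᶜ ∪ {f | f^[p] (d n) ≤ d n}) := by
      ext f
      refine (and_congr
        (forall_between_iff_denseSeq continuous_id (f.continuous.iterate p) _ _)
        (forall_between_iff_denseSeq (f.continuous.iterate p) continuous_id _ _)).trans ?_
      simp only [mem_inter_iff, mem_iInter, mem_union, mem_compl_iff, mem_ofPred_eq,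
        imp_iff_not_or, id, d]
    rw [this]
    refine MeasurableSet.inter (.iInter fun n => ?_) (.iInter fun n => ?_)
    · exact (hlt (he a) measurable_const).compl.union ((hlt measurable_const (he b)).compl.union
        (measurableSet_le measurable_const (measurable_eval_iterate p _)))
    · exact (hlt (he b) measurable_const).compl.union ((hlt measurable_const (he a)).compl.union
        (measurableSet_le (measurable_eval_iterate p _) measurable_const))
  · exact MeasurableSet.const _

/-- The correspondence `x n ↦ y n` is well defined because equality is determined by the order, and
the relations say that it is a `NodeMatch`. -/
theorem exists_conj_of_nodeRel_of_lt_iff {f g : C(I, I)} {x y : ℕ → I} (hx : range x = nodes f)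
    (hy : range y = nodes g) (hlt : ∀ a b, x a < x b ↔ y a < y b)
    (hxy : ∀ i l, nodeRel f x i l ↔ nodeRel g y i l) :
    ∃ h : I ≃ₜ I, ∀ z, h (f z) = g (h z) := by
  classical
  have heq : ∀ a b, x a = x b → y a = y b := fun a b h =>
    le_antisymm (not_lt.1 fun h' => ((hlt b a).2 h').ne' h)
      (not_lt.1 fun h' => ((hlt a b).2 h').ne h)
  let φ : I → I := fun z => if h : ∃ n, x n = z then y h.choose else 0
  have hφ : ∀ n, φ (x n) = y n := fun n => by
    have h : ∃ m, x m = x n := ⟨n, rfl⟩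
    exact (dif_pos h).trans (heq _ _ h.choose_spec)
  have hmono : StrictMonoOn φ (nodes f) := by
    rw [← hx]
    rintro _ ⟨a, rfl⟩ _ ⟨b, rfl⟩ hab
    rw [hφ, hφ]
    exact (hlt a b).1 hab
  refine NodeMatch.exists_conj (φ := φ) ⟨hmono, ⟨?_, hmono.injOn, ?_⟩, ?_, ?_⟩
  · rw [← hx, ← hy]
    rintro _ ⟨a, rfl⟩
    exact ⟨a, (hφ a).symm⟩
  · rw [← hx, ← hy]
    rintro _ ⟨a, rfl⟩
    exact ⟨x a, ⟨a, rfl⟩, hφ a⟩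
  · intro z hz
    have hfz := apply_mem_nodes hz
    rw [← hx] at hz hfz
    obtain ⟨a, rfl⟩ := hz
    obtain ⟨b, hb⟩ := hfz
    have h1 : g (y a) = y b := (hxy 1 [a, b]).1 hb.symm
    rw [← hb, hφ, hφ, h1]
  · rw [← hx]
    rintro p _ ⟨a, rfl⟩ _ ⟨b, rfl⟩
    rw [hφ, hφ]
    exact hxy (p + 2) [a, b]

theorem exists_conj_of_nodeRel {f g : C(I, I)} {x y : ℕ → I} (hx : range x = nodes f)
    (hy : range y = nodes g) (hxy : ∀ i l, nodeRel f x i l ↔ nodeRel g y i l) :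
    ∃ h : I ≃ₜ I, ∀ z, h (f z) = g (h z) := by
  obtain ⟨m, hm⟩ : ∃ m, x m = 0 := by
    rw [← mem_range, hx]; exact .inl (zero_mem_marked f)
  obtain ⟨n, hn⟩ : ∃ n, x n = 1 := by
    rw [← mem_range, hx]; exact .inl (one_mem_marked f)
  -- Comparing all pairs with the one enumerating `(0, 1)` recovers the order on the nodes of `g` up
  -- to reversal.
  have hS : ∀ a b, x a < x b ↔ (y m < y n ∧ y a < y b) ∨ (y n < y m ∧ y b < y a) := fun a b => by
    have h := hxy 0 [m, n, a, b]
    have h01 : (0 : I) < 1 := zero_lt_one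
    simp only [nodeRel, hm, hn, h01, h01.not_gt, true_and, false_and, or_false] at h
    exact h
  rcases lt_trichotomy (y m) (y n) with hmn | hmn | hmn
  · exact exists_conj_of_nodeRel_of_lt_iff hx hy
      (fun a b => by simp [hS, hmn, hmn.not_gt]) hxy
  · have := (hS m n).1 (by rw [hm, hn]; exact zero_lt_one)
    simp [hmn] at this
  -- If the order is reversed, `g` is replaced by its conjugate under `t ↦ 1 - t`.
  · let s : I ≃ₜ I := unitInterval.symmHomeomorph
    let g' : C(I, I) := (ContinuousMap.mk s).comp (g.comp (ContinuousMap.mk s.symm))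
    have hs : ∀ z, s (g z) = g' (s z) := fun z => by
      change s (g z) = s (g (s.symm (s z)))
      rw [s.symm_apply_apply]
    have hy' : range (fun a => s (y a)) = nodes g' := by
      ext z
      constructor
      · rintro ⟨a, rfl⟩
        rw [nodes_conj hs, ← hy]
        exact ⟨a, rfl⟩
      · intro hz
        rw [← s.apply_symm_apply z, nodes_conj hs, ← hy] at hz
        obtain ⟨a, ha⟩ := hz
        exact ⟨a, (congrArg s ha).trans (s.apply_symm_apply z)⟩
    have h1 : intervalConjugacy f g' := exists_conj_of_nodeRel_of_lt_iff hx hy'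
      (fun a b => by
        rw [hS]
        simp only [hmn, hmn.not_gt, true_and, false_and, false_or]
        exact unitInterval.strictAnti_symm.lt_iff_gt.symm)
      fun i l => (hxy i l).trans (nodeRel_conj hs y i l).symm
    have h2 : intervalConjugacy g g' := ⟨s, hs⟩
    exact intervalConjugacy.trans h1 (intervalConjugacy.symm h2)

/-- All nonempty fibres are countably infinite, so they can be matched one by one. Hence a bijection
between node sets is induced by a permutation of indices. -/
theorem exists_perm_of_infinite_fibers {α : Type*} {u v : ℕ → α} (huv : range u = range v)
    (hu : ∀ n, {m | u m = u n}.Infinite) (hv : ∀ n, {m | v m = v n}.Infinite) :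
    ∃ p : Equiv.Perm ℕ, ∀ n, v (p n) = u n := by
  have hfib : ∀ z, Nonempty ({n // u n = z} ≃ {n // v n = z}) := by
    intro z
    by_cases hz : z ∈ range u
    · obtain ⟨n, rfl⟩ := hz
      have h1 : Infinite {m // u m = u n} := (hu n).to_subtype
      have h2 : Infinite {m // v m = u n} := by
        obtain ⟨k, hk⟩ : u n ∈ range v := huv ▸ mem_range_self n
        rw [← hk]
        exact (hv k).to_subtype
      exact nonempty_equiv_of_countable
    · have h1 : IsEmpty {m // u m = z} := ⟨fun m => hz ⟨m, m.2⟩⟩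
      have h2 : IsEmpty {m // v m = z} := ⟨fun m => hz (huv ▸ ⟨m, m.2⟩)⟩
      exact ⟨Equiv.equivOfIsEmpty _ _⟩
  have E := fun z => (hfib z).some
  refine ⟨(Equiv.sigmaFiberEquiv u).symm.trans
    ((Equiv.sigmaCongrRight E).trans (Equiv.sigmaFiberEquiv v)), fun n => ?_⟩
  exact (E (u n) ⟨n, rfl⟩).2

theorem intervalConjugacy_le_relFamilyIso : BorelReducible intervalConjugacy relFamilyIso := by
  classical
  obtain ⟨e, he, hr, hinf⟩ := exists_infinite_enumeration
  refine ⟨fun f i l => decide (nodeRel f (fun n => e n f) i l), ?_, fun f g => ?_⟩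
  · refine measurable_pi_iff.2 fun i => measurable_pi_iff.2 fun l => measurable_to_bool ?_
    convert measurableSet_nodeRel he i l using 1
    ext f
    simp
  · rw [relFamilyIso_iff]
    simp only [decide_eq_decide, nodeRel_map]
    constructor
    · rintro ⟨h, hh⟩
      obtain ⟨p, hp⟩ := exists_perm_of_infinite_fibers (u := fun n => h (e n f))
        (v := fun n => e n g) (by
          rw [hr]
          ext z
          rw [← h.apply_symm_apply z, nodes_conj hh, ← hr]
          simp only [mem_range, h.injective.eq_iff])
        (fun n => by simpa only [h.injective.eq_iff] using hinf f n) (hinf g)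
      refine ⟨p, fun i l => ?_⟩
      simp only [hp]
      exact (nodeRel_conj hh _ i l).symm
    · rintro ⟨p, hp⟩
      refine exists_conj_of_nodeRel (hr f) ?_ hp
      exact (p.surjective.range_comp fun n => e n g).trans (hr g)

end BorelComplexity

/-! ### Lower bound: interval maps that realise coloured orders. -/

namespace BorelComplexity

open Set Filter Topology

/-! ### Patterns -/

/-- The amount by which the `k`-th pattern stays below `1`. -/
noncomputable def patternDefect (k : ℕ) (t : ℝ) : ℝ :=
  (1 - t) * ((1 - t) * ∏ i ∈ Finset.range k, min 1 |1 - (i + 2) * t|)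

theorem pattern_prod_mem (k : ℕ) (t : ℝ) :
    (∏ i ∈ Finset.range k, min 1 |1 - ((i : ℝ) + 2) * t|) ∈ Icc (0 : ℝ) 1 :=
  ⟨Finset.prod_nonneg fun _ _ => le_min zero_le_one (abs_nonneg _),
    Finset.prod_le_one (fun _ _ => le_min zero_le_one (abs_nonneg _)) fun _ _ => min_le_left _ _⟩

theorem patternDefect_mem (k : ℕ) {t : ℝ} (ht : t ∈ I) : patternDefect k t ∈ Icc 0 (1 - t) := by
  obtain ⟨h0, h1⟩ := pattern_prod_mem k t
  have ht' : 0 ≤ 1 - t := sub_nonneg.2 ht.2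
  refine ⟨mul_nonneg ht' (mul_nonneg ht' h0), mul_le_of_le_one_right ht' ?_⟩
  exact mul_le_one₀ (by linarith [ht.1]) h0 h1

/-- The squared factor `1 - t` gives strictness: the second copy is below `1` as soon as `t > 0`,
and the truncated product is at most `1`. -/
theorem patternDefect_lt (k : ℕ) {t : ℝ} (ht : t ∈ Ioo (0 : ℝ) 1) : patternDefect k t < 1 - t := by
  obtain ⟨h0, h1⟩ := pattern_prod_mem k t
  have ht' : 0 < 1 - t := sub_pos.2 ht.2
  refine mul_lt_of_lt_one_right ht' ?_
  exact (mul_le_of_le_one_right ht'.le h1).trans_lt (by linarith [ht.1])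

theorem patternDefect_eq_zero_iff (k : ℕ) {t : ℝ} (ht : t < 1) :
    patternDefect k t = 0 ↔ ∃ i < k, t = 1 / (i + 2) := by
  have ht' : 1 - t ≠ 0 := (sub_pos.2 ht).ne'
  simp only [patternDefect, mul_eq_zero, ht', false_or, Finset.prod_eq_zero_iff, Finset.mem_range]
  refine exists_congr fun i => and_congr_right fun _ => ?_
  have hi : (i : ℝ) + 2 ≠ 0 := by positivity
  rw [eq_div_iff hi, mul_comm t]
  constructor
  · intro h
    rcases min_choice 1 |1 - ((i : ℝ) + 2) * t| with h' | h'
    · rw [h] at h'; norm_num at h'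
    · rw [h] at h'
      linarith [abs_eq_zero.1 h'.symm]
  · intro h
    rw [h]
    simp

theorem continuous_patternDefect (k : ℕ) : Continuous (patternDefect k) := by
  unfold patternDefect
  fun_prop

/-- A map of the interval that fixes exactly the end points, moves the other points up, and takes
the value `1` at exactly `k` interior points. -/
noncomputable def pattern (k : ℕ) : C(I, I) where
  toFun t := ⟨1 - patternDefect k t, by
    obtain ⟨h1, h2⟩ := patternDefect_mem k t.2
    exact ⟨by linarith [t.2.1], by linarith⟩⟩
  continuous_toFun := Continuous.subtype_mk
    (continuous_const.sub ((continuous_patternDefect k).comp continuous_subtype_val)) _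

theorem pattern_coe (k : ℕ) (t : I) : (pattern k t : ℝ) = 1 - patternDefect k t := rfl

theorem pattern_zero (k : ℕ) : pattern k 0 = 0 := by
  apply Subtype.ext
  rw [pattern_coe]
  simp [patternDefect]

theorem pattern_one (k : ℕ) : pattern k 1 = 1 := by
  apply Subtype.ext
  rw [pattern_coe]
  simp [patternDefect]

theorem lt_pattern (k : ℕ) {t : I} (ht : t ∈ Ioo (0 : I) 1) : t < pattern k t := by
  have := patternDefect_lt k (t := t) ⟨ht.1, ht.2⟩
  rw [← Subtype.coe_lt_coe, pattern_coe]
  linarith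

theorem le_pattern (k : ℕ) (t : I) : t ≤ pattern k t := by
  have := (patternDefect_mem k t.2).2
  rw [← Subtype.coe_le_coe, pattern_coe]
  linarith

/-- The factor with index `i` vanishes exactly at `1 / (i + 2)`; the shift by `2` keeps this point
strictly inside the interval. The count is what a conjugacy will see of the colour. -/
theorem ncard_pattern_eq_one (k : ℕ) : {t : I | t ∈ Ioo 0 1 ∧ pattern k t = 1}.ncard = k := by
  have hmem : ∀ i : ℕ, 1 / ((i : ℝ) + 2) ∈ Ioo (0 : ℝ) 1 := fun i =>
    ⟨by positivity, (div_lt_one (by positivity)).2 (by linarith [(Nat.cast_nonneg i : (0 : ℝ) ≤ i)])⟩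
  let q : ℕ → I := fun i => ⟨1 / ((i : ℝ) + 2), (hmem i).1.le, (hmem i).2.le⟩
  have hq : Function.Injective q := fun i j hij => by
    have h : 1 / ((i : ℝ) + 2) = 1 / ((j : ℝ) + 2) := congrArg Subtype.val hij
    have hi : (i : ℝ) + 2 ≠ 0 := by positivity
    have hj : (j : ℝ) + 2 ≠ 0 := by positivity
    rw [div_eq_div_iff hi hj] at h
    have : (i : ℝ) = j := by linarith
    exact_mod_cast this
  have : {t : I | t ∈ Ioo 0 1 ∧ pattern k t = 1} = q '' (Finset.range k : Set ℕ) := by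
    ext t
    simp only [mem_ofPred_eq, mem_image, Finset.mem_coe, Finset.mem_range]
    constructor
    · rintro ⟨ht, h⟩
      have h' : patternDefect k t = 0 := by
        have := congrArg Subtype.val h
        rw [pattern_coe] at this
        have h1 : ((1 : I) : ℝ) = 1 := rfl
        linarith
      obtain ⟨i, hi, hti⟩ := (patternDefect_eq_zero_iff k ht.2).1 h'
      exact ⟨i, hi, Subtype.ext hti.symm⟩
    · rintro ⟨i, hi, rfl⟩
      refine ⟨⟨(hmem i).1, (hmem i).2⟩, Subtype.ext ?_⟩
      rw [pattern_coe, (patternDefect_eq_zero_iff k (hmem i).2).2 ⟨i, hi, rfl⟩, sub_zero]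
      rfl
  rw [this, ncard_image_of_injective _ hq, ncard_coe_finset, Finset.card_range]

/-- The displacement of the `k`-th pattern, extended by zero to the line. -/
noncomputable def bump (k : ℕ) (t : ℝ) : ℝ :=
  pattern k (projIcc 0 1 zero_le_one t) - projIcc 0 1 zero_le_one t

theorem continuous_bump (k : ℕ) : Continuous (bump k) :=
  (continuous_subtype_val.comp ((pattern k).continuous.comp continuous_projIcc)).sub
    (continuous_subtype_val.comp continuous_projIcc)

theorem abs_bump_le (k : ℕ) (t : ℝ) : |bump k t| ≤ 1 := by
  have h1 := (pattern k (projIcc 0 1 zero_le_one t)).2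
  have h2 := (projIcc (0 : ℝ) 1 zero_le_one t).2
  rw [bump, abs_le]
  constructor <;> linarith [h1.1, h1.2, h2.1, h2.2]

theorem bump_of_le (k : ℕ) {t : ℝ} (ht : t ≤ 0) : bump k t = 0 := by
  rw [bump, projIcc_of_le_left _ ht]
  exact sub_eq_zero.2 (congrArg Subtype.val (pattern_zero k))

theorem bump_of_ge (k : ℕ) {t : ℝ} (ht : 1 ≤ t) : bump k t = 0 := by
  rw [bump, projIcc_of_right_le _ ht]
  exact sub_eq_zero.2 (congrArg Subtype.val (pattern_one k))

theorem bump_coe (k : ℕ) (t : I) : bump k t = pattern k t - t := by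
  rw [bump, projIcc_val]

/-! ### Intervals arranged in a countable order -/

section Cells

variable {S : Type*} [LinearOrder S]

/-- A choice of positive lengths with sum `1`. -/
structure Lengths (S : Type*) where
  len : S → ℝ
  len_pos : ∀ s, 0 < len s
  hasSum : HasSum len 1

theorem nonempty_lengths (S : Type*) [Countable S] [Infinite S] : Nonempty (Lengths S) := by
  obtain ⟨D⟩ := nonempty_denumerable S
  let ε : S ≃ ℕ := Denumerable.eqv S
  refine ⟨⟨fun s => 1 / 2 / 2 ^ ε s, fun s => by positivity, ?_⟩⟩
  exact (ε.hasSum_iff (f := fun n : ℕ => (1 : ℝ) / 2 / 2 ^ n)).2 (hasSum_geometric_two' 1)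

namespace Lengths

variable (w : Lengths S)

/-- The left end point of the interval with index `s`. -/
noncomputable def left (s : S) : ℝ := ∑' t, (Iio s).indicator w.len t

theorem summable_indicator {S : Type*} (w : Lengths S) (A : Set S) : Summable (A.indicator w.len) :=
  w.hasSum.summable.indicator A

theorem left_nonneg (s : S) : 0 ≤ w.left s :=
  tsum_nonneg fun _ => indicator_nonneg (fun t _ => (w.len_pos t).le) _

theorem left_add_len (s : S) : w.left s + w.len s = ∑' t, (Iic s).indicator w.len t := by
  have h : ∀ t, (Iic s).indicator w.len t =
      (Iio s).indicator w.len t + ({s} : Set S).indicator w.len t := fun t => by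
    rw [← Iio_union_right, indicator_union_of_disjoint (by simp)]
  simp_rw [h]
  rw [(w.summable_indicator _).tsum_add (w.summable_indicator _), left]
  congr 1
  rw [tsum_eq_single s (fun t ht => indicator_of_notMem (by simpa using ht) _)]
  simp

theorem left_add_len_le_one (s : S) : w.left s + w.len s ≤ 1 := by
  rw [left_add_len, ← w.hasSum.tsum_eq]
  exact (w.summable_indicator _).tsum_le_tsum
    (indicator_le_self' fun t _ => (w.len_pos t).le) w.hasSum.summable

theorem left_add_len_le_left {s t : S} (h : s < t) : w.left s + w.len s ≤ w.left t := by
  rw [left_add_len, left]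
  exact (w.summable_indicator _).tsum_le_tsum
    (indicator_le_indicator_of_subset (Iic_subset_Iio.2 h) fun t => (w.len_pos t).le)
    (w.summable_indicator _)

/-- The affine parametrization of the interval with index `s`. -/
noncomputable def cell (s : S) : C(I, I) where
  toFun t := ⟨w.left s + w.len s * t, by
    have h1 := w.left_nonneg s
    have h2 := w.left_add_len_le_one s
    have h3 := mul_nonneg (w.len_pos s).le t.2.1
    have h4 := mul_le_of_le_one_right (w.len_pos s).le t.2.2
    exact ⟨by linarith, by linarith⟩⟩
  continuous_toFun := by fun_prop

theorem cell_coe (s : S) (t : I) : (w.cell s t : ℝ) = w.left s + w.len s * t := rfl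

theorem cell_strictMono (s : S) : StrictMono (w.cell s) := fun t u h => by
  rw [← Subtype.coe_lt_coe, cell_coe, cell_coe]
  have := mul_lt_mul_of_pos_left (Subtype.coe_lt_coe.2 h) (w.len_pos s)
  linarith

theorem cell_le_cell {s s' : S} (h : s < s') (t t' : I) : w.cell s t ≤ w.cell s' t' := by
  rw [← Subtype.coe_le_coe, cell_coe, cell_coe]
  have h1 := w.left_add_len_le_left h
  have h3 := mul_nonneg (w.len_pos s').le t'.2.1
  have h4 := mul_le_of_le_one_right (w.len_pos s).le t.2.2
  linarith

theorem cell_lt_cell_iff {s s' : S} {t t' : I} (ht : t ∈ Ioo 0 1) :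
    w.cell s t < w.cell s' t' ↔ s < s' ∨ s = s' ∧ t < t' := by
  rcases lt_trichotomy s s' with h | rfl | h
  · simp only [h, true_or, iff_true]
    exact (w.cell_strictMono s ht.2).trans_le (w.cell_le_cell h _ _)
  · simp [(w.cell_strictMono s).lt_iff_lt]
  · simp only [h.not_gt, h.ne', false_and, or_false, iff_false, not_lt]
    exact w.cell_le_cell h _ _

theorem exists_cell_eq {s : S} {x : I} (h0 : w.cell s 0 < x) (h1 : x < w.cell s 1) :
    ∃ t ∈ Ioo (0 : I) 1, w.cell s t = x := by
  have := intermediate_value_Ioo (zero_le_one : (0 : I) ≤ 1) (w.cell s).continuous.continuousOn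
  obtain ⟨t, ht, htx⟩ := this ⟨h0, h1⟩
  exact ⟨t, ht, htx⟩

/-- The open cells are disjoint with total length `1`, so they have full measure and no open
interval can avoid them. -/
theorem dense_cells [Countable S] : DenseRange fun p : S × Ioo (0 : I) 1 => w.cell p.1 p.2 := by
  refine dense_iff_inter_open.2 fun V hV hVn => ?_
  by_contra hemp
  obtain ⟨x, hx⟩ := hVn
  obtain ⟨u, v, huv, huvV⟩ := hV.exists_Ioo_subset ⟨x, hx⟩
  let J : S → Set ℝ := fun s => Ioo (w.left s) (w.left s + w.len s)
  have hJ1 : ∀ s, J s ⊆ Icc 0 1 := fun s y hy =>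
    ⟨(w.left_nonneg s).trans hy.1.le, hy.2.le.trans (w.left_add_len_le_one s)⟩
  have hJd : Pairwise fun s s' => Disjoint (J s) (J s') := by
    have : ∀ s s', s < s' → Disjoint (J s) (J s') := fun s s' h =>
      disjoint_left.2 fun y hy hy' => absurd (w.left_add_len_le_left h) (not_le.2 (hy'.1.trans hy.2))
    intro s s' h
    rcases lt_or_gt_of_ne h with h | h
    · exact this s s' h
    · exact (this s' s h).symm
  have hvol : MeasureTheory.volume (⋃ s, J s) = 1 := by
    rw [MeasureTheory.measure_iUnion hJd fun s => measurableSet_Ioo]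
    simp only [J, Real.volume_Ioo, add_sub_cancel_left]
    rw [← ENNReal.ofReal_tsum_of_nonneg (fun s => (w.len_pos s).le) w.hasSum.summable,
      w.hasSum.tsum_eq, ENNReal.ofReal_one]
  have hdis : Disjoint (⋃ s, J s) (Ioo (u : ℝ) v) := by
    refine disjoint_left.2 fun y hy hy' => ?_
    obtain ⟨s, hs⟩ := mem_iUnion.1 hy
    have hyI := hJ1 s hs
    have h0 : w.cell s 0 < ⟨y, hyI⟩ := by
      rw [← Subtype.coe_lt_coe, cell_coe]
      simpa using hs.1
    have h1 : ⟨y, hyI⟩ < w.cell s 1 := by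
      rw [← Subtype.coe_lt_coe, cell_coe]
      simpa using hs.2
    obtain ⟨t, ht, hty⟩ := w.exists_cell_eq h0 h1
    refine hemp ⟨⟨y, hyI⟩, huvV ⟨hy'.1, hy'.2⟩, ⟨⟨s, ⟨t, ht⟩⟩, hty⟩⟩
  have hsub : (⋃ s, J s) ∪ Ioo (u : ℝ) v ⊆ Icc 0 1 :=
    union_subset (iUnion_subset hJ1) fun y hy => ⟨u.2.1.trans hy.1.le, hy.2.le.trans v.2.2⟩
  have hle := MeasureTheory.measure_mono (μ := MeasureTheory.volume) hsub
  rw [MeasureTheory.measure_union hdis measurableSet_Ioo, hvol, Real.volume_Ioo, Real.volume_Icc,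
    sub_zero, ENNReal.ofReal_one] at hle
  have hpos : 0 < ENNReal.ofReal ((v : ℝ) - u) := ENNReal.ofReal_pos.2 (sub_pos.2 huv)
  exact (ENNReal.lt_add_right ENNReal.one_ne_top hpos.ne').not_ge hle

variable (c : S → ℕ)

theorem bump_eq_zero {s s' : S} (h : s' ≠ s) (t : I) :
    bump (c s') ((w.cell s t - w.left s') / w.len s') = 0 := by
  have hp := w.len_pos s'
  rcases lt_or_gt_of_ne h with h | h
  · refine bump_of_ge _ ((one_le_div hp).2 ?_)
    have h1 := w.cell_le_cell h 1 t
    rw [← Subtype.coe_le_coe, cell_coe] at h1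
    have h2 : w.len s' * ((1 : I) : ℝ) = w.len s' := mul_one _
    linarith
  · refine bump_of_le _ (div_nonpos_of_nonpos_of_nonneg ?_ hp.le)
    have h1 := w.cell_le_cell h t 0
    rw [← Subtype.coe_le_coe, w.cell_coe s' 0] at h1
    have h2 : w.len s' * ((0 : I) : ℝ) = 0 := mul_zero _
    linarith

/-- The value at `x` of the map that follows the pattern with number `c s` on the interval with index
`s`. -/
noncomputable def patternedValue (x : ℝ) : ℝ :=
  x + ∑' s, w.len s * bump (c s) ((x - w.left s) / w.len s)

/-- The displacements are bounded by the lengths, which are summable, so the series converges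
uniformly. -/
theorem continuous_patternedValue : Continuous (w.patternedValue c) := by
  refine continuous_id.add (continuous_tsum (u := w.len) (fun s => ?_) w.hasSum.summable ?_)
  · exact continuous_const.mul ((continuous_bump _).comp
      ((continuous_id.sub continuous_const).div_const _))
  · intro s x
    rw [norm_mul, Real.norm_of_nonneg (w.len_pos s).le]
    exact mul_le_of_le_one_right (w.len_pos s).le (abs_bump_le _ _)

theorem patternedValue_cell (s : S) (t : I) :
    w.patternedValue c (w.cell s t) = w.cell s (pattern (c s) t) := by
  rw [patternedValue, tsum_eq_single s fun s' hs' => by rw [w.bump_eq_zero c hs', mul_zero]]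
  have h : ((w.cell s t : ℝ) - w.left s) / w.len s = t := by
    rw [cell_coe, add_sub_cancel_left, mul_div_cancel_left₀ _ (w.len_pos s).ne']
  rw [h, bump_coe, cell_coe, cell_coe]
  ring

theorem patternedValue_of_forall {x : I} (hx : ∀ s, ∀ t ∈ Ioo (0 : I) 1, w.cell s t ≠ x) :
    w.patternedValue c x = x := by
  have h : ∀ s, w.len s * bump (c s) ((x - w.left s) / w.len s) = 0 := fun s => by
    have hp := w.len_pos s
    rcases le_or_gt x (w.cell s 0) with h0 | h0
    · rw [bump_of_le, mul_zero]
      refine div_nonpos_of_nonpos_of_nonneg ?_ hp.le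
      rw [← Subtype.coe_le_coe, cell_coe] at h0
      have h2 : w.len s * ((0 : I) : ℝ) = 0 := mul_zero _
      linarith
    · rcases le_or_gt (w.cell s 1) x with h1 | h1
      · rw [bump_of_ge, mul_zero]
        refine (one_le_div hp).2 ?_
        rw [← Subtype.coe_le_coe, cell_coe] at h1
        have h2 : w.len s * ((1 : I) : ℝ) = w.len s := mul_one _
        linarith
      · obtain ⟨t, ht, htx⟩ := w.exists_cell_eq h0 h1
        exact (hx s t ht htx).elim
  rw [patternedValue, tsum_congr h, tsum_zero, add_zero]

theorem cell_or_forall (x : I) : (∃ s, ∃ t ∈ Ioo (0 : I) 1, w.cell s t = x) ∨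
    ∀ s, ∀ t ∈ Ioo (0 : I) 1, w.cell s t ≠ x := by
  by_cases h : ∃ s, ∃ t ∈ Ioo (0 : I) 1, w.cell s t = x
  · exact .inl h
  · push Not at h
    exact .inr h

/-- The interval map that follows the pattern with number `c s` on the interval with index `s` and is
the identity elsewhere. -/
noncomputable def patterned : C(I, I) where
  toFun x := ⟨w.patternedValue c x, by
    rcases w.cell_or_forall x with ⟨s, t, -, rfl⟩ | h
    · rw [patternedValue_cell]
      exact Subtype.prop _
    · rw [w.patternedValue_of_forall c h]
      exact x.2⟩
  continuous_toFun := Continuous.subtype_mk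
    ((w.continuous_patternedValue c).comp continuous_subtype_val) _

theorem patterned_cell (s : S) (t : I) :
    w.patterned c (w.cell s t) = w.cell s (pattern (c s) t) :=
  Subtype.ext (w.patternedValue_cell c s t)

theorem patterned_of_forall {x : I} (hx : ∀ s, ∀ t ∈ Ioo (0 : I) 1, w.cell s t ≠ x) :
    w.patterned c x = x :=
  Subtype.ext (w.patternedValue_of_forall c hx)

theorem le_patterned (x : I) : x ≤ w.patterned c x := by
  rcases w.cell_or_forall x with ⟨s, t, -, rfl⟩ | h
  · rw [patterned_cell]
    exact (w.cell_strictMono s).monotone (le_pattern _ _)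
  · rw [w.patterned_of_forall c h]

theorem lt_patterned_cell (s : S) {t : I} (ht : t ∈ Ioo 0 1) :
    w.cell s t < w.patterned c (w.cell s t) := by
  rw [patterned_cell]
  exact w.cell_strictMono s (lt_pattern _ ht)

theorem le_cell_zero_of_fixed {s : S} {x : I} (hx : w.patterned c x = x) (h : x < w.cell s 1) :
    x ≤ w.cell s 0 := by
  by_contra! h0
  obtain ⟨t, ht, rfl⟩ := w.exists_cell_eq h0 h
  exact (w.lt_patterned_cell c s ht).ne' hx

theorem cell_one_le_of_fixed {s : S} {x : I} (hx : w.patterned c x = x) (h : w.cell s 0 < x) :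
    w.cell s 1 ≤ x := by
  by_contra! h0
  obtain ⟨t, ht, rfl⟩ := w.exists_cell_eq h h0
  exact (w.lt_patterned_cell c s ht).ne' hx

theorem patterned_cell_zero (s : S) : w.patterned c (w.cell s 0) = w.cell s 0 := by
  rw [patterned_cell, pattern_zero]

theorem patterned_cell_one (s : S) : w.patterned c (w.cell s 1) = w.cell s 1 := by
  rw [patterned_cell, pattern_one]

theorem ncard_patterned (s : S) :
    {x | (w.cell s 0 < x ∧ x < w.cell s 1) ∧ w.patterned c x = w.cell s 1}.ncard = c s := by
  have : {x | (w.cell s 0 < x ∧ x < w.cell s 1) ∧ w.patterned c x = w.cell s 1} =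
      w.cell s '' {t | t ∈ Ioo 0 1 ∧ pattern (c s) t = 1} := by
    ext x
    constructor
    · rintro ⟨⟨h0, h1⟩, hx⟩
      obtain ⟨t, ht, rfl⟩ := w.exists_cell_eq h0 h1
      rw [patterned_cell] at hx
      exact ⟨t, ⟨ht, (w.cell_strictMono s).injective hx⟩, rfl⟩
    · rintro ⟨t, ⟨ht, hp⟩, rfl⟩
      refine ⟨⟨w.cell_strictMono s ht.1, w.cell_strictMono s ht.2⟩, ?_⟩
      rw [patterned_cell, hp]
  rw [this, ncard_image_of_injective _ (w.cell_strictMono s).injective, ncard_pattern_eq_one]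

variable {c} {d : S → ℕ}

/-- Both maps move points only up, and a decreasing conjugacy would turn a point moved strictly up
into one moved strictly down. -/
theorem strictMono_of_conj [Nonempty S] {h : I ≃ₜ I}
    (hh : ∀ x, h (w.patterned c x) = w.patterned d (h x)) : StrictMono h := by
  rcases homeomorph_mono_or_anti h with hm | hm
  · exact hm
  · exfalso
    obtain ⟨s⟩ := ‹Nonempty S›
    obtain ⟨t, ht⟩ := exists_between (zero_lt_one : (0 : I) < 1)
    have h1 := hm (w.lt_patterned_cell c s ht)
    rw [hh] at h1
    exact h1.not_ge (w.le_patterned d _)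

/-- The open cells are the maximal intervals without fixed points, with fixed end points, so a
conjugacy carries cells to cells. -/
theorem exists_cell_of_conj [Nonempty S] {h : I ≃ₜ I}
    (hh : ∀ x, h (w.patterned c x) = w.patterned d (h x)) (s : S) :
    ∃ s', h (w.cell s 0) = w.cell s' 0 ∧ h (w.cell s 1) = w.cell s' 1 := by
  have hm := w.strictMono_of_conj hh
  obtain ⟨t, ht⟩ := exists_between (zero_lt_one : (0 : I) < 1)
  rcases w.cell_or_forall (h (w.cell s t)) with ⟨s', t', ht', e⟩ | hno
  · have hfix : ∀ z, w.patterned d z = z → w.patterned c (h.symm z) = h.symm z := fun z hz => by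
      rw [← conj_symm hh, hz]
    have h0 : w.cell s' 0 < h (w.cell s t) := e ▸ w.cell_strictMono s' ht'.1
    have h1 : h (w.cell s t) < w.cell s' 1 := e ▸ w.cell_strictMono s' ht'.2
    have h2 := hm (w.cell_strictMono s ht.1)
    have h3 := hm (w.cell_strictMono s ht.2)
    refine ⟨s', le_antisymm ?_ ?_, le_antisymm ?_ ?_⟩
    · exact w.le_cell_zero_of_fixed d (by rw [← hh, patterned_cell_zero]) (h2.trans h1)
    · have := w.le_cell_zero_of_fixed c (s := s) (hfix _ (w.patterned_cell_zero d s')) (by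
        rw [← hm.lt_iff_lt, h.apply_symm_apply]; exact h0.trans h3)
      rwa [← hm.le_iff_le, h.apply_symm_apply] at this
    · have := w.cell_one_le_of_fixed c (s := s) (hfix _ (w.patterned_cell_one d s')) (by
        rw [← hm.lt_iff_lt, h.apply_symm_apply]; exact h2.trans h1)
      rwa [← hm.le_iff_le, h.apply_symm_apply] at this
    · exact w.cell_one_le_of_fixed d (by rw [← hh, patterned_cell_one]) (h0.trans h3)
  · exfalso
    have h1 := w.patterned_of_forall d hno
    rw [← hh] at h1
    exact (w.lt_patterned_cell c s ht).ne' (h.injective h1)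

theorem lt_of_cell_zero_lt {s s' : S} (h : w.cell s 1 ≤ w.cell s' 0) : s < s' := by
  by_contra! hle
  have h01 : w.cell s 0 < w.cell s 1 := w.cell_strictMono s zero_lt_one
  rcases hle.eq_or_lt with rfl | hlt
  · exact (h01.trans_le h).false
  · have h1 := w.cell_le_cell hlt 1 0
    have h2 : w.cell s' 0 < w.cell s' 1 := w.cell_strictMono s' zero_lt_one
    exact ((h2.trans_le h1).trans (h01.trans_le h)).false

theorem cell_zero_injective {s s' : S} (h : w.cell s 0 = w.cell s' 0) : s = s' := by
  have h01 : ∀ s, w.cell s 0 < w.cell s 1 := fun s => w.cell_strictMono s zero_lt_one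
  rcases lt_trichotomy s s' with hlt | e | hlt
  · exact ((h01 s).trans_le (h ▸ w.cell_le_cell hlt 1 0)).false.elim
  · exact e
  · exact ((h01 s').trans_le (h ▸ w.cell_le_cell hlt 1 0)).false.elim

theorem exists_orderIso_of_conj [Nonempty S]
    (hcd : intervalConjugacy (w.patterned c) (w.patterned d)) :
    ∃ e : S ≃o S, ∀ s, d (e s) = c s := by
  obtain ⟨h, hh⟩ := hcd
  have hm := w.strictMono_of_conj hh
  choose F hF0 hF1 using w.exists_cell_of_conj hh
  choose G hG0 hG1 using w.exists_cell_of_conj (conj_symm hh)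
  have hGF : ∀ s, G (F s) = s := fun s => w.cell_zero_injective (by
    rw [← hG0, ← hF0, h.symm_apply_apply])
  have hFG : ∀ s, F (G s) = s := fun s => w.cell_zero_injective (by
    rw [← hF0, ← hG0, h.apply_symm_apply])
  have hmono : StrictMono F := fun s s' hs => w.lt_of_cell_zero_lt (by
    rw [← hF1, ← hF0]
    exact hm.monotone (w.cell_le_cell hs _ _))
  refine ⟨hmono.orderIsoOfSurjective F fun s => ⟨G s, hFG s⟩, fun s => ?_⟩
  change d (F s) = c s
  -- The conjugacy maps the interior points of a cell sent to its right end bijectively to those of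
  -- the image cell, so the colours agree.
  rw [← w.ncard_patterned d, ← w.ncard_patterned c, ← ncard_image_of_injective
    {x | (w.cell s 0 < x ∧ x < w.cell s 1) ∧ w.patterned c x = w.cell s 1} h.injective]
  congr 1
  ext x
  obtain ⟨z, rfl⟩ := h.surjective x
  rw [h.injective.mem_set_image]
  simp only [mem_ofPred_eq, ← hF0, ← hF1, ← hh, hm.lt_iff_lt, h.injective.eq_iff]

/-- The affine identifications of corresponding cells form an increasing map between dense sets; its
extension commutes with the maps on the cells, hence everywhere. -/
theorem conj_of_orderIso [Countable S] (e : S ≃o S) (he : ∀ s, d (e s) = c s) :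
    intervalConjugacy (w.patterned c) (w.patterned d) := by
  have hb : DenseRange fun p : S × Ioo (0 : I) 1 => w.cell (e p.1) p.2 := by
    have := w.dense_cells
    refine this.mono ?_
    rintro _ ⟨⟨s, t⟩, rfl⟩
    exact ⟨(e.symm s, t), by simp⟩
  obtain ⟨h, hh⟩ := exists_orderIso_of_denseRange w.dense_cells hb fun p q => by
    rw [w.cell_lt_cell_iff p.2.2, w.cell_lt_cell_iff p.2.2, e.lt_iff_lt,
      e.injective.eq_iff]
  have hcell : ∀ s, ∀ t : I, h (w.cell s t) = w.cell (e s) t := fun s => by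
    have hd : Dense (Ioo (0 : I) 1) := by
      intro x
      rw [closure_Ioo zero_ne_one]
      exact ⟨unitInterval.nonneg', unitInterval.le_one'⟩
    refine congrFun (Continuous.ext_on hd (h.continuous.comp (w.cell s).continuous)
      (w.cell (e s)).continuous fun t ht => hh (s, ⟨t, ht⟩))
  refine ⟨h.toHomeomorph, fun x => ?_⟩
  refine congrFun (Continuous.ext_on w.dense_cells (f := fun x => h (w.patterned c x))
    (g := fun x => w.patterned d (h x)) (h.continuous.comp (w.patterned c).continuous)
    ((w.patterned d).continuous.comp h.continuous) ?_) x
  rintro _ ⟨⟨s, t⟩, rfl⟩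
  beta_reduce
  rw [patterned_cell, hcell, hcell, patterned_cell, he]

end Lengths

end Cells

/-- Evaluations at a dense sequence embed `C(I, I)` continuously and injectively in a countable
power of `I`; such a map between Polish spaces is a Borel embedding (Lusin–Souslin). -/
theorem measurable_of_measurable_eval {Ω : Type*} [MeasurableSpace Ω] {F : Ω → C(I, I)}
    (hF : ∀ x, Measurable fun ω => F ω x) : Measurable F := by
  let d : ℕ → I := TopologicalSpace.denseSeq I
  have hc : Continuous fun (f : C(I, I)) (n : ℕ) => f (d n) :=
    continuous_pi fun n => continuous_eval_const (d n)
  have hi : Function.Injective fun (f : C(I, I)) (n : ℕ) => f (d n) := fun f g h =>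
    DFunLike.coe_injective ((TopologicalSpace.denseRange_denseSeq I).equalizer f.continuous
      g.continuous (funext fun n => congrFun h n))
  exact (hc.measurableEmbedding hi).measurable_comp_iff.1 (measurable_pi_iff.2 fun n => hF (d n))

/-- The cells do not move with the colouring, so the value at a fixed `x` depends on at most one
colour. -/
theorem Lengths.measurable_patterned {S : Type*} [LinearOrder S] (w : Lengths S) {Ω : Type*}
    [MeasurableSpace Ω] {c : Ω → S → ℕ} (hc : ∀ s, Measurable fun ω => c ω s) :
    Measurable fun ω => w.patterned (c ω) := by
  refine measurable_of_measurable_eval fun x => ?_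
  rcases w.cell_or_forall x with ⟨s, t, -, rfl⟩ | h
  · simp only [patterned_cell]
    exact (measurable_from_top (f := fun k => w.cell s (pattern k t))).comp (hc s)
  · simp only [w.patterned_of_forall _ h]
    exact measurable_const

end BorelComplexity

/-! ### Lower bound: coding graphs by colourings of one countable order. -/

namespace BorelComplexity

open Set Filter Topology

/-! ### Back and forth -/

/-- The back-and-forth method: finite approximations that can be extended in both directions
yield a bijection all of whose pairs are approximated. -/
theorem exists_equiv_of_back_and_forth {α β P : Type*} [Encodable α] [Encodable β]
    (le : P → P → Prop) [Std.Refl le] [IsTrans P le] (R : P → α → β → Prop) (p₀ : P)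
    (mono : ∀ {p q a b}, le p q → R p a b → R q a b)
    (left : ∀ p a, ∃ q, le p q ∧ ∃ b, R q a b) (right : ∀ p b, ∃ q, le p q ∧ ∃ a, R q a b)
    (inj : ∀ {p a b a' b'}, R p a b → R p a' b' → (a = a' ↔ b = b')) :
    ∃ e : α ≃ β, ∀ a a', ∃ p, R p a (e a) ∧ R p a' (e a') := by
  -- Stage `n` serves the single element of `α ⊕ β` with code `n`, so every element of either side
  -- is treated at some stage.
  have hstep : ∀ (n : ℕ) (p : P), ∃ q, le p q ∧
      (∀ a : α, n = Encodable.encode (Sum.inl a : α ⊕ β) → ∃ b, R q a b) ∧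
      ∀ b : β, n = Encodable.encode (Sum.inr b : α ⊕ β) → ∃ a, R q a b := by
    intro n p
    by_cases hn : ∃ x : α ⊕ β, n = Encodable.encode x
    · obtain ⟨a | b, rfl⟩ := hn
      · obtain ⟨q, hq, hb⟩ := left p a
        refine ⟨q, hq, fun a' ha' => ?_, fun b' hb' => ?_⟩
        · cases Sum.inl_injective (Encodable.encode_injective ha')
          exact hb
        · cases Encodable.encode_injective hb'
      · obtain ⟨q, hq, ha⟩ := right p b
        refine ⟨q, hq, fun a' ha' => ?_, fun b' hb' => ?_⟩
        · cases Encodable.encode_injective ha'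
        · cases Sum.inr_injective (Encodable.encode_injective hb')
          exact ha
    · exact ⟨p, refl p, fun a ha => (hn ⟨_, ha⟩).elim, fun b hb => (hn ⟨_, hb⟩).elim⟩
  choose next hle hl hr using hstep
  obtain ⟨s, hsucc⟩ : ∃ s : ℕ → P, ∀ n, s (n + 1) = next n (s n) :=
    ⟨fun n => Nat.rec p₀ next n, fun _ => rfl⟩
  have hs : ∀ {m n}, m ≤ n → le (s m) (s n) := fun h =>
    Nat.rel_of_forall_rel_succ_of_le le (fun n => hsucc n ▸ hle n (s n)) h
  have hcommon : ∀ m n {a b a' b'}, R (s m) a b → R (s n) a' b' →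
      ∃ p, R p a b ∧ R p a' b' := fun m n _ _ _ _ h h' =>
    ⟨s (max m n), mono (hs (le_max_left _ _)) h, mono (hs (le_max_right _ _)) h'⟩
  choose F hF using fun a => hl _ (s (Encodable.encode (Sum.inl a : α ⊕ β))) a rfl
  choose G hG using fun b => hr _ (s (Encodable.encode (Sum.inr b : α ⊕ β))) b rfl
  have hF' : ∀ a, R (s (Encodable.encode (Sum.inl a : α ⊕ β) + 1)) a (F a) :=
    fun a => hsucc _ ▸ hF a
  have hG' : ∀ b, R (s (Encodable.encode (Sum.inr b : α ⊕ β) + 1)) (G b) b :=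
    fun b => hsucc _ ▸ hG b
  refine ⟨⟨F, G, fun a => ?_, fun b => ?_⟩, ?_⟩
  · obtain ⟨p, h, h'⟩ := hcommon _ _ (hG' (F a)) (hF' a)
    exact (inj h h').2 rfl
  · obtain ⟨p, h, h'⟩ := hcommon _ _ (hF' (G b)) (hG' b)
    exact (inj h h').1 rfl
  · exact fun a a' => hcommon _ _ (hF' a) (hF' a')

/-! ### A shuffle of countably many colours -/

/-- A countable dense linear order in which each of countably many colours is dense. -/
structure Shuffle where
  pos : ℚ
  colour : ℕ

namespace Shuffle

/-- The position of a point of the shuffle on the real line. -/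
noncomputable def val (a : Shuffle) : ℝ := a.pos + a.colour * √2

/-- Colour `n` occupies the translate of `ℚ` by `n√2`, and these translates are disjoint because
`√2` is irrational. -/
theorem val_injective : Function.Injective val := by
  rintro ⟨q, m⟩ ⟨r, n⟩ h
  simp only [val] at h
  have hmn : (m : ℚ) = n := by
    by_contra hne
    have h0 : ((m : ℚ) - n) ≠ 0 := sub_ne_zero.2 hne
    have h0' : ((m : ℝ) - n) ≠ 0 := by exact_mod_cast h0
    refine irrational_sqrt_two ⟨(r - q) / (m - n), ?_⟩
    push_cast
    rw [div_eq_iff h0']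
    linarith
  obtain rfl : m = n := by exact_mod_cast hmn
  have : (q : ℝ) = r := by linarith
  rw [Rat.cast_injective this]

noncomputable instance : LinearOrder Shuffle := LinearOrder.lift' val val_injective

theorem val_lt_val {a b : Shuffle} : a.val < b.val ↔ a < b := Iff.rfl

theorem equiv_injective : Function.Injective fun a : Shuffle => (a.pos, a.colour) := by
  rintro ⟨q, m⟩ ⟨r, n⟩ h
  simpa using h

instance : Countable Shuffle := equiv_injective.countable

instance : Nonempty Shuffle := ⟨⟨0, 0⟩⟩

theorem exists_between_of_colour (n : ℕ) (lo hi : Finset Shuffle) (h : ∀ x ∈ lo, ∀ y ∈ hi, x < y) :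
    ∃ m : Shuffle, m.colour = n ∧ (∀ x ∈ lo, x < m) ∧ ∀ y ∈ hi, m < y := by
  classical
  obtain ⟨u, hu, hu'⟩ := Order.exists_between_finsets (lo.image val) (hi.image val) (by
    simpa [Finset.forall_mem_image, val_lt_val] using h)
  -- A second point `w` leaves an open interval `(u, w)` in which a rational translate of `n√2` can
  -- be placed, even if `lo` or `hi` is empty.
  obtain ⟨w, hw, hw'⟩ := Order.exists_between_finsets {u} (hi.image val) (by simpa using hu')
  simp only [Finset.forall_mem_image, Finset.mem_singleton, forall_eq] at hu hw hw'
  obtain ⟨q, hq, hq'⟩ := exists_rat_btwn (sub_lt_sub_right hw (n * √2))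
  have h1 : u < val ⟨q, n⟩ := by simp only [val]; linarith
  have h2 : val ⟨q, n⟩ < w := by simp only [val]; linarith
  exact ⟨⟨q, n⟩, rfl, fun x hx => (hu hx).trans h1, fun y hy => h2.trans (hw' hy)⟩

/-- Finite partial automorphisms of the shuffle that permute the colours by `π`. -/
def IsPartialIso (π : Equiv.Perm ℕ) (f : Finset (Shuffle × Shuffle)) : Prop :=
  (∀ p ∈ f, ∀ q ∈ f, p.1 < q.1 ↔ p.2 < q.2) ∧ ∀ p ∈ f, p.2.colour = π p.1.colour

theorem IsPartialIso.exists_left {π : Equiv.Perm ℕ} {f : Finset (Shuffle × Shuffle)}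
    (hf : IsPartialIso π f) (a : Shuffle) : ∃ g, f ⊆ g ∧ IsPartialIso π g ∧ ∃ b, (a, b) ∈ g := by
  classical
  by_cases ha : ∃ b, (a, b) ∈ f
  · exact ⟨f, subset_rfl, hf, ha⟩
  obtain ⟨b, hb, hlo, hhi⟩ := exists_between_of_colour (π a.colour)
    ((f.filter fun p => p.1 < a).image Prod.snd) ((f.filter fun p => a < p.1).image Prod.snd) (by
      simp only [Finset.forall_mem_image, Finset.mem_filter]
      exact fun p hp q hq => (hf.1 p hp.1 q hq.1).1 (hp.2.trans hq.2))
  simp only [Finset.forall_mem_image, Finset.mem_filter, and_imp] at hlo hhi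
  have hne : ∀ p ∈ f, p.1 ≠ a := fun p hp h => ha ⟨p.2, h ▸ hp⟩
  have key : ∀ p ∈ f, (p.1 < a ↔ p.2 < b) ∧ (a < p.1 ↔ b < p.2) := by
    intro p hp
    rcases (hne p hp).lt_or_gt with h | h
    · exact ⟨iff_of_true h (hlo hp h), iff_of_false h.asymm (hlo hp h).asymm⟩
    · exact ⟨iff_of_false h.asymm (hhi hp h).asymm, iff_of_true h (hhi hp h)⟩
  refine ⟨insert (a, b) f, Finset.subset_insert _ _, ⟨?_, ?_⟩, b, Finset.mem_insert_self _ _⟩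
  · simp only [Finset.forall_mem_insert, lt_self_iff_false, true_and]
    exact ⟨fun p hp => (key p hp).2, fun p hp => ⟨(key p hp).1, hf.1 p hp⟩⟩
  · simp only [Finset.forall_mem_insert]
    exact ⟨hb, hf.2⟩

theorem IsPartialIso.swap {π : Equiv.Perm ℕ} {f : Finset (Shuffle × Shuffle)}
    (hf : IsPartialIso π f) : IsPartialIso π.symm (f.map (Equiv.prodComm _ _).toEmbedding) := by
  simp only [IsPartialIso, Finset.forall_mem_map]
  exact ⟨fun p hp q hq => (hf.1 p hp q hq).symm, fun p hp => by simp [hf.2 p hp]⟩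

theorem IsPartialIso.exists_right {π : Equiv.Perm ℕ} {f : Finset (Shuffle × Shuffle)}
    (hf : IsPartialIso π f) (b : Shuffle) : ∃ g, f ⊆ g ∧ IsPartialIso π g ∧ ∃ a, (a, b) ∈ g := by
  obtain ⟨g, hg, hiso, a, ha⟩ := hf.swap.exists_left b
  refine ⟨g.map (Equiv.prodComm _ _).toEmbedding, fun p hp => ?_, hiso.swap, a, ?_⟩
  · exact Finset.mem_map.2 ⟨p.swap, hg (Finset.mem_map.2 ⟨p, hp, rfl⟩), rfl⟩
  · exact Finset.mem_map.2 ⟨_, ha, rfl⟩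

/-- Since each colour is dense, a finite partial automorphism can always be extended by a point of
the required colour, and back-and-forth applies. -/
theorem exists_orderIso (π : Equiv.Perm ℕ) :
    ∃ τ : Shuffle ≃o Shuffle, ∀ a, (τ a).colour = π a.colour := by
  have := Encodable.ofCountable Shuffle
  obtain ⟨e, he⟩ := exists_equiv_of_back_and_forth
    (P := {f : Finset (Shuffle × Shuffle) // IsPartialIso π f}) (· ≤ ·)
    (fun f a b => (a, b) ∈ f.1) ⟨∅, by simp [IsPartialIso]⟩ (fun h h' => h h')
    (fun f a => by
      obtain ⟨g, hg, hiso, hb⟩ := f.2.exists_left a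
      exact ⟨⟨g, hiso⟩, hg, hb⟩)
    (fun f b => by
      obtain ⟨g, hg, hiso, ha⟩ := f.2.exists_right b
      exact ⟨⟨g, hiso⟩, hg, ha⟩)
    (fun {f a b a' b'} h h' => by
      have h1 := f.2.1 _ h _ h'
      have h2 := f.2.1 _ h' _ h
      simp only [le_antisymm_iff, ← not_lt] at h1 h2 ⊢
      rw [h1, h2])
  have hlt : ∀ {a a'}, e a < e a' ↔ a < a' := fun {a a'} => by
    obtain ⟨f, h, h'⟩ := he a a'
    exact (f.2.1 _ h _ h').symm
  refine ⟨⟨e, fun {a b} => ?_⟩, fun a => ?_⟩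
  · rw [← not_lt, ← not_lt, hlt]
  · obtain ⟨f, h, -⟩ := he a a
    exact f.2.2 _ h

end Shuffle

/-! ### The tree of finite sequences in the shuffle -/

/-- Lists of equal length differ at a first entry, which extending `w` does not change. -/
theorem append_lt_of_lt {A : Type*} [LinearOrder A] :
    ∀ {u w : List A} (r : List A), w.length = u.length → w < u → w ++ r < u
  | [], [], _, _, h => (lt_irrefl _ h).elim
  | x :: u, y :: w, r, hl, h => by
    rw [List.cons_lt_cons_iff] at h
    rw [List.cons_append, List.cons_lt_cons_iff]
    exact h.imp_right fun h => ⟨h.1, append_lt_of_lt r (by simpa using hl) h.2⟩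

/-- Thus `w` is the greatest list of its length below `w ++ [a]`: a parent is recovered from the
order and the lengths alone. -/
theorem lt_append_singleton_iff {A : Type*} [LinearOrder A] {u w : List A} (a : A)
    (h : u.length = w.length) : u < w ++ [a] ↔ u ≤ w := by
  refine ⟨fun h' => ?_, fun h' => h'.trans_lt ?_⟩
  · by_contra! hlt
    exact h'.asymm (append_lt_of_lt [a] h.symm hlt)
  · refine lt_of_le_of_ne (not_lt.1 (List.IsPrefix.le (List.prefix_append w [a]))) fun h => ?_
    simpa using congrArg List.length h

/-- An automorphism of the lexicographic order on lists that preserves lengths maps children to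
children. -/
theorem exists_orderIso_append_singleton {A : Type*} [LinearOrder A] (e : List A ≃o List A)
    (he : ∀ s, (e s).length = s.length) (s : List A) (a : A) :
    ∃ b, e (s ++ [a]) = e s ++ [b] := by
  have hlen : (e (s ++ [a])).length = s.length + 1 := by simp [he]
  obtain ⟨w, b, hw⟩ := List.eq_nil_or_concat (e (s ++ [a])) |>.resolve_left (by
    intro h; simp [h] at hlen)
  simp only [List.concat_eq_append] at hw
  refine ⟨b, ?_⟩
  have hwl : w.length = s.length := by simpa [hw] using hlen
  have hsl : (e.symm w).length = s.length := by rw [← he, e.apply_symm_apply, hwl]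
  rw [hw]
  congr 1
  refine le_antisymm ?_ ?_
  · rw [← e.symm_apply_le, ← lt_append_singleton_iff a hsl, ← e.lt_iff_lt, hw, e.apply_symm_apply,
      lt_append_singleton_iff b rfl]
  · rw [← lt_append_singleton_iff b (by rw [he, hwl]), ← hw, e.lt_iff_lt,
      lt_append_singleton_iff a rfl]

/-! ### Coding graphs by coloured orders -/

theorem getElem?_of_prefix {α : Type*} {s t : List α} (h : s <+: t) {i : ℕ} {a : α}
    (hs : s[i]? = some a) : t[i]? = some a := by
  obtain ⟨r, rfl⟩ := h
  rwa [List.getElem?_append_left (List.getElem?_eq_some_iff.1 hs).1]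

open Classical in
/-- The equality and adjacency pattern of a finite sequence of vertices. -/
noncomputable def adjPattern (G : SimpleGraph ℕ) (l : List ℕ) : List (List (Bool × Bool)) :=
  l.map fun m => l.map fun n => (decide (m = n), decide (G.Adj m n))

theorem adjPattern_map {G H : SimpleGraph ℕ} (e : G ≃g H) (l : List ℕ) :
    adjPattern H (l.map e) = adjPattern G l := by
  simp [adjPattern, Function.comp_def, e.map_adj_iff]

theorem length_eq_of_adjPattern_eq {G H : SimpleGraph ℕ} {l l' : List ℕ}
    (h : adjPattern G l = adjPattern H l') : l.length = l'.length := by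
  simpa [adjPattern] using congrArg List.length h

theorem iff_of_adjPattern_eq {G H : SimpleGraph ℕ} {l l' : List ℕ}
    (h : adjPattern G l = adjPattern H l') {i j m n m' n' : ℕ} (hm : l[i]? = some m)
    (hn : l[j]? = some n) (hm' : l'[i]? = some m') (hn' : l'[j]? = some n') :
    (m = n ↔ m' = n') ∧ (G.Adj m n ↔ H.Adj m' n') := by
  have h1 := congrArg (fun M => M[i]?.bind fun r => r[j]?) h
  simpa [adjPattern, hm, hn, hm', hn'] using h1

theorem measurable_encode_map {Ω α β : Type*} [MeasurableSpace Ω] [Encodable β] {f : Ω → α → β}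
    (hf : ∀ a, Measurable fun ω => Encodable.encode (f ω a)) (l : List α) :
    Measurable fun ω => Encodable.encode (l.map (f ω)) := by
  induction l with
  | nil => exact measurable_const
  | cons a l ih =>
    simp only [List.map_cons, Encodable.encode_list_cons]
    exact (Measurable.of_discrete (f := fun p : ℕ × ℕ => (Nat.pair p.1 p.2).succ)).comp
      ((hf a).prodMk ih)

theorem measurable_encode_adjPattern (l : List ℕ) :
    Measurable fun G : SimpleGraph ℕ => Encodable.encode (adjPattern G l) := by
  refine measurable_encode_map (fun m => measurable_encode_map (fun n => ?_) l) l
  classical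
  exact (measurable_from_top (f := fun p : Prop => Encodable.encode (decide (m = n), decide p))).comp
    (SimpleGraph.measurable_iff_adj.1 measurable_id m n)

/-- The colouring of the tree of finite sequences in the shuffle that codes a graph. -/
noncomputable def graphColouring (G : SimpleGraph ℕ) (s : List Shuffle) : ℕ :=
  Encodable.encode (adjPattern G (s.map Shuffle.colour))

/-- The vertex permutation is realised as a permutation of colours by an automorphism of the
shuffle, applied entrywise to lists; adjacency patterns are invariant. -/
theorem exists_orderIso_of_graphIso {G H : SimpleGraph ℕ} (e : G ≃g H) :
    ∃ f : List Shuffle ≃o List Shuffle, ∀ s, graphColouring H (f s) = graphColouring G s := by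
  obtain ⟨τ, hτ⟩ := Shuffle.exists_orderIso e.toEquiv
  have hmono : StrictMono (List.map τ) := fun s t h => List.map_lt (fun _ _ h => τ.strictMono h) h
  refine ⟨⟨⟨List.map τ, List.map τ.symm, fun s => by simp [Function.comp_def],
    fun s => by simp [Function.comp_def]⟩,
    hmono.le_iff_le⟩, fun s => ?_⟩
  have : (s.map τ).map Shuffle.colour = (s.map Shuffle.colour).map e := by
    simp [Function.comp_def, hτ]
  change Encodable.encode (adjPattern H ((s.map τ).map Shuffle.colour)) = _
  rw [this, adjPattern_map, graphColouring]

/-- The colour of a list determines its length, so `e` preserves lengths and hence prefixes. Each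
list and its image then give a finite partial isomorphism of the graphs, and prolonging the list
prolongs it. -/
theorem nonempty_graphIso_of_orderIso {G H : SimpleGraph ℕ} (e : List Shuffle ≃o List Shuffle)
    (he : ∀ s, graphColouring H (e s) = graphColouring G s) : Nonempty (G ≃g H) := by
  have hpat : ∀ s, adjPattern G (s.map Shuffle.colour) = adjPattern H ((e s).map Shuffle.colour) :=
    fun s => Encodable.encode_injective (he s).symm
  have hlen : ∀ s, (e s).length = s.length := fun s => by
    simpa using (length_eq_of_adjPattern_eq (hpat s)).symm
  have hlen' : ∀ s, (e.symm s).length = s.length := fun s => by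
    rw [← hlen, e.apply_symm_apply]
  have hpre : ∀ {s t : List Shuffle}, s <+: t → e s <+: e t := by
    rintro s t ⟨r, rfl⟩
    induction r using List.reverseRecOn with
    | nil => simp
    | append_singleton r a ih =>
      obtain ⟨b, hb⟩ := exists_orderIso_append_singleton e hlen (s ++ r) a
      rw [← List.append_assoc, hb]
      exact ih.trans (List.prefix_append _ _)
  -- The vertices `m` and `n` occur at the same place in `s` and in `e s`; equality of the patterns
  -- makes this a partial isomorphism.
  let R : List Shuffle → ℕ → ℕ → Prop := fun s m n => ∃ i : ℕ,
    (s.map Shuffle.colour)[i]? = some m ∧ ((e s).map Shuffle.colour)[i]? = some n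
  have hR : ∀ {s m n m' n'}, R s m n → R s m' n' →
      (m = m' ↔ n = n') ∧ (G.Adj m m' ↔ H.Adj n n') := by
    rintro s m n m' n' ⟨i, hm, hn⟩ ⟨j, hm', hn'⟩
    exact iff_of_adjPattern_eq (hpat s) hm hm' hn hn'
  have hchild : ∀ s a b, e (s ++ [a]) = e s ++ [b] → R (s ++ [a]) a.colour b.colour := by
    intro s a b h
    refine ⟨s.length, by simp, ?_⟩
    rw [h, ← hlen s]
    simp
  have : Std.Refl (α := List Shuffle) (· <+: ·) := ⟨List.prefix_refl⟩
  have : IsTrans (List Shuffle) (· <+: ·) := ⟨fun _ _ _ => List.IsPrefix.trans⟩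
  obtain ⟨f, hf⟩ := exists_equiv_of_back_and_forth (P := List Shuffle) (· <+: ·) R []
    (by
      rintro s t m n h ⟨i, hm, hn⟩
      exact ⟨i, getElem?_of_prefix (h.map _) hm, getElem?_of_prefix ((hpre h).map _) hn⟩)
    -- Any vertex can be put in the domain by appending a point of that colour; for the range, this
    -- is done on the side of `e s` and pulled back by `e.symm`.
    (fun s m => by
      obtain ⟨b, hb⟩ := exists_orderIso_append_singleton e hlen s ⟨0, m⟩
      exact ⟨_, List.prefix_append _ _, _, hchild _ _ _ hb⟩)
    (fun s n => by
      obtain ⟨a, ha⟩ := exists_orderIso_append_singleton e.symm hlen' (e s) ⟨0, n⟩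
      refine ⟨s ++ [a], List.prefix_append _ _, _, hchild s a ⟨0, n⟩ ?_⟩
      rw [e.symm_apply_apply] at ha
      rw [← ha, e.apply_symm_apply])
    (fun h h' => (hR h h').1)
  refine ⟨⟨f, fun {m n} => ?_⟩⟩
  obtain ⟨s, h, h'⟩ := hf m n
  exact (hR h h').2.symm

theorem graphIso_le_intervalConjugacy : BorelReducible graphIso intervalConjugacy := by
  obtain ⟨w⟩ := nonempty_lengths (List Shuffle)
  refine ⟨fun G => w.patterned (graphColouring G),
    w.measurable_patterned fun s => measurable_encode_adjPattern _, fun G H => ⟨?_, fun h => ?_⟩⟩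
  · rintro ⟨e⟩
    obtain ⟨f, hf⟩ := exists_orderIso_of_graphIso e
    exact w.conj_of_orderIso f hf
  · obtain ⟨e, he⟩ := w.exists_orderIso_of_conj h
    exact nonempty_graphIso_of_orderIso e he

end BorelComplexity

/-! ### Closing the cycle of reductions. -/

theorem mainTheorem1 :
    -- a universal orbit equivalence relation of `S_∞` exists
    (∃ (X : Type) (_ : MeasurableSpace X) (_ : StandardBorelSpace X) (E : Setoid X),
      BorelComplexity.IsUniversalSInftyOrbitRel E) ∧
    -- conjugacy of interval maps is Borel bireducible to it, whichever one is chosen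
    (∀ (X : Type u) [MeasurableSpace X] [StandardBorelSpace X] (E : Setoid X),
      BorelComplexity.IsUniversalSInftyOrbitRel E →
        BorelComplexity.BorelBireducible BorelComplexity.intervalConjugacy E) ∧
    BorelComplexity.ClassifiableByCountableStructures BorelComplexity.intervalConjugacy ∧
    BorelComplexity.BorelBireducible BorelComplexity.intervalConjugacy
      BorelComplexity.graphIso := by
  have hle := BorelComplexity.relFamilyIso_le_graphIso.trans
    BorelComplexity.graphIso_le_intervalConjugacy
  have hconj := BorelComplexity.intervalConjugacy_le_relFamilyIso
  have hgraph := hconj.trans BorelComplexity.relFamilyIso_le_graphIso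
  refine ⟨⟨BorelComplexity.RelFamily, inferInstance, inferInstance, BorelComplexity.relFamilyIso,
    BorelComplexity.isPolishSInftyOrbitRel_relFamilyIso,
    fun Y _ _ F hF => BorelComplexity.borelReducible_relFamilyIso hF⟩, ?_, ?_, hgraph,
    BorelComplexity.graphIso_le_intervalConjugacy⟩
  · intro X _ _ E hE
    exact ⟨hconj.trans (hE.2 _ _ BorelComplexity.isPolishSInftyOrbitRel_relFamilyIso),
      (BorelComplexity.borelReducible_relFamilyIso hE.1).trans hle⟩
  · exact ⟨FirstOrder.Language.graph, inferInstance, inferInstance,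
      hgraph.trans BorelComplexity.graphIso_le_structureIso⟩
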